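/- **Definitions.** All representations are over $\mathbb{Q}$, and $S_n\subset S_{n+1}$ is the subgroup fixing the last point. For a partition $\lambda=(\lambda_1\ge\dots\ge\lambda_l)$ of $k$ and $n\ge k+\lambda_1$, let $V(\lambda)_n$ be the irreducible $S_n$-representation (given by the Young symmetrizer) of the partition $(n-k,\lambda_1,\dots,\lambda_l)$ of $n$. The multiplicity $c_\lambda(V)$ of $V(\lambda)_n$ in a finite dimensional $S_n$-representation $V$ is taken to be $0$ if $n<k+\lambda_1$. A *consistent sequence* $\{V_n,\phi_n\}$ consists of $S_n$-representations $V_n$ and linear maps $\phi_n\colon V_n\to V_{n+1}$ that are equivariant for $S_n\hookrightarrow S_{n+1}$. It is *compatible with $G$-actions* for a group $G$ if $G$ acts linearly on each $V_n$, this action commutes with that of $S_n$, and the $\phi_n$ are $G$-equivariant. A consistent sequence is *monotone for $n\ge N$* if, for all $n\ge N$, the map $\phi_n$ is injective and, for each partition $\lambda$ such that $V(\lambda)_n$ is defined, each $k\geq 0$ and each subrepresentation $W\subset V_n$ isomorphic to $V(\lambda)_n^{\oplus k}$, the $S_{n+1}$-span of $\phi_n(W)$ contains a subrepresentation isomorphic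 to $V(\lambda)_{n+1}^{\oplus k}$. A consistent sequence of finite dimensional representations is *uniformly representation stable with stable range $n\ge N$* if for all $n\ge N$ the map $\phi_n$ is injective and the $S_{n+1}$-span of $\phi_n(V_n)$ is $V_{n+1}$, and for each partition $\lambda$ the multiplicity $c_\lambda(V_n)$ is constant for $n\ge N$. **Theorem (Representation stability with changing coefficients 2).** Let $X$ be a connected CW complex with finitely many cells in each dimension, and let $G=\pi_1(X,x_0)$. Let $\{V_n,\phi_n\}$ be a consistent sequence of finite dimensional rational representations of $S_n$ compatible with $G$-actions. If $\{V_n,\phi_n\}$ is monotone for $n\ge N$ and uniformly representation stable with stable range $n\geq N$, then for every integer $p\ge 0$ the sequence $\{H^p(X;V_n),\phi_n^*\}$ of (singular) cohomology groups with local coefficients in the $G$-modules $V_n$, with the $S_n$-action and the maps $\phi_n^*$ induced by the $S_n$-action on $V_n$ and by $\phi_n$, is a consistent sequence of finite dimensional representations, is monotone for $n\ge N$, and is uniformly representation stable with the same stable range $n\ge N$. -/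

import Mathlib

open CategoryTheory
open scoped MonoidAlgebra

universe u v w

namespace RepStability

noncomputable section

/-! ## Irreducible representations of the symmetric groups

Partitions are Young diagrams; a partition of `n` is a Young diagram with `n` cells. -/

/-- The padded partition `lam[n] = (n - |lam|, lam_1, lam_2, ...)`, for `n ≥ |lam| + lam_1`. -/
def padded (lam : YoungDiagram) (n : ℕ) (h : lam.card + lam.rowLen 0 ≤ n) : YoungDiagram where
  cells := (Finset.range (n - lam.card)).image (fun j => ((0 : ℕ), j)) ∪
    lam.cells.image (fun c => (c.1 + 1, c.2))
  isLowerSet := by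
    rintro ⟨a, b⟩ ⟨a', b'⟩ ⟨h1, h2⟩ hab
    simp only [Finset.coe_union, Finset.coe_image, Set.mem_union, Set.mem_image, Finset.mem_coe,
      Finset.mem_range, Prod.mk.injEq, YoungDiagram.mem_cells, Prod.exists] at hab ⊢
    simp only at h1 h2
    rcases hab with ⟨j, hj, h0, rfl⟩ | ⟨i, j, hij, rfl, rfl⟩
    · exact Or.inl ⟨b', by omega, by omega, rfl⟩
    · rcases a' with _ | a'
      · have := YoungDiagram.mem_iff_lt_rowLen.1 (lam.up_left_mem (Nat.zero_le i) h2 hij)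
        exact Or.inl ⟨b', by omega, rfl, rfl⟩
      · exact Or.inr ⟨a', b', lam.up_left_mem (by omega) h2 hij, rfl, rfl⟩

lemma card_padded (lam : YoungDiagram) (n : ℕ) (h : lam.card + lam.rowLen 0 ≤ n) :
    (padded lam n h).cells.card = n := by
  have hd : Disjoint ((Finset.range (n - lam.card)).image (fun j => ((0 : ℕ), j)))
      (lam.cells.image (fun c => (c.1 + 1, c.2))) := by
    rw [Finset.disjoint_left]
    rintro ⟨a, b⟩ h1 h2
    simp only [Finset.mem_image, Prod.mk.injEq] at h1 h2
    obtain ⟨_, _, h1, _⟩ := h1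
    obtain ⟨_, _, h2, _⟩ := h2
    omega
  have e1 : ((Finset.range (n - lam.card)).image (fun j => ((0 : ℕ), j))).card = n - lam.card := by
    rw [Finset.card_image_of_injective _ (fun a b hab => by simpa using hab), Finset.card_range]
  have e2 : (lam.cells.image (fun c => (c.1 + 1, c.2))).card = lam.card :=
    Finset.card_image_of_injective _ (fun a b hab => by
      simp only [Prod.mk.injEq, add_left_inj] at hab
      exact Prod.ext hab.1 hab.2)
  rw [padded, Finset.card_union_of_disjoint hd, e1, e2]
  omega

/-- A tableau of shape `mu`: a numbering of the cells of `mu` by `Fin n`, for `mu` with `n` cells.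
(A different numbering gives an isomorphic representation below.) -/
def tableau {n : ℕ} (mu : YoungDiagram) (h : mu.cells.card = n) : Fin n ≃ mu.cells :=
  (Finset.equivFinOfCardEq h).symm

open Classical in
/-- The Young symmetrizer `c = (∑ p) * (∑ sign q • q)` in `ℚ[S_n]` of the tableau of shape `mu`:
`p` runs over the permutations preserving each row, `q` over those preserving each column. -/
def youngSymmetrizer {n : ℕ} (mu : YoungDiagram) (h : mu.cells.card = n) :
    ℚ[Equiv.Perm (Fin n)] :=
  (∑ p : Equiv.Perm (Fin n) with
      ∀ i, (tableau mu h (p i)).1.1 = (tableau mu h i).1.1,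
    MonoidAlgebra.of ℚ (Equiv.Perm (Fin n)) p) *
  (∑ q : Equiv.Perm (Fin n) with
      ∀ i, (tableau mu h (q i)).1.2 = (tableau mu h i).1.2,
    ((Equiv.Perm.sign q : ℤ) : ℚ) • MonoidAlgebra.of ℚ (Equiv.Perm (Fin n)) q)

/-- The underlying space of the irreducible representation `V_mu` of `S_n`: the left ideal
`ℚ[S_n] * c` generated by the Young symmetrizer. -/
abbrev Irrep {n : ℕ} (mu : YoungDiagram) (h : mu.cells.card = n) : Type :=
  (Ideal.span {youngSymmetrizer mu h} : Ideal ℚ[Equiv.Perm (Fin n)])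

/-- `S_n` acts on `V_mu` by left multiplication. -/
def irrep {n : ℕ} (mu : YoungDiagram) (h : mu.cells.card = n) :
    Representation ℚ (Equiv.Perm (Fin n)) (Irrep mu h) :=
  Representation.ofModule' (Irrep mu h)

/-! ## Monotonicity and uniform representation stability -/

/-- The subspace `W` of `V` is a subrepresentation isomorphic to the direct sum of `k` copies
of the representation `τ`. -/
def IsSumOfCopies {H : Type*} [Group H] {V U : Type*} [AddCommGroup V] [Module ℚ V]
    [AddCommGroup U] [Module ℚ U] (ρ : Representation ℚ H V) (τ : Representation ℚ H U)
    (k : ℕ) (W : Submodule ℚ V) : Prop :=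
  ∃ f : (Fin k → U) →ₗ[ℚ] V, Function.Injective f ∧ LinearMap.range f = W ∧
    ∀ (g : H) (x : Fin k → U), f (fun j => τ g (x j)) = ρ g (f x)

/-- The multiplicity of an irreducible representation `τ` in a finite dimensional representation:
the largest `k` such that the direct sum of `k` copies of `τ` is a subrepresentation. -/
def multiplicity {H : Type*} [Group H] {V U : Type*} [AddCommGroup V] [Module ℚ V]
    [AddCommGroup U] [Module ℚ U] (ρ : Representation ℚ H V) (τ : Representation ℚ H U) : ℕ :=
  sSup {k : ℕ | ∃ W : Submodule ℚ V, IsSumOfCopies ρ τ k W}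

/-- The multiplicity `c_lam(V)` of `V(lam)_n = V_{lam[n]}` in a representation `V` of `S_n`
(zero if `V(lam)_n` is not defined, that is, if `n < |lam| + lam_1`). -/
def paddedMultiplicity {n : ℕ} {V : Type*} [AddCommGroup V] [Module ℚ V]
    (ρ : Representation ℚ (Equiv.Perm (Fin n)) V) (lam : YoungDiagram) : ℕ :=
  if h : lam.card + lam.rowLen 0 ≤ n then
    multiplicity ρ (irrep (padded lam n h) (card_padded lam n h))
  else 0

/-- The span of the translates of the subspace `W` under the group. -/
def orbitSpan {H : Type*} [Group H] {V : Type*} [AddCommGroup V] [Module ℚ V]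
    (ρ : Representation ℚ H V) (W : Submodule ℚ V) : Submodule ℚ V :=
  ⨆ g : H, W.map (ρ g)

/-- The natural inclusion of `S_n` in `S_{n+1}`, fixing the last point. -/
def permInclusion (n : ℕ) : Equiv.Perm (Fin n) →* Equiv.Perm (Fin (n + 1)) :=
  Equiv.Perm.viaEmbeddingHom Fin.castSuccEmb

section Sequences

variable {V : ℕ → Type v} [∀ n, AddCommGroup (V n)] [∀ n, Module ℚ (V n)]

/-- A consistent sequence of representations of the symmetric groups. -/
def IsConsistent (ρ : ∀ n, Representation ℚ (Equiv.Perm (Fin n)) (V n))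
    (φ : ∀ n, V n →ₗ[ℚ] V (n + 1)) : Prop :=
  ∀ (n : ℕ) (s : Equiv.Perm (Fin n)) (x : V n),
    φ n (ρ n s x) = ρ (n + 1) (permInclusion n s) (φ n x)

/-- The consistent sequence is monotone for `n ≥ N`. -/
structure IsMonotone (ρ : ∀ n, Representation ℚ (Equiv.Perm (Fin n)) (V n))
    (φ : ∀ n, V n →ₗ[ℚ] V (n + 1)) (N : ℕ) : Prop where
  consistent : IsConsistent ρ φ
  injective : ∀ n, N ≤ n → Function.Injective (φ n)
  contains : ∀ n, N ≤ n → ∀ (lam : YoungDiagram) (h : lam.card + lam.rowLen 0 ≤ n) (k : ℕ)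
    (W : Submodule ℚ (V n)),
    IsSumOfCopies (ρ n) (irrep (padded lam n h) (card_padded lam n h)) k W →
    ∃ W' : Submodule ℚ (V (n + 1)), W' ≤ orbitSpan (ρ (n + 1)) (W.map (φ n)) ∧
      IsSumOfCopies (ρ (n + 1))
        (irrep (padded lam (n + 1) (h.trans n.le_succ)) (card_padded lam (n + 1) _)) k W'

/-- The sequence of finite dimensional representations is uniformly representation stable with
stable range `n ≥ N`. -/
structure IsUniformlyRepStable (ρ : ∀ n, Representation ℚ (Equiv.Perm (Fin n)) (V n))
    (φ : ∀ n, V n →ₗ[ℚ] V (n + 1)) (N : ℕ) : Prop where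
  finiteDimensional : ∀ n, FiniteDimensional ℚ (V n)
  consistent : ∀ n, N ≤ n → ∀ (s : Equiv.Perm (Fin n)) (x : V n),
    φ n (ρ n s x) = ρ (n + 1) (permInclusion n s) (φ n x)
  injective : ∀ n, N ≤ n → Function.Injective (φ n)
  surjective : ∀ n, N ≤ n → orbitSpan (ρ (n + 1)) (LinearMap.range (φ n)) = ⊤
  multiplicityStable : ∀ (lam : YoungDiagram) (m n : ℕ), N ≤ m → N ≤ n →
    paddedMultiplicity (ρ m) lam = paddedMultiplicity (ρ n) lam

/-- The sequence is compatible with the `G`-actions `α n` on the `V n`. -/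
structure IsCompatible {G : Type*} [Group G] (α : ∀ n, Representation ℚ G (V n))
    (ρ : ∀ n, Representation ℚ (Equiv.Perm (Fin n)) (V n))
    (φ : ∀ n, V n →ₗ[ℚ] V (n + 1)) : Prop where
  equivariant : ∀ (n : ℕ) (g : G) (x : V n), φ n (α n g x) = α (n + 1) g (φ n x)
  commute : ∀ (n : ℕ) (g : G) (s : Equiv.Perm (Fin n)) (x : V n),
    ρ n s (α n g x) = α n g (ρ n s x)

end Sequences

/-! ## Singular cohomology with local coefficients -/

/-- The standard `p`-simplex. -/
abbrev Simplex (p : ℕ) : Type := stdSimplex ℝ (Fin (p + 1))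

/-- The inclusion of the `i`-th face, the face opposite to the `i`-th vertex. -/
def face (p : ℕ) (i : Fin (p + 2)) : C(Simplex p, Simplex (p + 1)) :=
  ⟨stdSimplex.map i.succAbove, stdSimplex.continuous_map _⟩

/-- The initial vertex of the standard `p`-simplex. -/
def vertexZero (p : ℕ) : Simplex p := stdSimplex.vertex 0

/-- The straight path between two points of the standard simplex. -/
def segmentPath {p : ℕ} (a b : Simplex p) : Path a b where
  toFun t := ⟨AffineMap.lineMap (k := ℝ) a.1 b.1 (t : ℝ),
    (convex_stdSimplex ℝ (Fin (p + 1))).lineMap_mem a.2 b.2 t.2⟩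
  continuous_toFun := by
    refine Continuous.subtype_mk ?_ _
    exact AffineMap.lineMap_continuous.comp continuous_subtype_val
  source' := Subtype.ext (AffineMap.lineMap_apply_zero (k := ℝ) a.1 b.1)
  target' := Subtype.ext (AffineMap.lineMap_apply_one (k := ℝ) a.1 b.1)

section Cohomology

variable {X : Type u} [TopologicalSpace X]

/-- For a singular simplex `τ` of dimension `p + 1`, the class of the path in `X` which is the
image under `τ` of the edge from the initial vertex of the `i`-th face of the simplex to the initial
vertex of the simplex (a constant path if `i ≠ 0`). -/
def edge {p : ℕ} (τ : C(Simplex (p + 1), X)) (i : Fin (p + 2)) :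
    FundamentalGroupoid.mk ((τ.comp (face p i)) (vertexZero p)) ⟶
      FundamentalGroupoid.mk (τ (vertexZero (p + 1))) :=
  (FundamentalGroupoid.map τ).map
    (X := .mk (face p i (vertexZero p))) (Y := .mk (vertexZero (p + 1)))
    (Path.Homotopic.Quotient.mk (segmentPath (face p i (vertexZero p)) (vertexZero (p + 1))))

/-- Singular `p`-cochains of `X` with coefficients in the local system `L`: a cochain assigns
to each singular simplex `σ` an element of the fibre of `L` at the initial vertex of `σ`. -/
abbrev Cochain (L : FundamentalGroupoid X ⥤ ModuleCat.{w} ℚ) (p : ℕ) : Type (max u w) :=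
  ∀ σ : C(Simplex p, X), L.obj (FundamentalGroupoid.mk (σ (vertexZero p)))

/-- The coboundary `(δ c) τ = ∑ i, (-1)^i c (i-th face of τ)`, where the values of `c` are
transported along edges of `τ` to the fibre over the initial vertex of `τ`. -/
def coboundary (L : FundamentalGroupoid X ⥤ ModuleCat.{w} ℚ) (p : ℕ) :
    Cochain L p →ₗ[ℚ] Cochain L (p + 1) :=
  LinearMap.pi fun τ => ∑ i : Fin (p + 2), ((-1 : ℚ) ^ (i : ℕ)) •
    ((L.map (edge τ i)).hom ∘ₗ LinearMap.proj (τ.comp (face p i)))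

/-- The cocycles of degree `p`. -/
abbrev cocycles (L : FundamentalGroupoid X ⥤ ModuleCat.{w} ℚ) (p : ℕ) :
    Submodule ℚ (Cochain L p) :=
  LinearMap.ker (coboundary L p)

/-- The coboundaries of degree `p`. -/
def coboundaries (L : FundamentalGroupoid X ⥤ ModuleCat.{w} ℚ) :
    ∀ p : ℕ, Submodule ℚ (Cochain L p)
  | 0 => ⊥
  | p + 1 => LinearMap.range (coboundary L p)

/-- The cohomology `H^p(X; L)` with coefficients in the local system `L`:
cocycles modulo coboundaries. -/
abbrev Cohomology (L : FundamentalGroupoid X ⥤ ModuleCat.{w} ℚ) (p : ℕ) : Type (max u w) :=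
  cocycles L p ⧸ (coboundaries L p).comap (cocycles L p).subtype

/-- The map of cochains induced by a map of local systems. -/
def cochainMap {L L' : FundamentalGroupoid X ⥤ ModuleCat.{w} ℚ} (η : L ⟶ L') (p : ℕ) :
    Cochain L p →ₗ[ℚ] Cochain L' p :=
  LinearMap.pi fun σ => (η.app _).hom ∘ₗ LinearMap.proj σ

lemma cochainMap_coboundary {L L' : FundamentalGroupoid X ⥤ ModuleCat.{w} ℚ} (η : L ⟶ L')
    (p : ℕ) (c : Cochain L p) :
    cochainMap η (p + 1) (coboundary L p c) = coboundary L' p (cochainMap η p c) := by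
  funext τ
  simp only [cochainMap, coboundary, LinearMap.pi_apply, LinearMap.sum_apply, LinearMap.smul_apply,
    LinearMap.comp_apply, LinearMap.proj_apply, map_sum, map_smul]
  refine Finset.sum_congr rfl fun i _ => ?_
  congr 1
  exact congrArg (fun f => f.hom (c (τ.comp (face p i)))) (η.naturality (edge τ i))

lemma cochainMap_mem_cocycles {L L' : FundamentalGroupoid X ⥤ ModuleCat.{w} ℚ} (η : L ⟶ L')
    (p : ℕ) : ∀ c ∈ cocycles L p, cochainMap η p c ∈ cocycles L' p := by
  intro c hc
  rw [LinearMap.mem_ker] at hc ⊢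
  rw [← cochainMap_coboundary, hc, map_zero]

lemma cochainMap_mem_coboundaries {L L' : FundamentalGroupoid X ⥤ ModuleCat.{w} ℚ} (η : L ⟶ L')
    (p : ℕ) : ∀ c ∈ coboundaries L p, cochainMap η p c ∈ coboundaries L' p := by
  intro c hc
  cases p with
  | zero =>
    rw [coboundaries, Submodule.mem_bot] at hc ⊢
    rw [hc, map_zero]
  | succ p =>
    obtain ⟨b, rfl⟩ := hc
    exact ⟨cochainMap η p b, (cochainMap_coboundary η p b).symm⟩

/-- The map in cohomology induced by a map of local systems. -/
def cohomologyMap {L L' : FundamentalGroupoid X ⥤ ModuleCat.{w} ℚ} (η : L ⟶ L') (p : ℕ) :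
    Cohomology L p →ₗ[ℚ] Cohomology L' p :=
  Submodule.mapQ _ _ ((cochainMap η p).restrict (cochainMap_mem_cocycles η p))
    fun c hc => cochainMap_mem_coboundaries η p c hc

lemma cohomologyMap_id (L : FundamentalGroupoid X ⥤ ModuleCat.{w} ℚ) (p : ℕ) :
    cohomologyMap (𝟙 L) p = LinearMap.id := by
  ext c
  rfl

lemma cohomologyMap_comp {L L' L'' : FundamentalGroupoid X ⥤ ModuleCat.{w} ℚ} (η : L ⟶ L')
    (θ : L' ⟶ L'') (p : ℕ) :
    cohomologyMap (η ≫ θ) p = cohomologyMap θ p ∘ₗ cohomologyMap η p := by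
  ext c
  rfl

/-! ## The local system of a representation of the fundamental group -/

variable {x₀ : X} {V W : Type v} [AddCommGroup V] [Module ℚ V] [AddCommGroup W] [Module ℚ W]

/-- The fibre over `x` of the local system of a representation `α` of `π₁(X, x₀)` on `V`:
equivariant functions to `V` on the set of classes of paths from `x` to `x₀`. For `x = x₀` it is
identified with `V` by evaluation at the constant path. -/
def fibre (α : Representation ℚ (FundamentalGroup X x₀) V) (x : FundamentalGroupoid X) :
    Submodule ℚ ((x ⟶ FundamentalGroupoid.mk x₀) → V) where
  carrier := {f | ∀ (γ : x ⟶ FundamentalGroupoid.mk x₀) (g : FundamentalGroup X x₀),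
    f (γ ≫ g.toArrow) = α g (f γ)}
  add_mem' := by
    intro f f' hf hf' γ g
    simp only [Pi.add_apply, hf γ g, hf' γ g, map_add]
  zero_mem' := by
    intro γ g
    simp only [Pi.zero_apply, map_zero]
  smul_mem' := by
    intro r f hf γ g
    simp only [Pi.smul_apply, hf γ g, map_smul]

/-- Transport in the local system along the class of a path. -/
def transport (α : Representation ℚ (FundamentalGroup X x₀) V) {x y : FundamentalGroupoid X}
    (a : x ⟶ y) : fibre α x →ₗ[ℚ] fibre α y where
  toFun f := ⟨fun γ => f.1 (a ≫ γ), fun γ g => by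
    simpa only [Category.assoc] using f.2 (a ≫ γ) g⟩
  map_add' _ _ := rfl
  map_smul' _ _ := rfl

/-- The local system on `X` of a representation of `π₁(X, x₀)`; its monodromy at `x₀` is the given
representation. -/
def localSystem (α : Representation ℚ (FundamentalGroup X x₀) V) :
    FundamentalGroupoid X ⥤ ModuleCat.{max u v} ℚ where
  obj x := ModuleCat.of ℚ (fibre α x)
  map a := ModuleCat.ofHom (transport α a)
  map_id x := by
    ext f γ
    exact congrArg f.1 (Category.id_comp γ)
  map_comp a b := by
    ext f γ
    exact congrArg f.1 (Category.assoc a b γ)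

/-- The map of local systems induced by an equivariant map. -/
def localSystemMap {α : Representation ℚ (FundamentalGroup X x₀) V}
    {β : Representation ℚ (FundamentalGroup X x₀) W} (f : V →ₗ[ℚ] W)
    (hf : ∀ g x, f (α g x) = β g (f x)) : localSystem α ⟶ localSystem β where
  app _ := ModuleCat.ofHom
    { toFun := fun s => ⟨fun γ => f (s.1 γ), fun γ g =>
        (congrArg f (s.2 γ g)).trans (hf g (s.1 γ))⟩
      map_add' := fun s t => Subtype.ext (funext fun γ => map_add f (s.1 γ) (t.1 γ))
      map_smul' := fun r s => Subtype.ext (funext fun γ => map_smul f r (s.1 γ)) }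
  naturality _ _ _ := rfl

/-- `H^p(X; V)` for a representation `V` of the fundamental group of `X`. -/
abbrev LocalCohomology (α : Representation ℚ (FundamentalGroup X x₀) V) (p : ℕ) :
    Type (max u v) :=
  Cohomology (localSystem α) p

/-- The map `H^p(X; V) → H^p(X; W)` induced by an equivariant map `V → W`. -/
def localCohomologyMap {α : Representation ℚ (FundamentalGroup X x₀) V}
    {β : Representation ℚ (FundamentalGroup X x₀) W} (f : V →ₗ[ℚ] W)
    (hf : ∀ g x, f (α g x) = β g (f x)) (p : ℕ) :
    LocalCohomology α p →ₗ[ℚ] LocalCohomology β p :=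
  cohomologyMap (localSystemMap f hf) p

/-- The action on `H^p(X; V)` induced by an action of a group `H` on `V` that commutes with the
action of the fundamental group. -/
def localCohomologyRep {H : Type*} [Group H] (α : Representation ℚ (FundamentalGroup X x₀) V)
    (ρ : Representation ℚ H V) (hc : ∀ g s x, ρ s (α g x) = α g (ρ s x)) (p : ℕ) :
    Representation ℚ H (LocalCohomology α p) where
  toFun s := localCohomologyMap (ρ s) (fun g x => hc g s x) p
  map_one' := by
    have h : localSystemMap (ρ 1) (fun g x => hc g 1 x) = 𝟙 (localSystem α) := by
      ext x f
      refine Subtype.ext (funext fun γ => ?_)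
      exact congrArg (fun e : V →ₗ[ℚ] V => e (f.1 γ)) (map_one ρ)
    rw [localCohomologyMap, h, cohomologyMap_id]
    rfl
  map_mul' s t := by
    have h : localSystemMap (ρ (s * t)) (fun g x => hc g (s * t) x) =
        localSystemMap (ρ t) (fun g x => hc g t x) ≫
          localSystemMap (ρ s) (fun g x => hc g s x) := by
      ext x f
      refine Subtype.ext (funext fun γ => ?_)
      exact congrArg (fun e : V →ₗ[ℚ] V => e (f.1 γ)) (map_mul ρ s t)
    rw [localCohomologyMap, h, cohomologyMap_comp]
    rfl

end Cohomology

end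

end RepStability

/-! Let `e` be the Young idempotent of `lam[n]`, viewed in `ℚ[S_{n+1}]`, and `f` the Young
idempotent of `lam[n+1]`. The multiplicity of an irreducible representation is the dimension of the
image of its idempotent (`multiplicity_irrep`). Restriction from `S_{n+1}` to `S_n` is multiplicity
free, so `f ℚ[S_{n+1}] e` is spanned by a single element `t` (`exists_forall_corner_eq_smul`).

Monotonicity, applied to the copy of `V(lam)_n` generated by a nonzero vector of `e V_n`, shows that
`x ↦ t φ(x)` is injective from `e V_n` to `f V_{n+1}`. Equality of multiplicities makes it
bijective. Its inverse, composed with `f`, is a map `S : V_{n+1} → V_n` with `S t φ e = e`, `t φ S f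
= f` and `e S = S` (`exists_comparison`). Being determined by the other data, `S` commutes with all
operators that commute with the symmetric groups and with `φ`, in particular with `G`. The three
identities therefore hold between maps of `G`-modules and are preserved by every `ℚ`-linear functor
of the coefficients, such as `H^p`; no exactness is needed. In cohomology they give back
monotonicity, injectivity, generation and constant multiplicities. If `lam[n+1]` is defined and
`lam[n]` is not, then `f` is zero on `V_{n+1}`, hence on its cohomology. Injectivity and generation
may be tested on images of Young idempotents, because `1` is a combination of conjugates of these
(`one_mem_span_youngCentral`).

The representation theory over `ℚ` rests on positivity: `x * adj x = 0` forces `x = 0`.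
Multiplicity-freeness is Gelfand's trick: every permutation is conjugate to its inverse by a
permutation fixing the last point, so the centralizer of `ℚ[S_n]` in `ℚ[S_{n+1}]` is commutative.

It remains to see that `H^p` is finite dimensional. Over a convex set the local system is
trivialized by a framing, so cochains can be evaluated on affine chains; cone constructions provide
subdivision and prism operators, hence excision and homotopy invariance for the ranks of relative
cohomology. Relative to the space it is attached to, an `m`-cell has cohomology only in degree `m`,
of rank at most the bound on the fibres (`relRank_attach_le`). Finiteness of the skeleta then gives
the claim, since cells of dimension above `p` cannot add to `H^p`. -/

namespace RepStability

noncomputable section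


/-! ## Combinatorics of tableaux -/

/-- The number of cells of a Young diagram in the first `k` rows. -/
def topCard (mu : YoungDiagram) (k : ℕ) : ℕ := (mu.cells.filter fun c => c.1 < k).card

lemma card_filter_fst_eq (mu : YoungDiagram) (k : ℕ) :
    (mu.cells.filter fun c => c.1 = k).card = mu.rowLen k := by
  rw [YoungDiagram.rowLen_eq_card]
  rfl

lemma card_filter_snd_eq (mu : YoungDiagram) (j : ℕ) :
    (mu.cells.filter fun c => c.2 = j).card = mu.colLen j := by
  rw [YoungDiagram.colLen_eq_card]
  rfl

lemma card_filter_fst_lt_snd_eq (mu : YoungDiagram) (k j : ℕ) :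
    (mu.cells.filter fun c => c.1 < k ∧ c.2 = j).card = min k (mu.colLen j) := by
  have : (mu.cells.filter fun c => c.1 < k ∧ c.2 = j) =
      (Finset.range (min k (mu.colLen j))).image fun i => (i, j) := by
    ext ⟨a, b⟩
    simp only [Finset.mem_filter, YoungDiagram.mem_cells, Finset.mem_image, Finset.mem_range,
      Prod.mk.injEq, lt_min_iff]
    constructor
    · rintro ⟨h1, h2, rfl⟩
      exact ⟨a, ⟨h2, YoungDiagram.mem_iff_lt_colLen.1 h1⟩, rfl, rfl⟩
    · rintro ⟨i, ⟨h1, h2⟩, rfl, rfl⟩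
      exact ⟨YoungDiagram.mem_iff_lt_colLen.2 h2, h1, rfl⟩
  rw [this, Finset.card_image_of_injective _ fun a b h => (Prod.ext_iff.1 h).1, Finset.card_range]

lemma topCard_succ (mu : YoungDiagram) (k : ℕ) :
    topCard mu (k + 1) = topCard mu k + mu.rowLen k := by
  rw [topCard, topCard, ← card_filter_fst_eq, ← Finset.card_union_of_disjoint]
  · congr 1
    ext c
    simp only [Finset.mem_filter, Finset.mem_union]
    grind
  · rw [Finset.disjoint_filter]
    grind

lemma eq_of_topCard_eq {lam mu : YoungDiagram} (h : ∀ k, topCard lam k = topCard mu k) :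
    lam = mu := by
  have hr : ∀ k, lam.rowLen k = mu.rowLen k := by
    intro k
    have h1 := h (k + 1)
    rw [topCard_succ, topCard_succ, h k] at h1
    omega
  ext ⟨i, j⟩
  rw [YoungDiagram.mem_cells, YoungDiagram.mem_cells, YoungDiagram.mem_iff_lt_rowLen,
    YoungDiagram.mem_iff_lt_rowLen, hr]

section

variable {n : ℕ}

/-- The row of the entry `i` in the standard numbering of the cells of `mu`. -/
def tabRow (mu : YoungDiagram) (h : mu.cells.card = n) (i : Fin n) : ℕ := (tableau mu h i).1.1

/-- The column of the entry `i` in the standard numbering of the cells of `mu`. -/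
def tabCol (mu : YoungDiagram) (h : mu.cells.card = n) (i : Fin n) : ℕ := (tableau mu h i).1.2

lemma tab_inj (mu : YoungDiagram) (h : mu.cells.card = n) {i j : Fin n}
    (h1 : tabRow mu h i = tabRow mu h j) (h2 : tabCol mu h i = tabCol mu h j) : i = j :=
  (tableau mu h).injective (Subtype.ext (Prod.ext h1 h2))

lemma card_filter_tableau (mu : YoungDiagram) (h : mu.cells.card = n) (P : ℕ × ℕ → Prop)
    [DecidablePred P] :
    (Finset.univ.filter fun i : Fin n => P (tableau mu h i).1).card = (mu.cells.filter P).card := by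
  refine Finset.card_bij (fun i _ => (tableau mu h i).1) ?_ ?_ ?_
  · intro i hi
    simp only [Finset.mem_filter, Finset.mem_univ, true_and] at hi
    exact Finset.mem_filter.2 ⟨(tableau mu h i).2, hi⟩
  · intro i _ j _ hij
    exact (tableau mu h).injective (Subtype.ext hij)
  · intro c hc
    rw [Finset.mem_filter] at hc
    refine ⟨(tableau mu h).symm ⟨c, hc.1⟩, ?_, ?_⟩ <;> simp [hc.2]

variable {lam mu : YoungDiagram} (hl : lam.cells.card = n) (hm : mu.cells.card = n)
  (g : Equiv.Perm (Fin n))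

/-- Both counts are split by columns. For `lam` the column is taken in the tableau of `mu` permuted
by `g`, where the entry `i` sits at the place of `g⁻¹ i`. The bound `M` is left free so that the sum
can be made to contain any given column. -/
lemma card_lt_eq_sum : ∃ M₀ : ℕ, ∀ M, M₀ ≤ M → ∀ k,
    topCard lam k = ∑ j ∈ Finset.range M,
      (Finset.univ.filter fun i : Fin n => tabRow lam hl i < k ∧ tabCol mu hm (g⁻¹ i) = j).card ∧
    topCard mu k = ∑ j ∈ Finset.range M, min k (mu.colLen j) := by
  refine ⟨mu.cells.sup (fun c => c.2) + 1, fun M hM k => ⟨?_, ?_⟩⟩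
  · rw [topCard, ← card_filter_tableau lam hl fun c => c.1 < k,
      Finset.card_eq_sum_card_fiberwise (f := fun i => tabCol mu hm (g⁻¹ i))
        (t := Finset.range M)]
    · refine Finset.sum_congr rfl fun j _ => ?_
      rw [Finset.filter_filter]
      rfl
    · intro i _
      rw [Finset.mem_coe, Finset.mem_range]
      refine lt_of_lt_of_le (Nat.lt_succ_of_le ?_) hM
      exact Finset.le_sup (f := fun c : ℕ × ℕ => c.2) (tableau mu hm (g⁻¹ i)).2
  · rw [topCard, Finset.card_eq_sum_card_fiberwise (f := fun c => c.2)
        (t := Finset.range M)]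
    · refine Finset.sum_congr rfl fun j _ => ?_
      rw [Finset.filter_filter, card_filter_fst_lt_snd_eq]
    · intro c hc
      rw [Finset.mem_coe, Finset.mem_range]
      refine lt_of_lt_of_le (Nat.lt_succ_of_le ?_) hM
      exact Finset.le_sup (f := fun c : ℕ × ℕ => c.2) (Finset.mem_filter.1 hc).1

variable (hinj : ∀ i j, tabRow lam hl i = tabRow lam hl j →
  tabCol mu hm (g⁻¹ i) = tabCol mu hm (g⁻¹ j) → i = j)

-- The entries counted lie in distinct rows among the first `k`, and all of them lie in one column
-- of the permuted tableau; each fact gives one bound.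
include hinj in
lemma card_lt_le (k j : ℕ) :
    (Finset.univ.filter fun i : Fin n =>
      tabRow lam hl i < k ∧ tabCol mu hm (g⁻¹ i) = j).card ≤ min k (mu.colLen j) := by
  refine le_min ?_ ?_
  · rw [← Finset.card_range k]
    refine Finset.card_le_card_of_injOn (tabRow lam hl) ?_ ?_
    · intro i hi
      simp only [Finset.coe_filter, Finset.mem_univ, true_and, Set.mem_ofPred_eq] at hi
      simpa using hi.1
    · intro i hi i' hi' h
      simp only [Finset.coe_filter, Finset.mem_univ, true_and, Set.mem_ofPred_eq] at hi hi'
      exact hinj i i' h (hi.2.trans hi'.2.symm)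
  · rw [← card_filter_snd_eq, ← card_filter_tableau mu hm fun c => c.2 = j]
    refine Finset.card_le_card_of_injOn (fun i => g⁻¹ i) ?_ (g⁻¹.injective.injOn)
    intro i hi
    simp only [Finset.coe_filter, Finset.mem_univ, true_and, Set.mem_ofPred_eq] at hi ⊢
    exact hi.2

include hinj in
/-- If no two entries in the same row of one tableau are in the same column of another one,
then the shape of the first is dominated by that of the second. -/
lemma topCard_le (k : ℕ) : topCard lam k ≤ topCard mu k := by
  obtain ⟨M, hM⟩ := card_lt_eq_sum hl hm g
  rw [(hM M le_rfl k).1, (hM M le_rfl k).2]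
  exact Finset.sum_le_sum fun j _ => card_lt_le hl hm g hinj k j

end

section

variable {n : ℕ} {mu : YoungDiagram} (hm : mu.cells.card = n) (g : Equiv.Perm (Fin n))
  (hinj : ∀ i j, tabRow mu hm i = tabRow mu hm j →
    tabCol mu hm (g⁻¹ i) = tabCol mu hm (g⁻¹ j) → i = j)

-- For equal shapes the inequalities of `card_lt_le` sum to an equality, so each is an equality.
include hinj in
lemma card_lt_eq (k j : ℕ) :
    (Finset.univ.filter fun i : Fin n =>
      tabRow mu hm i < k ∧ tabCol mu hm (g⁻¹ i) = j).card = min k (mu.colLen j) := by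
  obtain ⟨M, hM⟩ := card_lt_eq_sum hm hm g
  obtain ⟨h1, h2⟩ := hM (max M (j + 1)) (le_max_left _ _) k
  exact (Finset.sum_eq_sum_iff_of_le (fun j _ => card_lt_le hm hm g hinj k j)).1
    (h1.symm.trans h2) j (Finset.mem_range.2 (lt_max_of_lt_right (Nat.lt_succ_self j)))

include hinj in
/-- A permutation such that no two entries in the same row of the tableau are in the same column
of the permuted tableau is the product of a row permutation and a column permutation. -/
lemma exists_row_col_factorization : ∃ p : Equiv.Perm (Fin n),
    (∀ i, tabRow mu hm (p i) = tabRow mu hm i) ∧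
      ∀ i, tabCol mu hm ((p⁻¹ * g) i) = tabCol mu hm i := by
  -- Let `k` be the row of `x` and `j` its column. Since `k` is less than the length of column `j`,
  -- the count of `card_lt_eq` grows when `k` is replaced by `k + 1`, so the row `k` contains an
  -- entry of the `j`-th column of the permuted tableau. Sending `x` to it is the row permutation
  -- sought.
  have hex : ∀ x : Fin n, ∃ i, tabRow mu hm i = tabRow mu hm x ∧
      tabCol mu hm (g⁻¹ i) = tabCol mu hm x := by
    intro x
    have hx : tabRow mu hm x < mu.colLen (tabCol mu hm x) :=
      YoungDiagram.mem_iff_lt_colLen.1 ((YoungDiagram.mem_cells _).1 (tableau mu hm x).2)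
    have h1 := card_lt_eq hm g hinj (tabRow mu hm x) (tabCol mu hm x)
    have h2 := card_lt_eq hm g hinj (tabRow mu hm x + 1) (tabCol mu hm x)
    by_contra! hcon
    have h3 : (Finset.univ.filter fun i : Fin n =>
        tabRow mu hm i < tabRow mu hm x + 1 ∧ tabCol mu hm (g⁻¹ i) = tabCol mu hm x) =
        (Finset.univ.filter fun i : Fin n =>
        tabRow mu hm i < tabRow mu hm x ∧ tabCol mu hm (g⁻¹ i) = tabCol mu hm x) := by
      ext i
      simp only [Finset.mem_filter, Finset.mem_univ, true_and]
      have := hcon i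
      grind
    rw [h3, h1] at h2
    omega
  choose f hf1 hf2 using hex
  have hfi : Function.Injective f := by
    intro x y hxy
    refine tab_inj mu hm ?_ ?_
    · rw [← hf1 x, ← hf1 y, hxy]
    · rw [← hf2 x, ← hf2 y, hxy]
  let p : Equiv.Perm (Fin n) := Equiv.ofBijective f (Finite.injective_iff_bijective.1 hfi)
  refine ⟨p, hf1, fun i => ?_⟩
  have h1 := hf2 ((p⁻¹ * g) i)
  have h2 : f ((p⁻¹ * g) i) = g i := by
    change p (p⁻¹ (g i)) = g i
    simp
  rw [h2] at h1
  rw [← h1]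
  simp

end


lemma perm_apply_inv {ι : Type*} (g : Equiv.Perm ι) (i : ι) : g (g⁻¹ i) = i := by simp

/-! ## The adjoint in the rational group algebra -/

section Adjoint

variable {G : Type*} [Group G]

/-- The anti-automorphism of `ℚ[G]` inverting the elements of `G`, as an algebra map to the opposite
algebra. -/
def adjHom (G : Type*) [Group G] : ℚ[G] →ₐ[ℚ] (ℚ[G])ᵐᵒᵖ :=
  MonoidAlgebra.lift ℚ (ℚ[G])ᵐᵒᵖ G
    { toFun := fun g => MulOpposite.op (MonoidAlgebra.of ℚ G g⁻¹)
      map_one' := by rw [inv_one, map_one, MulOpposite.op_one]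
      map_mul' := fun g h => by rw [mul_inv_rev, map_mul, MulOpposite.op_mul] }

/-- The adjoint of an element of `ℚ[G]`, whose coefficient at `g` is the coefficient at `g⁻¹` of
the given element. -/
def adj (x : ℚ[G]) : ℚ[G] := (adjHom G x).unop

lemma adj_of (g : G) : adj (MonoidAlgebra.of ℚ G g) = MonoidAlgebra.of ℚ G g⁻¹ := by
  rw [adj, adjHom, MonoidAlgebra.lift_of]
  rfl

lemma adj_add (x y : ℚ[G]) : adj (x + y) = adj x + adj y := by simp [adj]

lemma adj_zero : adj (0 : ℚ[G]) = 0 := by simp [adj]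

lemma adj_smul (r : ℚ) (x : ℚ[G]) : adj (r • x) = r • adj x := by simp [adj]

lemma adj_sum {ι : Type*} (s : Finset ι) (f : ι → ℚ[G]) :
    adj (∑ i ∈ s, f i) = ∑ i ∈ s, adj (f i) := by simp [adj]

lemma adj_mul (x y : ℚ[G]) : adj (x * y) = adj y * adj x := by simp [adj]

lemma adj_single (g : G) (r : ℚ) :
    adj (MonoidAlgebra.single g r) = MonoidAlgebra.single g⁻¹ r := by
  have h : ∀ h : G, MonoidAlgebra.single h r = r • MonoidAlgebra.of ℚ G h := by
    intro h
    rw [MonoidAlgebra.of_apply, MonoidAlgebra.smul_single, smul_eq_mul, mul_one]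
  rw [h, h, adj_smul, adj_of]

lemma adj_adj (x : ℚ[G]) : adj (adj x) = x := by
  induction x using MonoidAlgebra.induction_linear with
  | zero => rw [adj_zero, adj_zero]
  | add x y hx hy => rw [adj_add, adj_add, hx, hy]
  | single g r => rw [adj_single, adj_single, inv_inv]

lemma coeff_adj (x : ℚ[G]) (g : G) : (adj x).coeff g = x.coeff g⁻¹ := by
  classical
  induction x using MonoidAlgebra.induction_linear with
  | zero => simp [adj_zero]
  | add x y hx hy => simp [adj_add, hx, hy]
  | single h r =>
    simp [adj_single, Finsupp.single_apply, inv_eq_iff_eq_inv]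

lemma coeff_mul_adj_one [Fintype G] (x y : ℚ[G]) :
    (x * adj y).coeff 1 = ∑ g, x.coeff g * y.coeff g := by
  classical
  induction x using MonoidAlgebra.induction_linear with
  | zero => simp
  | add x x' hx hx' => simp [add_mul, hx, hx', Finset.sum_add_distrib]
  | single h r =>
    rw [MonoidAlgebra.coeff_single_mul_apply, mul_one, coeff_adj, inv_inv, Finset.sum_eq_single h]
    · simp
    · intro b _ hb
      simp [hb.symm]
    · simp

variable [Finite G]

/-- The coefficient of `x * adj x` at the identity is the sum of the squares of the coefficients of
`x`. -/
lemma eq_zero_of_mul_adj_eq_zero {x : ℚ[G]} (h : x * adj x = 0) : x = 0 := by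
  have := Fintype.ofFinite G
  have h1 := coeff_mul_adj_one x x
  rw [h, MonoidAlgebra.coeff_zero, Finsupp.zero_apply, eq_comm,
    Finset.sum_eq_zero_iff_of_nonneg fun g _ => mul_self_nonneg _] at h1
  ext g
  exact mul_self_eq_zero.1 (h1 g (Finset.mem_univ g))

/-- With `y = x * adj x` one has `y * adj y = (x * adj x * x) * adj x = 0`, and positivity applies
twice. This takes the place of semisimplicity below. -/
lemma eq_zero_of_forall_mul_mul {x : ℚ[G]} (h : ∀ r, x * r * x = 0) : x = 0 := by
  refine eq_zero_of_mul_adj_eq_zero (eq_zero_of_mul_adj_eq_zero ?_)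
  rw [adj_mul, adj_adj, ← mul_assoc, h, zero_mul]

end Adjoint

/-! ## Young symmetrizers -/

section Young

variable {n : ℕ}

open Classical in
/-- The sum of the row permutations of the tableau of shape `mu`. -/
def rowSum (mu : YoungDiagram) (h : mu.cells.card = n) : ℚ[Equiv.Perm (Fin n)] :=
  ∑ p : Equiv.Perm (Fin n) with ∀ i, tabRow mu h (p i) = tabRow mu h i,
    MonoidAlgebra.of ℚ (Equiv.Perm (Fin n)) p

open Classical in
/-- The signed sum of the column permutations of the tableau of shape `mu`. -/
def colSum (mu : YoungDiagram) (h : mu.cells.card = n) : ℚ[Equiv.Perm (Fin n)] :=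
  ∑ q : Equiv.Perm (Fin n) with ∀ i, tabCol mu h (q i) = tabCol mu h i,
    ((Equiv.Perm.sign q : ℤ) : ℚ) • MonoidAlgebra.of ℚ (Equiv.Perm (Fin n)) q

lemma youngSymmetrizer_eq (mu : YoungDiagram) (h : mu.cells.card = n) :
    youngSymmetrizer mu h = rowSum mu h * colSum mu h := rfl

variable (mu : YoungDiagram) (h : mu.cells.card = n)

local notation "δ" => MonoidAlgebra.of ℚ (Equiv.Perm (Fin n))

lemma rowSum_mul_of {p : Equiv.Perm (Fin n)} (hp : ∀ i, tabRow mu h (p i) = tabRow mu h i) :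
    rowSum mu h * δ p = rowSum mu h := by
  classical
  rw [rowSum, Finset.sum_mul]
  refine Finset.sum_bij (fun x _ => x * p) ?_ ?_ ?_ ?_
  · intro x hx
    simp only [Finset.mem_filter, Finset.mem_univ, true_and] at hx ⊢
    intro i
    rw [Equiv.Perm.mul_apply, hx, hp]
  · intro x _ y _ hxy
    exact mul_right_cancel hxy
  · intro y hy
    simp only [Finset.mem_filter, Finset.mem_univ, true_and] at hy
    refine ⟨y * p⁻¹, ?_, by simp⟩
    simp only [Finset.mem_filter, Finset.mem_univ, true_and]
    intro i
    rw [Equiv.Perm.mul_apply, hy, ← hp, perm_apply_inv]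
  · intro x _
    rw [map_mul]

lemma adj_rowSum : adj (rowSum mu h) = rowSum mu h := by
  classical
  rw [rowSum, adj_sum]
  refine Finset.sum_bij (fun x _ => x⁻¹) ?_ (fun x _ y _ hxy => inv_injective hxy) ?_
    fun x _ => adj_of x
  · intro x hx
    simp only [Finset.mem_filter, Finset.mem_univ, true_and] at hx ⊢
    intro i
    rw [← hx, perm_apply_inv]
  · intro x hx
    simp only [Finset.mem_filter, Finset.mem_univ, true_and] at hx
    refine ⟨x⁻¹, ?_, inv_inv x⟩
    simp only [Finset.mem_filter, Finset.mem_univ, true_and]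
    intro i
    rw [← hx, perm_apply_inv]

lemma adj_colSum : adj (colSum mu h) = colSum mu h := by
  classical
  rw [colSum, adj_sum]
  refine Finset.sum_bij (fun x _ => x⁻¹) ?_ (fun x _ y _ hxy => inv_injective hxy) ?_ ?_
  · intro x hx
    simp only [Finset.mem_filter, Finset.mem_univ, true_and] at hx ⊢
    intro i
    rw [← hx, perm_apply_inv]
  · intro x hx
    simp only [Finset.mem_filter, Finset.mem_univ, true_and] at hx
    refine ⟨x⁻¹, ?_, inv_inv x⟩
    simp only [Finset.mem_filter, Finset.mem_univ, true_and]
    intro i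
    rw [← hx, perm_apply_inv]
  · intro x _
    rw [adj_smul, adj_of, Equiv.Perm.sign_inv]

lemma of_mul_colSum {q : Equiv.Perm (Fin n)} (hq : ∀ i, tabCol mu h (q i) = tabCol mu h i) :
    δ q * colSum mu h = ((Equiv.Perm.sign q : ℤ) : ℚ) • colSum mu h := by
  classical
  rw [colSum, Finset.mul_sum, Finset.smul_sum]
  refine Finset.sum_bij (fun x _ => q * x) ?_ ?_ ?_ ?_
  · intro x hx
    simp only [Finset.mem_filter, Finset.mem_univ, true_and] at hx ⊢
    intro i
    rw [Equiv.Perm.mul_apply, hq, hx]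
  · intro x _ y _ hxy
    exact mul_left_cancel hxy
  · intro y hy
    simp only [Finset.mem_filter, Finset.mem_univ, true_and] at hy
    refine ⟨q⁻¹ * y, ?_, by simp⟩
    simp only [Finset.mem_filter, Finset.mem_univ, true_and]
    intro i
    rw [Equiv.Perm.mul_apply, ← hq, perm_apply_inv, hy]
  · intro x _
    have hs : ((Equiv.Perm.sign q : ℤ) : ℚ) * ((Equiv.Perm.sign q : ℤ) : ℚ) = 1 := by
      rw [← Int.cast_mul, ← Units.val_mul, Int.units_mul_self, Units.val_one, Int.cast_one]
    rw [mul_smul_comm, map_mul, smul_smul, map_mul, Units.val_mul, Int.cast_mul, ← mul_assoc, hs,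
      one_mul]

variable {mu} {lam : YoungDiagram} (hl : lam.cells.card = n)

/-- The transposition `(i j)` is absorbed by the row sum. Moved past `g` it becomes a column
transposition, which the column sum turns into the sign `-1`. So the product equals its negative. -/
lemma rowSum_mul_of_mul_colSum_eq_zero {g : Equiv.Perm (Fin n)} {i j : Fin n} (hij : i ≠ j)
    (hr : tabRow lam hl i = tabRow lam hl j)
    (hc : tabCol mu h (g⁻¹ i) = tabCol mu h (g⁻¹ j)) :
    rowSum lam hl * δ g * colSum mu h = 0 := by
  have h1 : rowSum lam hl * δ (Equiv.swap i j) = rowSum lam hl := by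
    refine rowSum_mul_of lam hl fun x => ?_
    by_cases hx : x = i
    · rw [hx, Equiv.swap_apply_left, hr]
    · by_cases hx' : x = j
      · rw [hx', Equiv.swap_apply_right, hr]
      · rw [Equiv.swap_apply_of_ne_of_ne hx hx']
  have h2 : δ (Equiv.swap (g⁻¹ i) (g⁻¹ j)) * colSum mu h = -colSum mu h := by
    rw [of_mul_colSum mu h, Equiv.Perm.sign_swap (fun e => hij (g⁻¹.injective e))]
    · simp
    · intro x
      by_cases hx : x = g⁻¹ i
      · rw [hx, Equiv.swap_apply_left, hc]
      · by_cases hx' : x = g⁻¹ j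
        · rw [hx', Equiv.swap_apply_right, hc]
        · rw [Equiv.swap_apply_of_ne_of_ne hx hx']
  have h3 : Equiv.swap i j * g = g * Equiv.swap (g⁻¹ i) (g⁻¹ j) := by
    rw [Equiv.mul_swap_eq_swap_mul, perm_apply_inv, perm_apply_inv]
  have h4 : rowSum lam hl * δ g * colSum mu h = -(rowSum lam hl * δ g * colSum mu h) := by
    conv_lhs => rw [← h1, mul_assoc (rowSum lam hl), ← map_mul, h3, map_mul, mul_assoc, mul_assoc,
      h2]
    rw [mul_neg, mul_neg, mul_assoc]
  have h5 : (2 : ℚ) • (rowSum lam hl * δ g * colSum mu h) = 0 := by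
    rw [two_smul]
    nth_rewrite 1 [h4]
    exact neg_add_cancel _
  exact (smul_eq_zero.1 h5).resolve_left two_ne_zero

/-- If a permutation gave a nonzero product, no two entries in a row of one tableau would share a
column of the other, and `topCard_le` would contradict `hk`. -/
lemma rowSum_mul_mul_colSum_eq_zero {k : ℕ} (hk : topCard mu k < topCard lam k)
    (x : ℚ[Equiv.Perm (Fin n)]) : rowSum lam hl * x * colSum mu h = 0 := by
  induction x using MonoidAlgebra.induction_on with
  | of g =>
    by_contra hne
    refine absurd (topCard_le hl h g (fun i j h1 h2 => ?_) k) (not_le.2 hk)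
    by_contra hij
    exact hne (rowSum_mul_of_mul_colSum_eq_zero h hl hij h1 h2)
  | add x y hx hy => rw [mul_add, add_mul, hx, hy, add_zero]
  | smul r x hx => rw [mul_smul_comm, smul_mul_assoc, hx, smul_zero]

/-- A permutation either is a row permutation times a column permutation, and is absorbed up to
sign, or admits a transposition that kills the product. -/
lemma rowSum_mul_mul_colSum (x : ℚ[Equiv.Perm (Fin n)]) :
    ∃ t : ℚ, rowSum mu h * x * colSum mu h = t • youngSymmetrizer mu h := by
  induction x using MonoidAlgebra.induction_on with
  | of g =>
    by_cases hinj : ∀ i j, tabRow mu h i = tabRow mu h j →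
        tabCol mu h (g⁻¹ i) = tabCol mu h (g⁻¹ j) → i = j
    · obtain ⟨p, hp, hq⟩ := exists_row_col_factorization h g hinj
      refine ⟨((Equiv.Perm.sign (p⁻¹ * g) : ℤ) : ℚ), ?_⟩
      have : δ g = δ p * δ (p⁻¹ * g) := by rw [← map_mul, mul_inv_cancel_left]
      rw [this, ← mul_assoc, rowSum_mul_of mu h hp, mul_assoc, of_mul_colSum mu h hq,
        mul_smul_comm, youngSymmetrizer_eq]
    · push Not at hinj
      obtain ⟨i, j, h1, h2, hij⟩ := hinj
      exact ⟨0, by rw [rowSum_mul_of_mul_colSum_eq_zero h h hij h1 h2, zero_smul]⟩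
  | add x y hx hy =>
    obtain ⟨t, ht⟩ := hx
    obtain ⟨s, hs⟩ := hy
    exact ⟨t + s, by rw [mul_add, add_mul, ht, hs, add_smul]⟩
  | smul r x hx =>
    obtain ⟨t, ht⟩ := hx
    exact ⟨r * t, by rw [mul_smul_comm, smul_mul_assoc, ht, smul_smul]⟩

lemma youngSymmetrizer_mul_mul (x : ℚ[Equiv.Perm (Fin n)]) : ∃ t : ℚ,
    youngSymmetrizer mu h * x * youngSymmetrizer mu h = t • youngSymmetrizer mu h := by
  obtain ⟨t, ht⟩ := rowSum_mul_mul_colSum h (colSum mu h * x * rowSum mu h)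
  exact ⟨t, by rw [← ht, youngSymmetrizer_eq]; simp only [mul_assoc]⟩

/-- Only the identity preserves both rows and columns, so a single product of a row and a column
permutation contributes. -/
lemma coeff_youngSymmetrizer_one : (youngSymmetrizer mu h).coeff 1 = 1 := by
  classical
  have h1 : youngSymmetrizer mu h = rowSum mu h * adj (colSum mu h) := by
    rw [adj_colSum, youngSymmetrizer_eq]
  have hr : ∀ g, (rowSum mu h).coeff g =
      if ∀ i, tabRow mu h (g i) = tabRow mu h i then 1 else 0 := by
    intro g
    rw [rowSum, MonoidAlgebra.coeff_sum, Finsupp.finsetSum_apply, Finset.sum_filter]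
    rw [Finset.sum_eq_single g]
    · simp [MonoidAlgebra.of_apply]
    · intro b _ hb
      simp [MonoidAlgebra.of_apply, hb]
    · simp
  have hc : ∀ g, (colSum mu h).coeff g =
      if ∀ i, tabCol mu h (g i) = tabCol mu h i then ((Equiv.Perm.sign g : ℤ) : ℚ) else 0 := by
    intro g
    rw [colSum, MonoidAlgebra.coeff_sum, Finsupp.finsetSum_apply, Finset.sum_filter]
    rw [Finset.sum_eq_single g]
    · simp [MonoidAlgebra.of_apply]
    · intro b _ hb
      simp [MonoidAlgebra.of_apply, hb]
    · simp
  rw [h1, coeff_mul_adj_one, Finset.sum_eq_single 1]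
  · rw [hr, hc]
    simp
  · intro g _ hg
    rw [hr, hc]
    split_ifs with h2 h3
    · exact absurd (Equiv.ext fun i => tab_inj mu h (h2 i) (h3 i)) hg
    all_goals simp
  · simp

lemma youngSymmetrizer_ne_zero : youngSymmetrizer mu h ≠ 0 := by
  intro h0
  have := coeff_youngSymmetrizer_one h
  rw [h0] at this
  simp at this

lemma rowSum_mul_rowSum : ∃ t : ℚ, t ≠ 0 ∧ rowSum mu h * rowSum mu h = t • rowSum mu h := by
  classical
  refine ⟨((Finset.univ.filter fun p : Equiv.Perm (Fin n) =>
    ∀ i, tabRow mu h (p i) = tabRow mu h i).card : ℚ), ?_, ?_⟩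
  · rw [Nat.cast_ne_zero, Finset.card_ne_zero]
    exact ⟨1, by simp⟩
  · conv_lhs => enter [2]; rw [rowSum]
    rw [Finset.mul_sum, Finset.sum_congr rfl fun p hp => rowSum_mul_of mu h
      (Finset.mem_filter.1 hp).2, Finset.sum_const, Nat.cast_smul_eq_nsmul]

lemma colSum_mul_colSum : ∃ t : ℚ, t ≠ 0 ∧ colSum mu h * colSum mu h = t • colSum mu h := by
  classical
  refine ⟨((Finset.univ.filter fun p : Equiv.Perm (Fin n) =>
    ∀ i, tabCol mu h (p i) = tabCol mu h i).card : ℚ), ?_, ?_⟩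
  · rw [Nat.cast_ne_zero, Finset.card_ne_zero]
    exact ⟨1, by simp⟩
  · have hs : ∀ q : Equiv.Perm (Fin n),
        ((Equiv.Perm.sign q : ℤ) : ℚ) * ((Equiv.Perm.sign q : ℤ) : ℚ) = 1 := by
      intro q
      rw [← Int.cast_mul, ← Units.val_mul, Int.units_mul_self, Units.val_one, Int.cast_one]
    conv_lhs => enter [1]; rw [colSum]
    rw [Finset.sum_mul, Finset.sum_congr rfl fun q hq => by
      rw [smul_mul_assoc, of_mul_colSum mu h (Finset.mem_filter.1 hq).2, smul_smul, hs, one_smul],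
      Finset.sum_const, Nat.cast_smul_eq_nsmul]

/-- Write `c = a b` with `a` the row sum and `b` the column sum, both self-adjoint and idempotent up
to nonzero scalars. If `c c = 0`, then `(a b a) adj(a b a)` is a multiple of `a b a b a = 0`, so `a
b a = 0`; then `(a b) adj(a b)` is a multiple of `a b a = 0`, so `c = 0`, which is false. -/
lemma exists_youngSymmetrizer_mul_self : ∃ t : ℚ, t ≠ 0 ∧
    youngSymmetrizer mu h * youngSymmetrizer mu h = t • youngSymmetrizer mu h := by
  obtain ⟨t, ht⟩ := youngSymmetrizer_mul_mul h 1
  rw [mul_one] at ht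
  refine ⟨t, ?_, ht⟩
  rintro rfl
  rw [zero_smul] at ht
  obtain ⟨r, hr0, hr⟩ := rowSum_mul_rowSum h
  obtain ⟨s, hs0, hs⟩ := colSum_mul_colSum h
  have h1 : rowSum mu h * colSum mu h * rowSum mu h = 0 := by
    refine eq_zero_of_mul_adj_eq_zero ?_
    have : r • (youngSymmetrizer mu h * youngSymmetrizer mu h * rowSum mu h) = 0 := by
      rw [ht, zero_mul, smul_zero]
    rw [adj_mul, adj_mul, adj_rowSum, adj_colSum, ← this, youngSymmetrizer_eq]
    simp only [← mul_assoc]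
    rw [mul_assoc (rowSum mu h * colSum mu h) (rowSum mu h) (rowSum mu h), hr]
    simp only [mul_smul_comm, smul_mul_assoc]
  refine youngSymmetrizer_ne_zero h (eq_zero_of_mul_adj_eq_zero ?_)
  rw [youngSymmetrizer_eq, adj_mul, adj_rowSum, adj_colSum, ← mul_assoc,
    mul_assoc (rowSum mu h), hs, mul_smul_comm, smul_mul_assoc, h1, smul_zero]

/-! ## The idempotents of the Young symmetrizers -/

/-- The multiple of the Young symmetrizer which is idempotent. -/
def youngIdem (mu : YoungDiagram) (h : mu.cells.card = n) : ℚ[Equiv.Perm (Fin n)] :=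
  (exists_youngSymmetrizer_mul_self h).choose⁻¹ • youngSymmetrizer mu h

lemma exists_youngIdem_eq : ∃ t : ℚ, t ≠ 0 ∧ youngIdem mu h = t • youngSymmetrizer mu h :=
  ⟨_, inv_ne_zero (exists_youngSymmetrizer_mul_self h).choose_spec.1, rfl⟩

lemma youngIdem_mul_self : youngIdem mu h * youngIdem mu h = youngIdem mu h := by
  have h1 := (exists_youngSymmetrizer_mul_self h).choose_spec
  rw [youngIdem, smul_mul_smul_comm]
  generalize (exists_youngSymmetrizer_mul_self h).choose = t at h1 ⊢
  rw [h1.2, smul_smul, mul_assoc, inv_mul_cancel₀ h1.1, mul_one]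

lemma coeff_youngIdem_one : (youngIdem mu h).coeff 1 ≠ 0 := by
  obtain ⟨t, ht, h1⟩ := exists_youngIdem_eq h
  rw [h1, MonoidAlgebra.coeff_smul, Finsupp.smul_apply, coeff_youngSymmetrizer_one, smul_eq_mul,
    mul_one]
  exact ht

lemma youngIdem_mul_mul (x : ℚ[Equiv.Perm (Fin n)]) : ∃ t : ℚ,
    youngIdem mu h * x * youngIdem mu h = t • youngIdem mu h := by
  obtain ⟨t, ht, h1⟩ := exists_youngIdem_eq h
  obtain ⟨s, hs⟩ := youngSymmetrizer_mul_mul h x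
  refine ⟨t * s, ?_⟩
  rw [h1, smul_mul_assoc, smul_mul_smul_comm, hs, smul_smul, smul_smul]
  congr 1
  ring

lemma youngIdem_mul_mul_eq_zero (hne : lam ≠ mu) (x : ℚ[Equiv.Perm (Fin n)]) :
    youngIdem lam hl * x * youngIdem mu h = 0 := by
  have key : ∀ {lam mu : YoungDiagram} (hl : lam.cells.card = n) (h : mu.cells.card = n) (k : ℕ),
      topCard mu k < topCard lam k → ∀ x, youngIdem lam hl * x * youngIdem mu h = 0 := by
    intro lam mu hl h k hk x
    obtain ⟨t, -, h1⟩ := exists_youngIdem_eq h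
    obtain ⟨s, -, h2⟩ := exists_youngIdem_eq hl
    have h3 := rowSum_mul_mul_colSum_eq_zero h hl hk (colSum lam hl * x * rowSum mu h)
    rw [h1, h2, smul_mul_assoc, smul_mul_smul_comm, youngSymmetrizer_eq, youngSymmetrizer_eq]
    simp only [mul_assoc] at h3 ⊢
    rw [h3, smul_zero]
  obtain ⟨k, hk⟩ : ∃ k, topCard lam k ≠ topCard mu k := by
    by_contra! hcon
    exact hne (eq_of_topCard_eq hcon)
  rcases lt_or_gt_of_ne hk with hk | hk
  -- The dominance argument works in one direction only. In the other, the product sandwiched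
  -- between two copies of itself contains a factor that vanishes by `key`.
  · refine eq_zero_of_forall_mul_mul fun r => ?_
    have := key h hl k hk r
    calc _ = youngIdem lam hl * x * (youngIdem mu h * r * youngIdem lam hl) * x *
          youngIdem mu h := by simp only [mul_assoc]
      _ = 0 := by rw [this]; simp
  · exact key hl h k hk x

end Young


/-! ## Averaging over conjugates, and completeness of the Young idempotents -/

section ConjSum

variable {H G : Type*} [Group H] [Fintype H] [Group G] (ι : H →* G)

/-- The sum of the conjugates of an element of `ℚ[G]` under a finite group `H` mapping to `G`. -/
def conjSum (x : ℚ[G]) : ℚ[G] :=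
  ∑ h : H, MonoidAlgebra.of ℚ G (ι h) * x * MonoidAlgebra.of ℚ G (ι h)⁻¹

lemma of_mul_conjSum (x : ℚ[G]) (h : H) :
    MonoidAlgebra.of ℚ G (ι h) * conjSum ι x = conjSum ι x * MonoidAlgebra.of ℚ G (ι h) := by
  rw [conjSum, Finset.mul_sum, Finset.sum_mul]
  refine Fintype.sum_bijective (fun k => h * k) (Group.mulLeft_bijective h) _ _ fun k => ?_
  simp only [← mul_assoc, ← map_mul]
  rw [mul_assoc _ (MonoidAlgebra.of ℚ G _) (MonoidAlgebra.of ℚ G _), ← map_mul]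
  congr 3
  rw [map_mul]
  group

/-- The map of group algebras induced by a homomorphism. -/
def algMap : ℚ[H] →ₐ[ℚ] ℚ[G] := MonoidAlgebra.mapDomainAlgHom ℚ ℚ ι

omit [Fintype H] in
lemma algMap_of (h : H) : algMap ι (MonoidAlgebra.of ℚ H h) = MonoidAlgebra.of ℚ G (ι h) := by
  simp [algMap]

lemma algMap_mul_conjSum (x : ℚ[G]) (r : ℚ[H]) :
    algMap ι r * conjSum ι x = conjSum ι x * algMap ι r := by
  induction r using MonoidAlgebra.induction_on with
  | of g => rw [algMap_of, of_mul_conjSum]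
  | add r s hr hs => rw [map_add, add_mul, mul_add, hr, hs]
  | smul t r hr => rw [map_smul, smul_mul_assoc, mul_smul_comm, hr]

end ConjSum

section Completeness

variable {n : ℕ}

local notation "δ" => MonoidAlgebra.of ℚ (Equiv.Perm (Fin n))

/-- The sum of the conjugates of a Young idempotent. -/
def youngCentral (mu : YoungDiagram) (h : mu.cells.card = n) : ℚ[Equiv.Perm (Fin n)] :=
  conjSum (MonoidHom.id _) (youngIdem mu h)

lemma mul_youngCentral (mu : YoungDiagram) (h : mu.cells.card = n) (x : ℚ[Equiv.Perm (Fin n)]) :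
    x * youngCentral mu h = youngCentral mu h * x := by
  have := algMap_mul_conjSum (MonoidHom.id _) (youngIdem mu h) x
  rwa [algMap, MonoidAlgebra.mapDomainAlgHom_id] at this

lemma youngCentral_mul_youngIdem_eq_zero {lam mu : YoungDiagram} (hl : lam.cells.card = n)
    (h : mu.cells.card = n) (hne : lam ≠ mu) : youngCentral lam hl * youngIdem mu h = 0 := by
  rw [youngCentral, conjSum, Finset.sum_mul]
  refine Finset.sum_eq_zero fun g _ => ?_
  have := youngIdem_mul_mul_eq_zero h hl hne (δ g⁻¹)
  rw [MonoidHom.id_apply, mul_assoc, mul_assoc, ← mul_assoc (youngIdem lam hl), this, mul_zero]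

/-- Conjugation preserves the coefficient at the identity, so that of the sum is the order of the
group times a nonzero number. -/
lemma youngCentral_ne_zero (mu : YoungDiagram) (h : mu.cells.card = n) :
    youngCentral mu h ≠ 0 := by
  intro h0
  have h1 : (youngCentral mu h).coeff 1 =
      (Fintype.card (Equiv.Perm (Fin n)) : ℚ) * (youngIdem mu h).coeff 1 := by
    rw [youngCentral, conjSum, MonoidAlgebra.coeff_sum, Finsupp.finsetSum_apply]
    rw [Finset.sum_congr rfl fun g _ => ?_, Finset.sum_const, nsmul_eq_mul, Finset.card_univ]
    rw [MonoidHom.id_apply, MonoidAlgebra.of_apply, MonoidAlgebra.of_apply,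
      MonoidAlgebra.coeff_mul_single_apply, MonoidAlgebra.coeff_single_mul_apply]
    simp
  rw [h0, MonoidAlgebra.coeff_zero, Finsupp.zero_apply, eq_comm, mul_eq_zero] at h1
  refine h1.elim (fun h2 => ?_) (coeff_youngIdem_one h)
  rw [Nat.cast_eq_zero] at h2
  exact Fintype.card_ne_zero h2

/-- If the central element `z` killed the idempotent, it would kill all its conjugates and hence `z`
itself; but `z r z = r z z = 0` for all `r` forces `z = 0`. -/
lemma youngCentral_mul_youngIdem_ne_zero (mu : YoungDiagram) (h : mu.cells.card = n) :
    youngCentral mu h * youngIdem mu h ≠ 0 := by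
  intro h0
  refine youngCentral_ne_zero mu h (eq_zero_of_forall_mul_mul fun r => ?_)
  have h1 : youngCentral mu h * youngCentral mu h = 0 := by
    conv_lhs => enter [2]; rw [youngCentral, conjSum]
    rw [Finset.mul_sum]
    refine Finset.sum_eq_zero fun g _ => ?_
    rw [mul_assoc, ← mul_assoc, ← mul_youngCentral, mul_assoc, ← mul_assoc (youngCentral mu h), h0,
      zero_mul, mul_zero]
  rw [← mul_youngCentral, mul_assoc, h1, mul_zero]

/-- The space of class functions, as a subspace of the group algebra. -/
def classSpace (G : Type*) [Group G] : Submodule ℚ ℚ[G] where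
  carrier := {x | ∀ g, MonoidAlgebra.of ℚ G g * x = x * MonoidAlgebra.of ℚ G g}
  add_mem' := by
    intro x y hx hy g
    rw [mul_add, add_mul, hx, hy]
  zero_mem' := by
    intro g
    rw [mul_zero, zero_mul]
  smul_mem' := by
    intro r x hx g
    rw [mul_smul_comm, smul_mul_assoc, hx]

lemma coeff_eq_of_isConj {G : Type*} [Group G] {x : ℚ[G]} (hx : x ∈ classSpace G) {g h : G}
    (hgh : IsConj g h) : x.coeff g = x.coeff h := by
  obtain ⟨k, rfl⟩ := isConj_iff.1 hgh
  have := congrArg (fun y => y.coeff (k * g)) (hx k)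
  simp only [MonoidAlgebra.of_apply] at this
  rw [MonoidAlgebra.coeff_mul_single_apply, MonoidAlgebra.coeff_single_mul_apply] at this
  simpa using this

instance finiteDimensional_groupAlgebra {G : Type*} [Finite G] : FiniteDimensional ℚ ℚ[G] :=
  Module.Finite.of_surjective
    ({ toFun := MonoidAlgebra.ofCoeff, map_add' := fun _ _ => rfl, map_smul' := fun _ _ => rfl } :
      (G →₀ ℚ) →ₗ[ℚ] ℚ[G]) fun x => ⟨x.coeff, rfl⟩

lemma finrank_classSpace_le (G : Type*) [Group G] [Finite G] :
    Module.finrank ℚ (classSpace G) ≤ Nat.card (ConjClasses G) := by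
  have := Fintype.ofFinite (ConjClasses G)
  let f : classSpace G →ₗ[ℚ] (ConjClasses G → ℚ) :=
    { toFun := fun x C => x.1.coeff C.out
      map_add' := fun _ _ => rfl
      map_smul' := fun _ _ => rfl }
  have hf : Function.Injective f := by
    intro x y hxy
    refine Subtype.ext (MonoidAlgebra.coeff_injective (Finsupp.ext fun g => ?_))
    have h1 : IsConj (ConjClasses.mk g).out g := ConjClasses.mk_eq_mk_iff_isConj.1 (Quotient.out_eq _)
    rw [← coeff_eq_of_isConj x.2 h1, ← coeff_eq_of_isConj y.2 h1]
    exact congrFun hxy (ConjClasses.mk g)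
  have := LinearMap.finrank_le_finrank_of_injective hf
  rwa [Module.finrank_fintype_fun_eq_card, ← Nat.card_eq_fintype_card] at this

lemma card_cellsOfRowLens : ∀ w : List ℕ, (YoungDiagram.cellsOfRowLens w).card = w.sum
  | [] => rfl
  | a :: w => by
    rw [YoungDiagram.cellsOfRowLens, Finset.card_union_of_disjoint, Finset.card_map,
      card_cellsOfRowLens w]
    · simp
    · rw [Finset.disjoint_left]
      rintro ⟨i, j⟩ h1 h2
      simp at h1 h2
      grind

/-- The Young diagram of the cycle type of a permutation. -/
def cycleDiagram (g : Equiv.Perm (Fin n)) : YoungDiagram :=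
  YoungDiagram.ofRowLens (g.partition.parts.sort (· ≥ ·))
    (Multiset.pairwise_sort _ _).sortedGE

lemma card_cycleDiagram (g : Equiv.Perm (Fin n)) : (cycleDiagram g).cells.card = n := by
  have : (cycleDiagram g).cells.card = (g.partition.parts.sort (· ≥ ·)).sum :=
    card_cellsOfRowLens _
  rw [this, ← Multiset.sum_coe, Multiset.sort_eq, g.partition.parts_sum, Fintype.card_fin]

lemma isConj_of_cycleDiagram_eq {g h : Equiv.Perm (Fin n)} (e : cycleDiagram g = cycleDiagram h) :
    IsConj g h := by
  rw [Equiv.Perm.partition_eq_of_isConj]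
  have hpos : ∀ g : Equiv.Perm (Fin n), ∀ x ∈ g.partition.parts.sort (· ≥ ·), 0 < x :=
    fun g x hx => g.partition.parts_pos ((Multiset.mem_sort _).1 hx)
  have h1 := congrArg YoungDiagram.rowLens e
  rw [cycleDiagram, cycleDiagram, YoungDiagram.rowLens_ofRowLens_eq_self (hpos g),
    YoungDiagram.rowLens_ofRowLens_eq_self (hpos h)] at h1
  refine Nat.Partition.ext ?_
  rw [← Multiset.sort_eq g.partition.parts (· ≥ ·), h1, Multiset.sort_eq]

/-- The identity is a linear combination of the central elements of the Young idempotents. -/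
lemma one_mem_span_youngCentral (n : ℕ) : (1 : ℚ[Equiv.Perm (Fin n)]) ∈
    Submodule.span ℚ (Set.range fun mu : {mu : YoungDiagram // mu.cells.card = n} =>
      youngCentral mu.1 mu.2) := by
  classical
  let z : {mu : YoungDiagram // mu.cells.card = n} → classSpace (Equiv.Perm (Fin n)) :=
    fun mu => ⟨youngCentral mu.1 mu.2, fun g => mul_youngCentral _ _ _⟩
  -- Multiplication of a linear relation by the idempotent of `mu` isolates the term of `mu`.
  have hz : LinearIndependent ℚ z := by
    rw [linearIndependent_iff']
    intro s t hst mu hmu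
    have h1 := congrArg (fun x => x.1 * youngIdem mu.1 mu.2) hst
    simp only [Submodule.coe_sum, Submodule.coe_smul, Finset.sum_mul, Submodule.coe_zero,
      zero_mul, smul_mul_assoc] at h1
    rw [Finset.sum_eq_single mu] at h1
    · exact (smul_eq_zero.1 h1).resolve_right (youngCentral_mul_youngIdem_ne_zero _ _)
    · intro nu _ hne
      rw [youngCentral_mul_youngIdem_eq_zero _ _ fun e => hne (Subtype.ext e), smul_zero]
    · exact fun h => absurd hmu h
  have hfin : Finite {mu : YoungDiagram // mu.cells.card = n} := hz.finite
  have := Fintype.ofFinite {mu : YoungDiagram // mu.cells.card = n}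
  -- Cycle types embed the conjugacy classes in the diagrams with `n` cells. So the independent
  -- central elements are at least as many as the dimension of the space of class functions, and
  -- they span it.
  have hle : Nat.card (ConjClasses (Equiv.Perm (Fin n))) ≤
      Nat.card {mu : YoungDiagram // mu.cells.card = n} := by
    refine Nat.card_le_card_of_injective
      (fun C => ⟨cycleDiagram C.out, card_cycleDiagram C.out⟩) fun C D hCD => ?_
    have h1 := isConj_of_cycleDiagram_eq (congrArg Subtype.val hCD)
    rw [← Quotient.out_eq C, ← Quotient.out_eq D]
    exact Quotient.sound h1
  have hcard : Fintype.card {mu : YoungDiagram // mu.cells.card = n} =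
      Module.finrank ℚ (classSpace (Equiv.Perm (Fin n))) := by
    refine le_antisymm hz.fintype_card_le_finrank ?_
    rw [← Nat.card_eq_fintype_card]
    exact (finrank_classSpace_le _).trans hle
  have htop := hz.span_eq_top_of_card_eq_finrank' hcard
  have h1 : (⟨1, fun g => by rw [mul_one, one_mul]⟩ : classSpace (Equiv.Perm (Fin n))) ∈
      Submodule.span ℚ (Set.range z) := htop ▸ Submodule.mem_top
  have h2 := Submodule.mem_map_of_mem (f := (classSpace (Equiv.Perm (Fin n))).subtype) h1
  rw [Submodule.map_span, ← Set.range_comp] at h2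
  exact h2

end Completeness


/-! ## Branching is multiplicity free -/

/-- Induction on the support: with `x = g a`, write `g = (a x) g₁` where `g₁` fixes `a`. If `h`
fixes `x` and inverts `g₁`, then `g₁⁻¹ h` fixes `a` and inverts `g`. The fixed point `a` will be the
last point, so that the conjugating element lies in `S_n`. -/
lemma exists_conj_inv_of_support_subset {ι : Type*} [DecidableEq ι] : ∀ (k : ℕ) (s : Finset ι)
    (_ : s.card = k) (g : Equiv.Perm ι) (_ : ∀ y, y ∉ s → g y = y) (a : ι),
    ∃ h : Equiv.Perm ι, (∀ y, y ∉ s → h y = y) ∧ h a = a ∧ h * g * h⁻¹ = g⁻¹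
  | 0, s, hs, g, hg, a => by
    rw [Finset.card_eq_zero] at hs
    subst hs
    have : g = 1 := Equiv.ext fun y => hg y (Finset.notMem_empty y)
    exact ⟨1, fun _ _ => rfl, rfl, by simp [this]⟩
  | k + 1, s, hs, g, hg, a => by
    -- if `a ∉ s`, it may be replaced by any point of `s`
    wlog ha : a ∈ s generalizing a
    · obtain ⟨b, hb⟩ := Finset.card_pos.1 (hs.symm ▸ Nat.succ_pos k : 0 < s.card)
      obtain ⟨h, h1, -, h3⟩ := this b hb
      exact ⟨h, h1, h1 a ha, h3⟩
    set x := g a with hx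
    obtain ⟨g₁, hg₁⟩ : ∃ g₁, g₁ = Equiv.swap a x * g := ⟨_, rfl⟩
    have hxs : x ∈ s := by
      by_contra hxs
      have h1 := hg x hxs
      have h2 : x = a := g.injective (h1.trans hx)
      exact hxs (h2 ▸ ha)
    have hg₁s : ∀ y, y ∉ s.erase a → g₁ y = y := by
      intro y hy
      rw [hg₁, Equiv.Perm.mul_apply]
      by_cases hya : y = a
      · rw [hya, ← hx, Equiv.swap_apply_right]
      · have hys : y ∉ s := fun h => hy (Finset.mem_erase.2 ⟨hya, h⟩)
        rw [hg y hys, Equiv.swap_apply_of_ne_of_ne hya]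
        rintro rfl
        exact hys hxs
    obtain ⟨h, h1, h2, h3⟩ := exists_conj_inv_of_support_subset k (s.erase a)
      (by rw [Finset.card_erase_of_mem ha, hs]; rfl) g₁ hg₁s x
    have hg₁a : g₁⁻¹ a = a := by
      rw [Equiv.Perm.inv_eq_iff_eq]
      exact (hg₁s a (Finset.notMem_erase a s)).symm
    have hga : (g₁⁻¹ * h) a = a := by
      rw [Equiv.Perm.mul_apply, h1 a (Finset.notMem_erase a s), hg₁a]
    have hgx : (g₁⁻¹ * h) x = g₁⁻¹ x := by rw [Equiv.Perm.mul_apply, h2]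
    refine ⟨g₁⁻¹ * h, fun y hy => ?_, hga, ?_⟩
    · have hy' : y ∉ s.erase a := fun h => hy (Finset.mem_of_mem_erase h)
      rw [Equiv.Perm.mul_apply, h1 y hy', Equiv.Perm.inv_eq_iff_eq, hg₁s y hy']
    · have e1 : g = Equiv.swap a x * g₁ := by rw [hg₁, Equiv.swap_mul_self_mul]
      have e2 : (g₁⁻¹ * h) * Equiv.swap a x = Equiv.swap a (g₁⁻¹ x) * (g₁⁻¹ * h) := by
        rw [Equiv.mul_swap_eq_swap_mul, hga, hgx]
      have e3 : g₁⁻¹ * Equiv.swap a x = Equiv.swap a (g₁⁻¹ x) * g₁⁻¹ := by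
        rw [Equiv.mul_swap_eq_swap_mul, hg₁a]
      calc (g₁⁻¹ * h) * g * (g₁⁻¹ * h)⁻¹ =
            (g₁⁻¹ * h * Equiv.swap a x) * g₁ * (g₁⁻¹ * h)⁻¹ := by rw [e1]; group
        _ = Equiv.swap a (g₁⁻¹ x) * (g₁⁻¹ * (h * g₁ * h⁻¹) * g₁) := by rw [e2]; group
        _ = Equiv.swap a (g₁⁻¹ x) * g₁⁻¹ := by rw [h3]; group
        _ = g⁻¹ := by rw [e1, mul_inv_rev, Equiv.swap_inv, e3]

lemma permInclusion_castSucc {n : ℕ} (s : Equiv.Perm (Fin n)) (i : Fin n) :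
    permInclusion n s i.castSucc = (s i).castSucc :=
  Equiv.Perm.viaEmbedding_apply s Fin.castSuccEmb i

lemma permInclusion_last {n : ℕ} (s : Equiv.Perm (Fin n)) :
    permInclusion n s (Fin.last n) = Fin.last n := by
  refine Equiv.Perm.viaEmbedding_apply_of_notMem s Fin.castSuccEmb _ ?_
  rintro ⟨i, hi⟩
  exact (Fin.castSucc_lt_last i).ne hi

lemma exists_permInclusion_eq {n : ℕ} {g : Equiv.Perm (Fin (n + 1))}
    (hg : g (Fin.last n) = Fin.last n) : ∃ s, permInclusion n s = g := by
  have hne : ∀ i : Fin n, g i.castSucc ≠ Fin.last n := by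
    intro i hi
    exact (Fin.castSucc_lt_last i).ne (g.injective (hi.trans hg.symm))
  let f : Fin n → Fin n := fun i => (g i.castSucc).castPred (hne i)
  have hf : Function.Injective f := by
    intro i j hij
    have : g i.castSucc = g j.castSucc := by
      rw [← Fin.castSucc_castPred _ (hne i), ← Fin.castSucc_castPred _ (hne j)]
      exact congrArg Fin.castSucc hij
    exact Fin.castSucc_injective _ (g.injective this)
  refine ⟨Equiv.ofBijective f (Finite.injective_iff_bijective.1 hf), Equiv.ext fun i => ?_⟩
  refine Fin.lastCases ?_ (fun i => ?_) i
  · rw [permInclusion_last, hg]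
  · rw [permInclusion_castSucc]
    exact Fin.castSucc_castPred _ (hne i)

/-! ### Centralizers and corners of the group algebra of `S_{n+1}`. -/

section

variable {n : ℕ}

local notation "δ" => MonoidAlgebra.of ℚ (Equiv.Perm (Fin (n + 1)))

/-- The coefficients of `x` are constant on the orbits of conjugation by `S_n`, and these orbits are
stable under inversion. -/
lemma adj_eq_self {x : ℚ[Equiv.Perm (Fin (n + 1))]}
    (hx : ∀ s, δ (permInclusion n s) * x = x * δ (permInclusion n s)) : adj x = x := by
  refine MonoidAlgebra.coeff_injective (Finsupp.ext fun g => ?_)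
  rw [coeff_adj]
  obtain ⟨h, -, h1, h2⟩ := exists_conj_inv_of_support_subset _ Finset.univ rfl g
    (fun y hy => absurd (Finset.mem_univ y) hy) (Fin.last n)
  obtain ⟨s, rfl⟩ := exists_permInclusion_eq h1
  have := congrArg (fun y => y.coeff (permInclusion n s * g)) (hx s)
  simp only [MonoidAlgebra.of_apply] at this
  rw [MonoidAlgebra.coeff_mul_single_apply, MonoidAlgebra.coeff_single_mul_apply,
    inv_mul_cancel_left, one_mul, mul_one, h2] at this
  exact this.symm

/-- The centralizer of `ℚ[S_n]` in `ℚ[S_{n+1}]` is commutative. -/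
lemma mul_comm_of_commute {x y : ℚ[Equiv.Perm (Fin (n + 1))]}
    (hx : ∀ s, δ (permInclusion n s) * x = x * δ (permInclusion n s))
    (hy : ∀ s, δ (permInclusion n s) * y = y * δ (permInclusion n s)) : x * y = y * x := by
  have hxy : ∀ s, δ (permInclusion n s) * (x * y) = x * y * δ (permInclusion n s) := by
    intro s
    rw [← mul_assoc, hx, mul_assoc, hy, mul_assoc]
  -- Gelfand's trick: the anti-automorphism `adj` fixes `x`, `y` and `x * y`.
  rw [← adj_eq_self hxy, adj_mul, adj_eq_self hx, adj_eq_self hy]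

variable {lam mu : YoungDiagram} (hl : lam.cells.card = n) (hm : mu.cells.card = n + 1)

/-- The Young idempotent of a Young diagram with `n` cells in `ℚ[S_{n+1}]`. -/
def youngIdemSucc (lam : YoungDiagram) (hl : lam.cells.card = n) : ℚ[Equiv.Perm (Fin (n + 1))] :=
  algMap (permInclusion n) (youngIdem lam hl)

lemma youngIdemSucc_mul_self :
    youngIdemSucc lam hl * youngIdemSucc lam hl = youngIdemSucc lam hl := by
  rw [youngIdemSucc, ← map_mul, youngIdem_mul_self]

/-- Averaging over `S_n` carries the corner of the idempotent `e` into the centralizer of `ℚ[S_n]`,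
and compression by `e` recovers the element of the corner up to a nonzero scalar. Products of the
corner can therefore be computed in the centralizer. -/
lemma exists_conjSum_identity : ∃ C : ℚ, C ≠ 0 ∧ ∀ x y : ℚ[Equiv.Perm (Fin (n + 1))],
    youngIdemSucc lam hl * x * youngIdemSucc lam hl = x →
    youngIdemSucc lam hl * y * youngIdemSucc lam hl = y →
    youngIdemSucc lam hl * conjSum (permInclusion n) x * conjSum (permInclusion n) y *
      youngIdemSucc lam hl = C • (x * y) := by
  set e := youngIdemSucc lam hl with he
  have hee : e * e = e := youngIdemSucc_mul_self hl
  choose χ hχ using fun k : Equiv.Perm (Fin n) =>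
    youngIdem_mul_mul hl (MonoidAlgebra.of ℚ _ k)
  have hχe : ∀ k, e * δ (permInclusion n k) * e = χ k • e := by
    intro k
    rw [he, youngIdemSucc, ← algMap_of, ← map_mul, ← map_mul, hχ, map_smul]
  -- Here `e k e = χ(k) e`, so compressing the conjugate of `x = e x e` by `k` multiplies `x` by
  -- `χ(k) χ(k⁻¹)`.
  set C := ∑ k, χ k * χ k⁻¹ with hC
  have key : ∀ x, e * x * e = x →
      e * conjSum (permInclusion n) x * e = C • x := by
    intro x hx
    rw [conjSum, Finset.mul_sum, Finset.sum_mul, hC, Finset.sum_smul]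
    refine Finset.sum_congr rfl fun k _ => ?_
    rw [← hx]
    calc _ = (e * δ (permInclusion n k) * e) * x * (e * δ (permInclusion n k)⁻¹ * e) := by
          simp only [mul_assoc]
      _ = _ := by
          rw [hχe, ← map_inv, hχe, smul_mul_assoc, smul_mul_smul_comm, hx]
  -- The same computation inside `ℚ[S_n]`, with `x` the idempotent itself, identifies `C` as the
  -- scalar by which the central element acts on it.
  have hC0 : C ≠ 0 := by
    intro h0
    refine youngCentral_mul_youngIdem_ne_zero lam hl ?_
    have h1 : youngIdem lam hl * youngCentral lam hl * youngIdem lam hl = C • youngIdem lam hl := by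
      rw [youngCentral, conjSum, Finset.mul_sum, Finset.sum_mul, hC, Finset.sum_smul]
      refine Finset.sum_congr rfl fun k _ => ?_
      calc _ = (youngIdem lam hl * MonoidAlgebra.of ℚ _ k * youngIdem lam hl) *
              (youngIdem lam hl * MonoidAlgebra.of ℚ _ k⁻¹ * youngIdem lam hl) := by
            conv_lhs => rw [← youngIdem_mul_self hl]
            simp only [MonoidHom.id_apply, mul_assoc]
            simp only [← mul_assoc, youngIdem_mul_self hl]
        _ = _ := by rw [hχ, hχ, smul_mul_smul_comm, youngIdem_mul_self]
    rw [mul_youngCentral, mul_assoc, youngIdem_mul_self, h0, zero_smul] at h1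
    exact h1
  refine ⟨C * C, mul_ne_zero hC0 hC0, fun x y hx hy => ?_⟩
  have hcomm : ∀ z, e * conjSum (permInclusion n) z = conjSum (permInclusion n) z * e :=
    fun z => algMap_mul_conjSum _ z _
  calc _ = (e * conjSum (permInclusion n) x * e) * (e * conjSum (permInclusion n) y * e) := by
        calc _ = e * (e * conjSum (permInclusion n) x) * conjSum (permInclusion n) y * e := by
              rw [← mul_assoc e e, hee]
          _ = e * conjSum (permInclusion n) x * (e * e) * conjSum (permInclusion n) y * e := by
              rw [hcomm x, hee, ← mul_assoc e _ e, hcomm x, mul_assoc _ e e, hee]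
          _ = _ := by simp only [mul_assoc]
    _ = _ := by rw [key x hx, key y hy, smul_mul_smul_comm]

/-- Up to a nonzero constant, `x * y` is the compression of a product in the commutative
centralizer. -/
lemma youngIdemSucc_corner_comm {x y : ℚ[Equiv.Perm (Fin (n + 1))]}
    (hx : youngIdemSucc lam hl * x * youngIdemSucc lam hl = x)
    (hy : youngIdemSucc lam hl * y * youngIdemSucc lam hl = y) : x * y = y * x := by
  obtain ⟨C, hC0, hC⟩ := exists_conjSum_identity hl
  have h1 := mul_comm_of_commute (of_mul_conjSum (permInclusion n) x)
    (of_mul_conjSum (permInclusion n) y)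
  have h2 := hC x y hx hy
  rw [mul_assoc (youngIdemSucc lam hl), h1, ← mul_assoc, hC y x hy hx] at h2
  exact (smul_right_injective _ hC0 h2).symm

/-- The restriction of an irreducible representation of `S_{n+1}` to `S_n` is multiplicity free. -/
lemma exists_forall_corner_eq_smul : ∃ t : ℚ[Equiv.Perm (Fin (n + 1))],
    youngIdem mu hm * t = t ∧ ∀ r, ∃ c : ℚ,
      youngIdem mu hm * r * youngIdemSucc lam hl = c • t := by
  set e := youngIdemSucc lam hl with he
  set f := youngIdem mu hm with hf
  have hee : e * e = e := youngIdemSucc_mul_self hl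
  have hff : f * f = f := youngIdem_mul_self hm
  by_cases h0 : ∀ r, f * r * e = 0
  · exact ⟨0, mul_zero _, fun r => ⟨0, by rw [h0, smul_zero]⟩⟩
  push Not at h0
  obtain ⟨r₀, hr₀⟩ := h0
  set t := f * r₀ * e with ht
  have hft : f * t = t := by rw [ht, ← mul_assoc, ← mul_assoc, hff]
  have hte : t * e = t := by rw [ht, mul_assoc, hee]
  -- Semiprimeness, together with `f A f = ℚ f` for `A = ℚ[S_{n+1}]`, yields a right inverse `w` of
  -- `t` in `e A f`, normalized so that `t w = f`.
  obtain ⟨r, hr⟩ : ∃ r, t * r * t ≠ 0 := by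
    by_contra! hcon
    exact hr₀ (eq_zero_of_forall_mul_mul hcon)
  obtain ⟨c, hc⟩ := youngIdem_mul_mul hm (t * r)
  have hc' : t * r * f = c • f := by rw [← hc, ← hf, ← mul_assoc f t r, hft]
  have hc0 : c ≠ 0 := by
    rintro rfl
    refine hr ?_
    rw [← hft, ← mul_assoc, hft, hc', zero_smul, zero_mul]
  set w := e * (c⁻¹ • r) * f with hw
  have htw : t * w = f := by
    rw [hw, ← mul_assoc, ← mul_assoc, hte, mul_smul_comm, smul_mul_assoc, hc', smul_smul,
      inv_mul_cancel₀ hc0, one_smul]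
  have hew : e * w = w := by rw [hw, ← mul_assoc, ← mul_assoc, hee]
  have hwf : w * f = w := by rw [hw, mul_assoc, hff]
  refine ⟨t, hft, fun s => ?_⟩
  set v := f * s * e with hv
  have hfv : f * v = v := by rw [hv, ← mul_assoc, ← mul_assoc, hff]
  have hve : v * e = v := by rw [hv, mul_assoc, hee]
  obtain ⟨d, hd⟩ := youngIdem_mul_mul hm (v * w)
  have hd' : v * w = d • f := by rw [← hd, ← hf, ← mul_assoc f v w, hfv, mul_assoc v w f, hwf]
  refine ⟨d, ?_⟩
  have hcom := youngIdemSucc_corner_comm hl (x := w * t) (y := w * v)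
    (by rw [← he, ← mul_assoc, hew, mul_assoc, hte]) (by rw [← he, ← mul_assoc, hew, mul_assoc, hve])
  -- Both `w t` and `w v` lie in the commutative corner of `e`. Exchanging them moves `v` next to
  -- `w`, and `v w` is the scalar `d` times `f`.
  calc v = t * (w * v) := by rw [← mul_assoc, htw, hfv]
    _ = t * (w * (t * w) * v) := by rw [htw, hwf]
    _ = t * ((w * t) * (w * v)) := by simp only [mul_assoc]
    _ = t * ((w * v) * (w * t)) := by rw [hcom]
    _ = (t * w) * (v * w) * t := by simp only [mul_assoc]
    _ = d • t := by rw [htw, hd', mul_smul_comm, hff, smul_mul_assoc, hft]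

end


/-! ## Multiplicities and Young idempotents -/

section Multiplicity

variable {n : ℕ} {V : Type*} [AddCommGroup V] [Module ℚ V]
  (ρ : Representation ℚ (Equiv.Perm (Fin n)) V) {mu : YoungDiagram} (h : mu.cells.card = n)

/-- The projection of a representation defined by a Young idempotent. -/
def youngProj (mu : YoungDiagram) (h : mu.cells.card = n) : V →ₗ[ℚ] V :=
  ρ.asAlgebraHom (youngIdem mu h)

lemma youngProj_youngProj (x : V) : youngProj ρ mu h (youngProj ρ mu h x) = youngProj ρ mu h x := by
  rw [youngProj, ← Module.End.mul_apply, ← map_mul, youngIdem_mul_self]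

lemma youngProj_eq_self_iff {x : V} :
    youngProj ρ mu h x = x ↔ x ∈ LinearMap.range (youngProj ρ mu h) :=
  ⟨fun hx => ⟨x, hx⟩, by rintro ⟨y, rfl⟩; exact youngProj_youngProj ρ h y⟩

lemma asAlgebraHom_mem {H : Type*} [Group H] (σ : Representation ℚ H V) {U : Submodule ℚ V}
    (hU : ∀ g, ∀ x ∈ U, σ g x ∈ U) (r : ℚ[H]) {x : V} (hx : x ∈ U) : σ.asAlgebraHom r x ∈ U := by
  induction r using MonoidAlgebra.induction_on with
  | of g =>
    rw [Representation.asAlgebraHom_of]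
    exact hU g x hx
  | add r s hr hs =>
    rw [map_add]
    exact U.add_mem hr hs
  | smul t r hr =>
    rw [map_smul]
    exact U.smul_mem t hr

lemma youngSymmetrizer_mem : youngSymmetrizer mu h ∈
    (Ideal.span {youngSymmetrizer mu h} : Ideal ℚ[Equiv.Perm (Fin n)]) :=
  Ideal.subset_span rfl

lemma youngSymmetrizer_mul_youngIdem :
    youngSymmetrizer mu h * youngIdem mu h = youngSymmetrizer mu h := by
  obtain ⟨t, ht, h1⟩ := exists_youngIdem_eq h
  have h2 := youngIdem_mul_self h
  nth_rewrite 1 3 [h1] at h2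
  rw [smul_mul_assoc] at h2
  exact smul_right_injective _ ht h2

lemma youngIdem_mul_youngSymmetrizer :
    youngIdem mu h * youngSymmetrizer mu h = youngSymmetrizer mu h := by
  obtain ⟨t, ht, h1⟩ := exists_youngIdem_eq h
  have h2 := youngIdem_mul_self h
  nth_rewrite 2 3 [h1] at h2
  rw [mul_smul_comm] at h2
  exact smul_right_injective _ ht h2

/-- The vectors are the images of the Young symmetrizer placed in each of the `k` summands. -/
lemma IsSumOfCopies.exists_linearIndependent {k : ℕ} {W : Submodule ℚ V}
    (hW : IsSumOfCopies ρ (irrep mu h) k W) : ∃ x : Fin k → V, LinearIndependent ℚ x ∧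
      ∀ j, x j ∈ W ∧ youngProj ρ mu h (x j) = x j := by
  classical
  obtain ⟨f, hf, rfl, hfe⟩ := hW
  have hact : ∀ (r : ℚ[Equiv.Perm (Fin n)]) (x : Fin k → Irrep mu h),
      f (fun j => r • x j) = ρ.asAlgebraHom r (f x) := by
    intro r x
    induction r using MonoidAlgebra.induction_on with
    | of g =>
      rw [Representation.asAlgebraHom_of, ← hfe]
      rfl
    | add r s hr hs =>
      rw [map_add, LinearMap.add_apply, ← hr, ← hs, ← map_add]
      congr 1
      funext j
      exact add_smul r s (x j)
    | smul t r hr =>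
      rw [map_smul, LinearMap.smul_apply, ← hr, ← map_smul]
      congr 1
      funext j
      exact smul_assoc t r (x j)
  let c : Irrep mu h := ⟨youngSymmetrizer mu h, youngSymmetrizer_mem h⟩
  have hc : c ≠ 0 := fun h0 => youngSymmetrizer_ne_zero h (congrArg Subtype.val h0)
  have hec : youngIdem mu h • c = c := Subtype.ext (youngIdem_mul_youngSymmetrizer h)
  refine ⟨fun j => f (Pi.single j c), ?_, fun j => ⟨⟨_, rfl⟩, ?_⟩⟩
  · have h1 : LinearIndependent ℚ fun j : Fin k => (Pi.single j c : Fin k → Irrep mu h) := by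
      rw [linearIndependent_iff']
      intro s t hst i hi
      have h2 := congrFun hst i
      rw [Finset.sum_apply, Finset.sum_eq_single i] at h2
      · rw [Pi.smul_apply, Pi.single_eq_same, Pi.zero_apply] at h2
        exact (smul_eq_zero.1 h2).resolve_right hc
      · intro j _ hj
        rw [Pi.smul_apply, Pi.single_eq_of_ne hj.symm, smul_zero]
      · exact fun h => absurd hi h
    exact h1.map' f (LinearMap.ker_eq_bot.2 hf)
  · rw [youngProj, ← hact]
    congr 1
    funext i
    by_cases hij : i = j
    · subst hij
      rw [Pi.single_eq_same, hec]
    · rw [Pi.single_eq_of_ne hij, smul_zero]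

/-- Converse of the preceding lemma: the `j`-th copy of the left ideal is mapped to `V` by acting on
`x j`. Minimality of `W` among invariant subspaces containing the `x j` is recorded for use inside
orbit spans. -/
lemma exists_isSumOfCopies {k : ℕ} {x : Fin k → V} (hx : LinearIndependent ℚ x)
    (hxe : ∀ j, youngProj ρ mu h (x j) = x j) : ∃ W : Submodule ℚ V,
    IsSumOfCopies ρ (irrep mu h) k W ∧ ∀ U : Submodule ℚ V, (∀ g, ∀ y ∈ U, ρ g y ∈ U) →
      (∀ j, x j ∈ U) → W ≤ U := by
  let f : (Fin k → Irrep mu h) →ₗ[ℚ] V :=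
    { toFun := fun w => ∑ j, ρ.asAlgebraHom (w j).1 (x j)
      map_add' := fun w w' => by
        rw [← Finset.sum_add_distrib]
        refine Finset.sum_congr rfl fun j _ => ?_
        rw [← LinearMap.add_apply, ← map_add]
        rfl
      map_smul' := fun t w => by
        rw [Finset.smul_sum]
        refine Finset.sum_congr rfl fun j _ => ?_
        rw [RingHom.id_apply, ← LinearMap.smul_apply, ← map_smul]
        rfl }
  have hf : ∀ w, f w = ∑ j, ρ.asAlgebraHom (w j).1 (x j) := fun _ => rfl
  refine ⟨LinearMap.range f, ⟨f, ?_, rfl, ?_⟩, ?_⟩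
  · rw [← LinearMap.ker_eq_bot, LinearMap.ker_eq_bot']
    intro w hw
    have hwe : ∀ j, (w j).1 * youngIdem mu h = (w j).1 := by
      intro j
      obtain ⟨a, ha⟩ := Ideal.mem_span_singleton'.1 (w j).2
      rw [← ha, mul_assoc, youngSymmetrizer_mul_youngIdem]
    -- With `e` the idempotent, `e s w_j = t_j e` since `w_j = w_j e`. Applying `e s` to the
    -- relation gives `∑ t_j x_j = 0`, so every `t_j` vanishes. Then `w_j r w_j = w_j e r w_j = 0`
    -- for all `r`, and semiprimeness gives `w_j = 0`.
    have hz : ∀ (s : ℚ[Equiv.Perm (Fin n)]) j, youngIdem mu h * s * (w j).1 = 0 := by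
      intro s
      choose t ht using fun j => youngIdem_mul_mul h (s * (w j).1)
      have ht' : ∀ j, youngIdem mu h * s * (w j).1 = t j • youngIdem mu h := by
        intro j
        rw [← ht, mul_assoc, mul_assoc, mul_assoc, hwe]
      have h0 : ∑ j, t j • x j = 0 := by
        have h1 := congrArg (ρ.asAlgebraHom (youngIdem mu h * s)) hw
        rw [hf, map_sum, map_zero] at h1
        rw [← h1]
        refine Finset.sum_congr rfl fun j _ => ?_
        rw [← Module.End.mul_apply, ← map_mul, ht', map_smul, LinearMap.smul_apply]
        exact congrArg _ (hxe j).symm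
      intro j
      rw [ht', Fintype.linearIndependent_iff.1 hx t h0 j, zero_smul]
    funext j
    refine Subtype.ext (eq_zero_of_forall_mul_mul fun r => ?_)
    rw [← hwe j, mul_assoc, mul_assoc, ← mul_assoc (youngIdem mu h), hwe, hz, mul_zero]
  · intro g w
    rw [hf, hf, map_sum]
    refine Finset.sum_congr rfl fun j _ => ?_
    rw [← Representation.asAlgebraHom_of ρ g, ← Module.End.mul_apply, ← map_mul]
    rfl
  · rintro U hU hxU _ ⟨w, rfl⟩
    rw [hf]
    exact U.sum_mem fun j _ => asAlgebraHom_mem ρ hU _ (hxU j)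

lemma multiplicity_irrep [FiniteDimensional ℚ V] :
    multiplicity ρ (irrep mu h) = Module.finrank ℚ (LinearMap.range (youngProj ρ mu h)) := by
  have : {k : ℕ | ∃ W : Submodule ℚ V, IsSumOfCopies ρ (irrep mu h) k W} =
      Set.Iic (Module.finrank ℚ (LinearMap.range (youngProj ρ mu h))) := by
    ext k
    constructor
    · rintro ⟨W, hW⟩
      obtain ⟨x, hx, hxe⟩ := hW.exists_linearIndependent ρ h
      have h1 : LinearIndependent ℚ fun j : Fin k =>
          (⟨x j, x j, (hxe j).2⟩ : LinearMap.range (youngProj ρ mu h)) :=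
        LinearIndependent.of_comp (LinearMap.range (youngProj ρ mu h)).subtype hx
      simpa using h1.fintype_card_le_finrank
    · intro hk
      have h1 := (Module.finBasis ℚ (LinearMap.range (youngProj ρ mu h))).linearIndependent
      have h2 := (h1.comp (Fin.castLE hk) (Fin.castLE_injective hk)).map'
        (LinearMap.range (youngProj ρ mu h)).subtype (Submodule.ker_subtype _)
      obtain ⟨W, hW, -⟩ := exists_isSumOfCopies ρ h h2 fun j =>
        (youngProj_eq_self_iff ρ h).2 (Subtype.property _)
      exact ⟨W, hW⟩
  rw [multiplicity, this, csSup_Iic]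

/-- Since `1` is a combination of sums of conjugates `g e g⁻¹` of Young idempotents, every `x` is a
combination of vectors `g e (g⁻¹ x)`. -/
lemma le_of_forall_youngProj_mem {P U : Submodule ℚ V} (hP : ∀ g, ∀ x ∈ P, ρ g x ∈ P)
    (hU : ∀ g, ∀ x ∈ U, ρ g x ∈ U)
    (hPU : ∀ (mu : YoungDiagram) (h : mu.cells.card = n), ∀ x ∈ P, youngProj ρ mu h x ∈ U) :
    P ≤ U := by
  intro x hx
  let f : ℚ[Equiv.Perm (Fin n)] →ₗ[ℚ] V := (LinearMap.applyₗ x) ∘ₗ ρ.asAlgebraHom.toLinearMap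
  have h1 : Submodule.span ℚ (Set.range fun mu : {mu : YoungDiagram // mu.cells.card = n} =>
      youngCentral mu.1 mu.2) ≤ U.comap f := by
    rw [Submodule.span_le]
    rintro _ ⟨mu, rfl⟩
    change ρ.asAlgebraHom (youngCentral mu.1 mu.2) x ∈ U
    rw [youngCentral, conjSum, map_sum, LinearMap.sum_apply]
    refine U.sum_mem fun g _ => ?_
    rw [map_mul, map_mul, Representation.asAlgebraHom_of, Representation.asAlgebraHom_of]
    exact hU _ _ (hPU _ _ _ (hP _ _ hx))
  have h2 : ρ.asAlgebraHom 1 x ∈ U := h1 (one_mem_span_youngCentral n)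
  rwa [map_one] at h2

end Multiplicity

/-! ## The comparison map between consecutive multiplicity spaces -/

lemma orbitSpan_le {H : Type*} [Group H] {V : Type*} [AddCommGroup V] [Module ℚ V]
    (ρ : Representation ℚ H V) {W U : Submodule ℚ V} (hU : ∀ g, ∀ x ∈ U, ρ g x ∈ U)
    (hWU : W ≤ U) : orbitSpan ρ W ≤ U := by
  refine iSup_le fun g => ?_
  rintro _ ⟨x, hx, rfl⟩
  exact hU g x (hWU hx)

lemma le_orbitSpan {H : Type*} [Group H] {V : Type*} [AddCommGroup V] [Module ℚ V]
    (ρ : Representation ℚ H V) (W : Submodule ℚ V) : W ≤ orbitSpan ρ W := by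
  intro x hx
  refine Submodule.mem_iSup_of_mem 1 ⟨x, hx, ?_⟩
  rw [map_one]
  rfl

lemma apply_mem_orbitSpan {H : Type*} [Group H] {V : Type*} [AddCommGroup V] [Module ℚ V]
    (ρ : Representation ℚ H V) (W : Submodule ℚ V) (g : H) :
    ∀ x ∈ orbitSpan ρ W, ρ g x ∈ orbitSpan ρ W := by
  have : orbitSpan ρ W ≤ (orbitSpan ρ W).comap (ρ g) := by
    refine iSup_le fun h => ?_
    rintro _ ⟨x, hx, rfl⟩
    refine Submodule.mem_iSup_of_mem (g * h) ⟨x, hx, ?_⟩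
    rw [map_mul]
    rfl
  exact this

section Comparison

variable {n : ℕ} {V V' : Type*} [AddCommGroup V] [Module ℚ V] [AddCommGroup V'] [Module ℚ V']
  (ρ : Representation ℚ (Equiv.Perm (Fin n)) V)
  (ρ' : Representation ℚ (Equiv.Perm (Fin (n + 1))) V') (φ : V →ₗ[ℚ] V')
  (hφ : ∀ s x, φ (ρ s x) = ρ' (permInclusion n s) (φ x))

include hφ in
lemma map_asAlgebraHom (r : ℚ[Equiv.Perm (Fin n)]) (x : V) :
    φ (ρ.asAlgebraHom r x) = ρ'.asAlgebraHom (algMap (permInclusion n) r) (φ x) := by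
  induction r using MonoidAlgebra.induction_on with
  | of g => rw [algMap_of, Representation.asAlgebraHom_of, Representation.asAlgebraHom_of, hφ]
  | add r s hr hs => simp only [map_add, LinearMap.add_apply, hr, hs]
  | smul t r hr => simp only [map_smul, LinearMap.smul_apply, hr]

lemma asAlgebraHom_comm {H : Type*} [Group H] (σ : Representation ℚ H V) {A : V →ₗ[ℚ] V}
    (hA : ∀ g x, σ g (A x) = A (σ g x)) (r : ℚ[H]) (x : V) :
    σ.asAlgebraHom r (A x) = A (σ.asAlgebraHom r x) := by
  induction r using MonoidAlgebra.induction_on with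
  | of g => rw [Representation.asAlgebraHom_of, hA]
  | add r s hr hs => simp only [map_add, LinearMap.add_apply, hr, hs]
  | smul t r hr => simp only [map_smul, LinearMap.smul_apply, hr]

variable {lam mu : YoungDiagram} (hl : lam.cells.card = n) (hm : mu.cells.card = n + 1)

/-- If `t` spans the multiplicity space of `V_lam` in the restriction of `V_mu`, then the map
`t φ` is injective on the multiplicity space of `V_lam` in a monotone sequence. -/
lemma injOn_range_youngProj {t : ℚ[Equiv.Perm (Fin (n + 1))]} (hφ : ∀ s x,
    φ (ρ s x) = ρ' (permInclusion n s) (φ x))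
    (ht : ∀ r, ∃ c : ℚ, youngIdem mu hm * r * youngIdemSucc lam hl = c • t)
    (hcont : ∀ W : Submodule ℚ V, IsSumOfCopies ρ (irrep lam hl) 1 W →
      ∃ W' : Submodule ℚ V', W' ≤ orbitSpan ρ' (W.map φ) ∧ IsSumOfCopies ρ' (irrep mu hm) 1 W')
    {x : V} (hx : youngProj ρ lam hl x = x) (h0 : ρ'.asAlgebraHom t (φ x) = 0) : x = 0 := by
  by_contra hne
  obtain ⟨W, hW, hWU⟩ := exists_isSumOfCopies ρ hl (x := fun _ : Fin 1 => x)
    (LinearIndependent.of_subsingleton 0 hne) fun _ => hx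
  obtain ⟨W', hW', hW'c⟩ := hcont W hW
  obtain ⟨y, hy, hye⟩ := hW'c.exists_linearIndependent ρ' hm
  let F : ℚ[Equiv.Perm (Fin n)] →ₗ[ℚ] V := (LinearMap.applyₗ x) ∘ₗ ρ.asAlgebraHom.toLinearMap
  let F' : ℚ[Equiv.Perm (Fin (n + 1))] →ₗ[ℚ] V' :=
    (LinearMap.applyₗ (φ x)) ∘ₗ ρ'.asAlgebraHom.toLinearMap
  have h1 : W ≤ LinearMap.range F := by
    refine hWU _ ?_ fun _ => ⟨1, ?_⟩
    · rintro g _ ⟨r, rfl⟩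
      refine ⟨MonoidAlgebra.of ℚ _ g * r, ?_⟩
      change ρ.asAlgebraHom _ x = ρ g (ρ.asAlgebraHom r x)
      rw [map_mul, Representation.asAlgebraHom_of]
      rfl
    · change ρ.asAlgebraHom 1 x = x
      rw [map_one]
      rfl
  -- The orbit span of `φ(W)` is contained in the cyclic module generated by `φ(x)`.
  have h2 : orbitSpan ρ' (W.map φ) ≤ LinearMap.range F' := by
    refine orbitSpan_le ρ' ?_ ?_
    · rintro g _ ⟨r, rfl⟩
      refine ⟨MonoidAlgebra.of ℚ _ g * r, ?_⟩
      change ρ'.asAlgebraHom _ (φ x) = ρ' g (ρ'.asAlgebraHom r (φ x))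
      rw [map_mul, Representation.asAlgebraHom_of]
      rfl
    · rintro _ ⟨w, hw, rfl⟩
      obtain ⟨r, rfl⟩ := h1 hw
      exact ⟨algMap (permInclusion n) r, (map_asAlgebraHom ρ ρ' φ hφ r x).symm⟩
  obtain ⟨r, hr⟩ := h2 (hW' (hye 0).1)
  have hr' : ρ'.asAlgebraHom r (φ x) = y 0 := hr
  refine hy.ne_zero 0 ?_
  -- With `e` and `f` the two idempotents, `y 0 = f r φ(x) = f r e φ(x)`, because `f` fixes `y 0`
  -- and `e` fixes `x`. This is a multiple of `t φ(x) = 0`, against independence.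
  obtain ⟨c, hc⟩ := ht r
  rw [← (hye 0).2, ← hr', youngProj, ← hx, youngProj, map_asAlgebraHom ρ ρ' φ hφ,
    ← Module.End.mul_apply, ← Module.End.mul_apply, ← map_mul, ← map_mul]
  have hc' := hc
  rw [youngIdemSucc] at hc'
  rw [hc', map_smul, LinearMap.smul_apply, h0, smul_zero]

/-- The operators `t φ` and `S` restrict to mutually inverse maps between the images of the Young
projections of `lam` and `mu`. -/
structure IsComparison (t : ℚ[Equiv.Perm (Fin (n + 1))]) (S : V' →ₗ[ℚ] V) : Prop where
  idem_mul : youngIdem mu hm * t = t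
  left_inv : ∀ x, S (ρ'.asAlgebraHom t (φ (youngProj ρ lam hl x))) = youngProj ρ lam hl x
  right_inv : ∀ y, ρ'.asAlgebraHom t (φ (S (youngProj ρ' mu hm y))) = youngProj ρ' mu hm y
  proj_apply : ∀ y, youngProj ρ lam hl (S y) = S y

variable {ρ ρ' φ hl hm}

lemma IsComparison.proj_asAlgebraHom {t : ℚ[Equiv.Perm (Fin (n + 1))]} {S : V' →ₗ[ℚ] V}
    (h : IsComparison ρ ρ' φ hl hm t S) (y : V') :
    youngProj ρ' mu hm (ρ'.asAlgebraHom t y) = ρ'.asAlgebraHom t y := by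
  rw [youngProj, ← Module.End.mul_apply, ← map_mul, h.idem_mul]

lemma IsComparison.multiplicity_eq [FiniteDimensional ℚ V] [FiniteDimensional ℚ V']
    {t : ℚ[Equiv.Perm (Fin (n + 1))]} {S : V' →ₗ[ℚ] V} (h : IsComparison ρ ρ' φ hl hm t S) :
    multiplicity ρ (irrep lam hl) = multiplicity ρ' (irrep mu hm) := by
  rw [multiplicity_irrep, multiplicity_irrep]
  refine le_antisymm ?_ ?_
  · refine LinearMap.finrank_le_finrank_of_injective (f := LinearMap.codRestrict _
      (ρ'.asAlgebraHom t ∘ₗ φ ∘ₗ Submodule.subtype _) fun x => ⟨_, h.proj_asAlgebraHom _⟩) ?_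
    rintro ⟨_, x, rfl⟩ ⟨_, y, rfl⟩ hxy
    refine Subtype.ext ?_
    change youngProj _ _ _ x = youngProj _ _ _ y
    rw [← h.left_inv x, ← h.left_inv y]
    exact congrArg S (congrArg Subtype.val hxy)
  · refine LinearMap.finrank_le_finrank_of_injective (f := LinearMap.codRestrict _
      (S ∘ₗ Submodule.subtype _) fun x => ⟨_, h.proj_apply _⟩) ?_
    rintro ⟨_, x, rfl⟩ ⟨_, y, rfl⟩ hxy
    refine Subtype.ext ?_
    change youngProj _ _ _ x = youngProj _ _ _ y
    rw [← h.right_inv x, ← h.right_inv y]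
    exact congrArg (fun z => ρ'.asAlgebraHom t (φ z)) (congrArg Subtype.val hxy)

/-- The operator `t φ` carries independent vectors fixed by the first idempotent to vectors fixed by
the second, inside the orbit span. They stay independent because `S` is a left inverse. -/
lemma IsComparison.exists_isSumOfCopies {t : ℚ[Equiv.Perm (Fin (n + 1))]} {S : V' →ₗ[ℚ] V}
    (h : IsComparison ρ ρ' φ hl hm t S) {k : ℕ} {W : Submodule ℚ V}
    (hW : IsSumOfCopies ρ (irrep lam hl) k W) : ∃ W' : Submodule ℚ V',
      W' ≤ orbitSpan ρ' (W.map φ) ∧ IsSumOfCopies ρ' (irrep mu hm) k W' := by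
  obtain ⟨x, hx, hxe⟩ := hW.exists_linearIndependent
  have hx' : LinearIndependent ℚ fun j => ρ'.asAlgebraHom t (φ (x j)) := by
    refine LinearIndependent.of_comp S ?_
    convert hx using 1
    funext j
    have := h.left_inv (x j)
    rwa [(hxe j).2] at this
  obtain ⟨W', hW', hW'le⟩ := RepStability.exists_isSumOfCopies ρ' hm hx'
    fun j => h.proj_asAlgebraHom _
  refine ⟨W', hW'le _ (apply_mem_orbitSpan _ _) fun j => ?_, hW'⟩
  exact asAlgebraHom_mem _ (apply_mem_orbitSpan _ _) t
    (le_orbitSpan _ _ (Submodule.mem_map_of_mem (hxe j).1))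

variable (ρ ρ' φ hl hm)

/-- The maps `φ` of a monotone sequence with stable multiplicities identify the multiplicity spaces
of `V_lam` and `V_mu`, by means of an element of the group algebra. -/
lemma exists_comparison [FiniteDimensional ℚ V] [FiniteDimensional ℚ V']
    (hφ : ∀ s x, φ (ρ s x) = ρ' (permInclusion n s) (φ x))
    (hcont : ∀ W : Submodule ℚ V, IsSumOfCopies ρ (irrep lam hl) 1 W →
      ∃ W' : Submodule ℚ V', W' ≤ orbitSpan ρ' (W.map φ) ∧ IsSumOfCopies ρ' (irrep mu hm) 1 W')
    (hmult : multiplicity ρ (irrep lam hl) = multiplicity ρ' (irrep mu hm)) :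
    ∃ (t : ℚ[Equiv.Perm (Fin (n + 1))]) (S : V' →ₗ[ℚ] V),
      IsComparison ρ ρ' φ hl hm t S ∧
      ∀ (A : V →ₗ[ℚ] V) (A' : V' →ₗ[ℚ] V'), (∀ g x, ρ g (A x) = A (ρ g x)) →
        (∀ g x, ρ' g (A' x) = A' (ρ' g x)) → (∀ x, φ (A x) = A' (φ x)) →
        ∀ y, S (A' y) = A (S y) := by
  obtain ⟨t, hft, ht⟩ := exists_forall_corner_eq_smul hl hm
  have hinj := fun x => injOn_range_youngProj ρ ρ' φ hl hm (x := x) hφ ht hcont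
  have htmem : ∀ y, ρ'.asAlgebraHom t y ∈ LinearMap.range (youngProj ρ' mu hm) := by
    intro y
    refine ⟨ρ'.asAlgebraHom t y, ?_⟩
    rw [youngProj, ← Module.End.mul_apply, ← map_mul, hft]
  let T : LinearMap.range (youngProj ρ lam hl) →ₗ[ℚ] LinearMap.range (youngProj ρ' mu hm) :=
    LinearMap.codRestrict _ (ρ'.asAlgebraHom t ∘ₗ φ ∘ₗ Submodule.subtype _) fun x => htmem _
  have hT : Function.Injective T := by
    rw [← LinearMap.ker_eq_bot, LinearMap.ker_eq_bot']
    intro x hx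
    exact Subtype.ext (hinj x.1 ((youngProj_eq_self_iff ρ hl).2 x.2) (congrArg Subtype.val hx))
  rw [multiplicity_irrep, multiplicity_irrep] at hmult
  let Te := T.linearEquivOfInjective hT hmult
  have hTe : ∀ x, (Te x).1 = ρ'.asAlgebraHom t (φ x.1) := fun _ => rfl
  -- The inverse is defined only on the image of the second idempotent; projecting to that image
  -- first makes it a map on all of `V'`.
  let S : V' →ₗ[ℚ] V :=
    Submodule.subtype _ ∘ₗ Te.symm.toLinearMap ∘ₗ (youngProj ρ' mu hm).rangeRestrict
  have hS : ∀ y, ρ'.asAlgebraHom t (φ (S y)) = youngProj ρ' mu hm y := by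
    intro y
    have : S y = (Te.symm ((youngProj ρ' mu hm).rangeRestrict y)).1 := rfl
    rw [this, ← hTe, LinearEquiv.apply_symm_apply]
    rfl
  have hSe : ∀ y, youngProj ρ lam hl (S y) = S y := fun y =>
    (youngProj_eq_self_iff ρ hl).2 (Subtype.property _)
  have hinj' : ∀ x y, youngProj ρ lam hl x = x → youngProj ρ lam hl y = y →
      ρ'.asAlgebraHom t (φ x) = ρ'.asAlgebraHom t (φ y) → x = y := by
    intro x y hx hy hxy
    refine sub_eq_zero.1 (hinj _ ?_ ?_)
    · rw [map_sub, hx, hy]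
    · rw [map_sub, map_sub, hxy, sub_self]
  refine ⟨t, S, ⟨hft, fun x => ?_, fun y => ?_, hSe⟩, fun A A' hA hA' hAA' y => ?_⟩
  · refine hinj' _ _ (hSe _) (youngProj_youngProj ρ hl x) ?_
    rw [hS]
    exact (youngProj_eq_self_iff ρ' hm).2 (htmem _)
  · rw [hS, youngProj_youngProj]
  -- Both `S (A' y)` and `A (S y)` are fixed by the first idempotent, where `t φ` is injective, and
  -- `t φ` sends both to the projection of `A' y`.
  · refine hinj' _ _ (hSe _) ?_ ?_
    · rw [youngProj, asAlgebraHom_comm ρ hA, ← youngProj, hSe]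
    · rw [hS, hAA', asAlgebraHom_comm ρ' hA', hS, youngProj, asAlgebraHom_comm ρ' hA']

end Comparison

/-! ## Every Young diagram is padded -/

/-- Take for `lam` the diagram without its first row. The padding condition says that the second row
of `mu` is not longer than the first. -/
lemma exists_padded_eq {n : ℕ} (mu : YoungDiagram) (hmu : mu.cells.card = n) :
    ∃ (lam : YoungDiagram) (h : lam.card + lam.rowLen 0 ≤ n), padded lam n h = mu := by
  let lam : YoungDiagram :=
    { cells := (mu.cells.filter fun c => c.1 ≠ 0).image fun c => (c.1 - 1, c.2)
      isLowerSet := by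
        rintro ⟨a, b⟩ ⟨a', b'⟩ ⟨h1, h2⟩ hab
        simp only [Finset.coe_image, Finset.coe_filter, Set.mem_image, Set.mem_ofPred_eq,
          Prod.mk.injEq, Prod.exists, YoungDiagram.mem_cells] at hab ⊢
        simp only at h1 h2
        obtain ⟨i, j, ⟨hij, hi⟩, rfl, rfl⟩ := hab
        exact ⟨a' + 1, b', ⟨mu.up_left_mem (by omega) h2 hij, by omega⟩, by omega, rfl⟩ }
  have hmem : ∀ i j, (i, j) ∈ lam ↔ (i + 1, j) ∈ mu := by
    intro i j
    rw [← YoungDiagram.mem_cells, ← YoungDiagram.mem_cells]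
    simp only [lam, Finset.mem_image, Finset.mem_filter, Prod.exists, Prod.mk.injEq]
    constructor
    · rintro ⟨a, b, ⟨h1, h2⟩, h3, rfl⟩
      rwa [show i + 1 = a by omega]
    · intro h
      exact ⟨i + 1, j, ⟨h, by omega⟩, rfl, rfl⟩
  have hcard : lam.card + mu.rowLen 0 = n := by
    have h1 : lam.cells.card = (mu.cells.filter fun c => c.1 ≠ 0).card := by
      refine Finset.card_image_of_injOn ?_
      rintro ⟨a, b⟩ h ⟨a', b'⟩ h' e
      simp only [Finset.coe_filter, Set.mem_ofPred_eq] at h h'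
      simp only [Prod.mk.injEq] at e ⊢
      omega
    rw [YoungDiagram.card, h1, ← card_filter_fst_eq, ← hmu, add_comm]
    exact Finset.card_filter_add_card_filter_not fun c : ℕ × ℕ => c.1 = 0
  have hrow : lam.rowLen 0 ≤ mu.rowLen 0 := by
    refine le_trans (le_of_forall_lt fun j hj => ?_) (mu.rowLen_anti 0 1 (Nat.zero_le 1))
    rw [← YoungDiagram.mem_iff_lt_rowLen] at hj ⊢
    exact (hmem 0 j).1 hj
  refine ⟨lam, by omega, ?_⟩
  ext ⟨i, j⟩
  simp only [padded, Finset.mem_union, Finset.mem_image, Finset.mem_range, Prod.mk.injEq,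
    Prod.exists, YoungDiagram.mem_cells]
  rcases i with _ | i
  · rw [YoungDiagram.mem_iff_lt_rowLen]
    constructor
    · rintro (⟨k, hk, -, rfl⟩ | ⟨a, b, -, h, -⟩)
      · omega
      · omega
    · intro h
      exact Or.inl ⟨j, by omega, rfl, rfl⟩
  · constructor
    · rintro (⟨k, hk, h, -⟩ | ⟨a, b, hab, h, rfl⟩)
      · omega
      · obtain rfl : a = i := by omega
        exact (hmem _ _).1 hab
    · intro h
      exact Or.inr ⟨i, j, (hmem _ _).2 h, rfl, rfl⟩


/-! ## Functoriality of cohomology in the coefficients -/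

section Functoriality

variable {X : Type u} [TopologicalSpace X] {x₀ : X} {V W U : Type v} [AddCommGroup V] [Module ℚ V]
  [AddCommGroup W] [Module ℚ W] [AddCommGroup U] [Module ℚ U]
  {α : Representation ℚ (FundamentalGroup X x₀) V} {β : Representation ℚ (FundamentalGroup X x₀) W}
  {γ : Representation ℚ (FundamentalGroup X x₀) U}

lemma localCohomologyMap_comp (f : V →ₗ[ℚ] W) (hf : ∀ g x, f (α g x) = β g (f x))
    (k : W →ₗ[ℚ] U) (hk : ∀ g x, k (β g x) = γ g (k x))
    (hkf : ∀ g x, (k ∘ₗ f) (α g x) = γ g ((k ∘ₗ f) x)) (p : ℕ) (c : LocalCohomology α p) :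
    localCohomologyMap (k ∘ₗ f) hkf p c =
      localCohomologyMap k hk p (localCohomologyMap f hf p c) := by
  obtain ⟨c, rfl⟩ := Submodule.Quotient.mk_surjective _ c
  rfl

lemma localCohomologyMap_add (f k : V →ₗ[ℚ] W) (hf : ∀ g x, f (α g x) = β g (f x))
    (hk : ∀ g x, k (α g x) = β g (k x))
    (hfk : ∀ g x, (f + k) (α g x) = β g ((f + k) x)) (p : ℕ) :
    localCohomologyMap (f + k) hfk p = localCohomologyMap f hf p + localCohomologyMap k hk p := by
  ext c
  rfl

lemma localCohomologyMap_smul (r : ℚ) (f : V →ₗ[ℚ] W) (hf : ∀ g x, f (α g x) = β g (f x))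
    (hrf : ∀ g x, (r • f) (α g x) = β g ((r • f) x)) (p : ℕ) :
    localCohomologyMap (r • f) hrf p = r • localCohomologyMap f hf p := by
  ext c
  rfl

lemma localCohomologyMap_congr {f k : V →ₗ[ℚ] W} (hf : ∀ g x, f (α g x) = β g (f x))
    (hk : ∀ g x, k (α g x) = β g (k x)) (hfk : ∀ x, f x = k x) (p : ℕ) :
    localCohomologyMap f hf p = localCohomologyMap k hk p := by
  obtain rfl : f = k := LinearMap.ext hfk
  rfl

lemma localCohomologyMap_eq_zero {f : V →ₗ[ℚ] W} (hf : ∀ g x, f (α g x) = β g (f x))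
    (h0 : ∀ x, f x = 0) (p : ℕ) : localCohomologyMap f hf p = 0 := by
  have h1 : f = 0 := LinearMap.ext h0
  subst h1
  rw [localCohomologyMap_congr hf (k := (0 : ℚ) • 0)
    (fun g x => by simp) (fun x => by simp), localCohomologyMap_smul 0 0 hf, zero_smul]

/-- This is where linearity of `H^p` in the coefficients is used: it makes Young projections of
cohomology the maps induced by Young projections of the coefficients. -/
lemma asAlgebraHom_localCohomologyRep {H : Type*} [Group H] (ρ : Representation ℚ H V)
    (hc : ∀ g s x, ρ s (α g x) = α g (ρ s x)) (p : ℕ) (r : ℚ[H])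
    (hr : ∀ g x, ρ.asAlgebraHom r (α g x) = α g (ρ.asAlgebraHom r x)) :
    (localCohomologyRep α ρ hc p).asAlgebraHom r = localCohomologyMap (ρ.asAlgebraHom r) hr p := by
  induction r using MonoidAlgebra.induction_on with
  | of g =>
    rw [Representation.asAlgebraHom_of]
    exact localCohomologyMap_congr _ _ (fun x => by rw [Representation.asAlgebraHom_of]) p
  | add r s hr' hs' =>
    have h1 : ∀ r : ℚ[H], ∀ g x, ρ.asAlgebraHom r (α g x) = α g (ρ.asAlgebraHom r x) :=
      fun r g => asAlgebraHom_comm ρ (fun s x => hc g s x) r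
    rw [map_add, hr' (h1 r), hs' (h1 s), ← localCohomologyMap_add _ _ _ _ (fun g x => by
      rw [← map_add]; exact h1 _ g x)]
    exact localCohomologyMap_congr _ _ (fun x => by rw [map_add]) p
  | smul t r hr' =>
    have h1 : ∀ r : ℚ[H], ∀ g x, ρ.asAlgebraHom r (α g x) = α g (ρ.asAlgebraHom r x) :=
      fun r g => asAlgebraHom_comm ρ (fun s x => hc g s x) r
    rw [map_smul, hr' (h1 r), ← localCohomologyMap_smul _ _ _ (fun g x => by
      rw [← map_smul]; exact h1 _ g x)]
    exact localCohomologyMap_congr _ _ (fun x => by rw [map_smul]) p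

variable {n : ℕ} {ρ : Representation ℚ (Equiv.Perm (Fin n)) V}
  {ρ' : Representation ℚ (Equiv.Perm (Fin (n + 1))) W} {φ : V →ₗ[ℚ] W}
  {lam mu : YoungDiagram} {hl : lam.cells.card = n} {hm : mu.cells.card = n + 1}

/-- A comparison of multiplicity spaces induces one in cohomology. -/
lemma IsComparison.localCohomology {t : ℚ[Equiv.Perm (Fin (n + 1))]} {S : W →ₗ[ℚ] V}
    (h : IsComparison ρ ρ' φ hl hm t S) (hρ : ∀ g s x, ρ s (α g x) = α g (ρ s x))
    (hρ' : ∀ g s x, ρ' s (β g x) = β g (ρ' s x)) (hφ : ∀ g x, φ (α g x) = β g (φ x))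
    (hS : ∀ g x, S (β g x) = α g (S x)) (p : ℕ) :
    IsComparison (localCohomologyRep α ρ hρ p) (localCohomologyRep β ρ' hρ' p)
      (localCohomologyMap φ hφ p) hl hm t (localCohomologyMap S hS p) := by
  have hE : ∀ g x, youngProj ρ lam hl (α g x) = α g (youngProj ρ lam hl x) :=
    fun g => asAlgebraHom_comm ρ (fun s x => hρ g s x) _
  have hE' : ∀ g x, youngProj ρ' mu hm (β g x) = β g (youngProj ρ' mu hm x) :=
    fun g => asAlgebraHom_comm ρ' (fun s x => hρ' g s x) _
  have ht : ∀ g x, ρ'.asAlgebraHom t (β g x) = β g (ρ'.asAlgebraHom t x) :=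
    fun g => asAlgebraHom_comm ρ' (fun s x => hρ' g s x) _
  have e1 : youngProj (localCohomologyRep α ρ hρ p) lam hl =
      localCohomologyMap (youngProj ρ lam hl) hE p := asAlgebraHom_localCohomologyRep _ _ _ _ hE
  have e2 : youngProj (localCohomologyRep β ρ' hρ' p) mu hm =
      localCohomologyMap (youngProj ρ' mu hm) hE' p :=
    asAlgebraHom_localCohomologyRep _ _ _ _ hE'
  have e3 : (localCohomologyRep β ρ' hρ' p).asAlgebraHom t =
      localCohomologyMap (ρ'.asAlgebraHom t) ht p := asAlgebraHom_localCohomologyRep _ _ _ _ ht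
  refine ⟨h.idem_mul, fun x => ?_, fun y => ?_, fun y => ?_⟩
  -- Each identity is one between composites of equivariant maps; equivariance of the partial
  -- composites allows functoriality to be applied factor by factor.
  · have c1 : ∀ g x, (φ ∘ₗ youngProj ρ lam hl) (α g x) = β g ((φ ∘ₗ youngProj ρ lam hl) x) :=
      fun g x => by rw [LinearMap.comp_apply, hE, hφ]; rfl
    have c2 : ∀ g x, (ρ'.asAlgebraHom t ∘ₗ φ ∘ₗ youngProj ρ lam hl) (α g x) =
        β g ((ρ'.asAlgebraHom t ∘ₗ φ ∘ₗ youngProj ρ lam hl) x) :=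
      fun g x => by rw [LinearMap.comp_apply, c1, ht]; rfl
    have c3 : ∀ g x, (S ∘ₗ ρ'.asAlgebraHom t ∘ₗ φ ∘ₗ youngProj ρ lam hl) (α g x) =
        α g ((S ∘ₗ ρ'.asAlgebraHom t ∘ₗ φ ∘ₗ youngProj ρ lam hl) x) :=
      fun g x => by rw [LinearMap.comp_apply, c2, hS]; rfl
    rw [e1, e3, ← localCohomologyMap_comp _ hE _ hφ c1, ← localCohomologyMap_comp _ c1 _ ht c2,
      ← localCohomologyMap_comp _ c2 _ hS c3, localCohomologyMap_congr c3 hE h.left_inv]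
  · have c1 : ∀ g x, (S ∘ₗ youngProj ρ' mu hm) (β g x) = α g ((S ∘ₗ youngProj ρ' mu hm) x) :=
      fun g x => by rw [LinearMap.comp_apply, hE', hS]; rfl
    have c2 : ∀ g x, (φ ∘ₗ S ∘ₗ youngProj ρ' mu hm) (β g x) =
        β g ((φ ∘ₗ S ∘ₗ youngProj ρ' mu hm) x) :=
      fun g x => by rw [LinearMap.comp_apply, c1, hφ]; rfl
    have c3 : ∀ g x, (ρ'.asAlgebraHom t ∘ₗ φ ∘ₗ S ∘ₗ youngProj ρ' mu hm) (β g x) =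
        β g ((ρ'.asAlgebraHom t ∘ₗ φ ∘ₗ S ∘ₗ youngProj ρ' mu hm) x) :=
      fun g x => by rw [LinearMap.comp_apply, c2, ht]; rfl
    rw [e2, e3, ← localCohomologyMap_comp _ hE' _ hS c1, ← localCohomologyMap_comp _ c1 _ hφ c2,
      ← localCohomologyMap_comp _ c2 _ ht c3, localCohomologyMap_congr c3 hE' h.right_inv]
  · have c1 : ∀ g x, (youngProj ρ lam hl ∘ₗ S) (β g x) = α g ((youngProj ρ lam hl ∘ₗ S) x) :=
      fun g x => by rw [LinearMap.comp_apply, hS, hE]; rfl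
    rw [e1, ← localCohomologyMap_comp _ hS _ hE c1, localCohomologyMap_congr c1 hS h.proj_apply]

end Functoriality

/-! ## Stability of the cohomology -/

section Stability

variable {X : Type u} [TopologicalSpace X] {x₀ : X}
  {V : ℕ → Type v} [∀ n, AddCommGroup (V n)] [∀ n, Module ℚ (V n)]
  {ρ : ∀ n, Representation ℚ (Equiv.Perm (Fin n)) (V n)}
  {α : ∀ n, Representation ℚ (FundamentalGroup X x₀) (V n)}
  {φ : ∀ n, V n →ₗ[ℚ] V (n + 1)} (hcons : IsConsistent ρ φ) (hcomp : IsCompatible α ρ φ)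
  {N : ℕ} (hmono : IsMonotone ρ φ N) (hstab : IsUniformlyRepStable ρ φ N) (p : ℕ)

local notation "ρH" => fun n => localCohomologyRep (α n) (ρ n) (hcomp.commute n) p
local notation "φH" => fun n => localCohomologyMap (φ n) (hcomp.equivariant n) p

include hcons in
lemma isConsistent_localCohomology :
    IsConsistent (V := fun n => LocalCohomology (α n) p) ρH φH := by
  intro n s x
  have h1 : ∀ g x, (φ n ∘ₗ ρ n s) (α n g x) = α (n + 1) g ((φ n ∘ₗ ρ n s) x) := by
    intro g x
    rw [LinearMap.comp_apply, hcomp.commute, hcomp.equivariant]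
    rfl
  have h2 : ∀ g x, (ρ (n + 1) (permInclusion n s) ∘ₗ φ n) (α n g x) =
      α (n + 1) g ((ρ (n + 1) (permInclusion n s) ∘ₗ φ n) x) := by
    intro g x
    rw [LinearMap.comp_apply, hcomp.equivariant, hcomp.commute]
    rfl
  have h3 := localCohomologyMap_congr h1 h2 (fun x => hcons n s x) p
  have h4 := localCohomologyMap_comp (ρ n s) (fun g x => hcomp.commute n g s x) (φ n)
    (hcomp.equivariant n) h1 p x
  have h5 := localCohomologyMap_comp (φ n) (hcomp.equivariant n) (ρ (n + 1) (permInclusion n s))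
    (fun g x => hcomp.commute (n + 1) g _ x) h2 p x
  exact h4.symm.trans ((congrArg (fun f => f x) h3).trans h5)

include hcomp in
lemma asAlgebraHom_equivariant (n : ℕ) (r : ℚ[Equiv.Perm (Fin n)]) (g : FundamentalGroup X x₀)
    (x : V n) : (ρ n).asAlgebraHom r (α n g x) = α n g ((ρ n).asAlgebraHom r x) :=
  asAlgebraHom_comm (ρ n) (fun s x => hcomp.commute n g s x) r x

include hcons hmono hstab in
lemma exists_comparison_localCohomology {n : ℕ} (hn : N ≤ n) (lam : YoungDiagram)
    (h : lam.card + lam.rowLen 0 ≤ n) :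
    ∃ (t : ℚ[Equiv.Perm (Fin (n + 1))])
      (S : LocalCohomology (α (n + 1)) p →ₗ[ℚ] LocalCohomology (α n) p),
      IsComparison (ρH n) (ρH (n + 1)) (φH n) (card_padded lam n h)
        (card_padded lam (n + 1) (h.trans n.le_succ)) t S := by
  have := hstab.finiteDimensional n
  have := hstab.finiteDimensional (n + 1)
  have hmult := hstab.multiplicityStable lam n (n + 1) hn (hn.trans n.le_succ)
  rw [paddedMultiplicity, paddedMultiplicity, dif_pos h, dif_pos (h.trans n.le_succ)] at hmult
  obtain ⟨t, S, h1, h2⟩ := exists_comparison (ρ n) (ρ (n + 1)) (φ n)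
    (card_padded lam n h) (card_padded lam (n + 1) (h.trans n.le_succ)) (hcons n)
    (hmono.contains n hn lam h 1) hmult
  -- An element of the fundamental group acts by operators commuting with the symmetric groups and
  -- with `φ`, so `S` is equivariant and induces a map in cohomology.
  have hS : ∀ g y, S (α (n + 1) g y) = α n g (S y) := fun g y =>
    h2 (α n g) (α (n + 1) g) (fun s x => hcomp.commute n g s x)
      (fun s x => hcomp.commute (n + 1) g s x) (hcomp.equivariant n g) y
  exact ⟨t, _, h1.localCohomology (hcomp.commute n) (hcomp.commute (n + 1)) (hcomp.equivariant n)
    hS p⟩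

-- The multiplicity at `n` is zero by convention. By stability the idempotent is zero on the
-- coefficients at `n + 1`, and so in cohomology.
include hstab in
lemma youngProj_localCohomology_eq_zero {n : ℕ} (hn : N ≤ n) (lam : YoungDiagram)
    (h : lam.card + lam.rowLen 0 ≤ n + 1) (h' : ¬ lam.card + lam.rowLen 0 ≤ n) :
    youngProj (ρH (n + 1)) (padded lam (n + 1) h) (card_padded lam (n + 1) h) = 0 := by
  have := hstab.finiteDimensional (n + 1)
  have hmult := hstab.multiplicityStable lam n (n + 1) hn (hn.trans n.le_succ)
  rw [paddedMultiplicity, paddedMultiplicity, dif_neg h', dif_pos h, multiplicity_irrep,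
    eq_comm, Submodule.finrank_eq_zero, LinearMap.range_eq_bot] at hmult
  rw [youngProj, asAlgebraHom_localCohomologyRep _ _ _ _ (asAlgebraHom_equivariant hcomp (n + 1) _)]
  exact localCohomologyMap_eq_zero _ (fun x => congrArg (fun f => f x) hmult) p

-- The kernel is invariant under `S_n`, and on the image of each Young idempotent the comparison map
-- provides a left inverse factoring through `φ`.
include hcons hmono hstab in
lemma injective_localCohomologyMap {n : ℕ} (hn : N ≤ n) :
    Function.Injective (localCohomologyMap (φ n) (hcomp.equivariant n) p) := by
  have hconsH := isConsistent_localCohomology hcons hcomp p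
  rw [← LinearMap.ker_eq_bot, eq_bot_iff]
  refine le_of_forall_youngProj_mem (ρH n) (fun g x hx => ?_) (fun g x hx => ?_)
    fun mu hmu x hx => ?_
  · rw [LinearMap.mem_ker] at hx ⊢
    exact (hconsH n g x).trans (by rw [hx, map_zero])
  · rw [Submodule.mem_bot] at hx ⊢
    rw [hx, map_zero]
  · rw [Submodule.mem_bot]
    rw [LinearMap.mem_ker] at hx
    obtain ⟨lam, h, rfl⟩ := exists_padded_eq mu hmu
    obtain ⟨t, S, hS⟩ := exists_comparison_localCohomology hcons hcomp hmono hstab p hn lam h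
    rw [← hS.left_inv, youngProj]
    have := map_asAlgebraHom (ρH n) (ρH (n + 1)) (φH n) (hconsH n)
      (youngIdem (padded lam n h) (card_padded lam n h)) x
    rw [this, hx, map_zero, map_zero, map_zero]

-- The identity `f y = t φ(S (f y))` exhibits each Young component as an element of the span, unless
-- the idempotent acts as zero.
include hcons hmono hstab in
lemma orbitSpan_localCohomologyMap {n : ℕ} (hn : N ≤ n) :
    orbitSpan (ρH (n + 1)) (LinearMap.range (localCohomologyMap (φ n) (hcomp.equivariant n) p)) =
      ⊤ := by
  rw [eq_top_iff]
  refine le_of_forall_youngProj_mem (ρH (n + 1)) (fun g x hx => Submodule.mem_top)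
    (apply_mem_orbitSpan _ _) fun mu hmu y _ => ?_
  obtain ⟨lam, h, rfl⟩ := exists_padded_eq mu hmu
  by_cases h' : lam.card + lam.rowLen 0 ≤ n
  · obtain ⟨t, S, hS⟩ := exists_comparison_localCohomology hcons hcomp hmono hstab p hn lam h'
    rw [← hS.right_inv y]
    exact asAlgebraHom_mem _ (apply_mem_orbitSpan _ _) t
      (le_orbitSpan _ _ (LinearMap.mem_range_self _ _))
  · rw [youngProj_localCohomology_eq_zero hcomp hstab p hn lam h h']
    exact Submodule.zero_mem _

include hcons hmono hstab in
lemma paddedMultiplicity_localCohomology_succ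
    (hfin : ∀ n, FiniteDimensional ℚ (LocalCohomology (α n) p)) {n : ℕ} (hn : N ≤ n)
    (lam : YoungDiagram) :
    paddedMultiplicity (ρH n) lam = paddedMultiplicity (ρH (n + 1)) lam := by
  rw [paddedMultiplicity, paddedMultiplicity]
  by_cases h : lam.card + lam.rowLen 0 ≤ n
  · rw [dif_pos h, dif_pos (h.trans n.le_succ)]
    obtain ⟨t, S, hS⟩ := exists_comparison_localCohomology hcons hcomp hmono hstab p hn lam h
    exact hS.multiplicity_eq
  · rw [dif_neg h]
    split_ifs with h'
    · rw [multiplicity_irrep, youngProj_localCohomology_eq_zero hcomp hstab p hn lam h' h,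
        LinearMap.range_zero, finrank_bot]
    · rfl

include hcons hmono hstab in
theorem stability_of_finiteDimensional
    (hfin : ∀ n, FiniteDimensional ℚ (LocalCohomology (α n) p)) :
    IsMonotone (V := fun n => LocalCohomology (α n) p) ρH φH N ∧
      IsUniformlyRepStable (V := fun n => LocalCohomology (α n) p) ρH φH N := by
  refine ⟨⟨isConsistent_localCohomology hcons hcomp p,
    fun n hn => injective_localCohomologyMap hcons hcomp hmono hstab p hn,
    fun n hn lam h k W hW => ?_⟩,
    ⟨hfin, fun n _ => isConsistent_localCohomology hcons hcomp p n,
    fun n hn => injective_localCohomologyMap hcons hcomp hmono hstab p hn,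
    fun n hn => orbitSpan_localCohomologyMap hcons hcomp hmono hstab p hn, ?_⟩⟩
  · obtain ⟨t, S, hS⟩ := exists_comparison_localCohomology hcons hcomp hmono hstab p hn lam h
    exact hS.exists_isSumOfCopies hW
  intro lam m n hm hn
  have key : ∀ n, N ≤ n → paddedMultiplicity (ρH n) lam = paddedMultiplicity (ρH N) lam := by
    intro n hn
    induction n, hn using Nat.le_induction with
    | base => rfl
    | succ n hn ih =>
      rw [← ih]
      exact (paddedMultiplicity_localCohomology_succ hcons hcomp hmono hstab p hfin hn lam).symm
  exact (key m hm).trans (key n hn).symm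

end Stability


/-! ## Affine simplices in convex sets -/

section AffineSimplices

variable {E E' : Type*} [NormedAddCommGroup E] [NormedSpace ℝ E] [NormedAddCommGroup E']
  [NormedSpace ℝ E'] {s : Set E} {s' : Set E'} [Fact (Convex ℝ s)] [Fact (Convex ℝ s')]

instance fact_convex_stdSimplex (q : ℕ) : Fact (Convex ℝ (stdSimplex ℝ (Fin (q + 1)))) :=
  ⟨convex_stdSimplex ℝ _⟩

/-- The affine singular simplex with given vertices in a convex set. -/
def affineSimplex {q : ℕ} (w : Fin (q + 1) → s) : C(Simplex q, s) where
  toFun t := ⟨∑ i, t.1 i • (w i : E), (Fact.out : Convex ℝ s).sum_mem (fun i _ => t.2.1 i) t.2.2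
    fun i _ => (w i).2⟩
  continuous_toFun := by
    refine Continuous.subtype_mk (continuous_finsetSum _ fun i _ => ?_) _
    exact ((continuous_apply i).comp continuous_subtype_val).smul continuous_const

lemma affineSimplex_coe {q : ℕ} (w : Fin (q + 1) → s) (t : Simplex q) :
    (affineSimplex w t : E) = ∑ i, t.1 i • (w i : E) := rfl

lemma affineSimplex_vertex {q : ℕ} (w : Fin (q + 1) → s) (i : Fin (q + 1)) :
    affineSimplex w (stdSimplex.vertex i) = w i := by
  apply Subtype.ext
  rw [affineSimplex_coe, Finset.sum_eq_single i]
  · simp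
  · intro j _ hj
    simp [Pi.single_eq_of_ne hj]
  · simp

lemma affineSimplex_comp_face {q : ℕ} (w : Fin (q + 2) → s) (i : Fin (q + 2)) :
    (affineSimplex w).comp (face q i) = affineSimplex (w ∘ i.succAbove) := by
  ext t
  change ∑ j, FunOnFinite.linearMap ℝ ℝ i.succAbove t.1 j • (w j : E) =
    ∑ j, t.1 j • (w (i.succAbove j) : E)
  simp_rw [FunOnFinite.linearMap_apply_apply, Finset.sum_smul]
  rw [← Finset.sum_fiberwise Finset.univ i.succAbove]
  refine Finset.sum_congr rfl fun j _ => Finset.sum_congr rfl fun k hk => ?_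
  rw [(Finset.mem_filter.1 hk).2]

/-- A map of convex sets is affine if it maps affine simplices to affine simplices. -/
def IsAffine (κ : s → s') : Prop :=
  ∀ (q : ℕ) (w : Fin (q + 1) → s) (t : Simplex q),
    κ (affineSimplex w t) = affineSimplex (κ ∘ w) t

lemma isAffine_affineSimplex {p : ℕ} (v : Fin (p + 1) → s) : IsAffine (affineSimplex v) := by
  intro q w t
  apply Subtype.ext
  simp only [affineSimplex_coe, Function.comp, Finset.sum_apply, Pi.smul_apply, smul_eq_mul,
    Finset.sum_smul, Finset.smul_sum, smul_smul]
  exact Finset.sum_comm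

lemma isAffine_of_coe_eq (κ : s → s') (f : E →ₗ[ℝ] E') (h : ∀ x, (κ x : E') = f x) :
    IsAffine κ := by
  intro q w t
  apply Subtype.ext
  rw [h, affineSimplex_coe, affineSimplex_coe, map_sum]
  refine Finset.sum_congr rfl fun i _ => ?_
  rw [map_smul, Function.comp, h]

lemma affineSimplex_vertices (p : ℕ) :
    affineSimplex (fun i : Fin (p + 1) => (stdSimplex.vertex i : Simplex p)) =
      ContinuousMap.id _ := by
  ext t j
  change (∑ i, t.1 i • (Pi.single i 1 : Fin (p + 1) → ℝ)) j = t.1 j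
  simp [Finset.sum_apply, Pi.single_apply]

end AffineSimplices

/-! ## Chains of tuples of points -/

section TupleChains

/-- Formal combinations of tuples of `q` points; these are the affine chains of dimension
`q - 1` of a convex set. -/
abbrev TupleChain (q : ℕ) (K : Type*) : Type _ := (Fin q → K) →₀ ℚ

variable {K K' : Type*}

/-- The boundary of a chain of tuples. -/
def tupleBoundary (q : ℕ) : TupleChain (q + 1) K →ₗ[ℚ] TupleChain q K :=
  Finsupp.linearCombination ℚ fun w =>
    ∑ i : Fin (q + 1), ((-1 : ℚ) ^ (i : ℕ)) • Finsupp.single (w ∘ i.succAbove) 1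

/-- The cone over a chain of tuples. -/
def cone {q : ℕ} (a : K) : TupleChain q K →ₗ[ℚ] TupleChain (q + 1) K :=
  Finsupp.lmapDomain ℚ ℚ fun w => Fin.cons a w

/-- The image of a chain of tuples under a map. -/
def pushTuple {q : ℕ} (κ : K → K') : TupleChain q K →ₗ[ℚ] TupleChain q K' :=
  Finsupp.lmapDomain ℚ ℚ fun w => κ ∘ w

lemma tupleBoundary_single {q : ℕ} (w : Fin (q + 1) → K) :
    tupleBoundary q (Finsupp.single w 1) =
      ∑ i : Fin (q + 1), ((-1 : ℚ) ^ (i : ℕ)) • Finsupp.single (w ∘ i.succAbove) 1 := by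
  rw [tupleBoundary, Finsupp.linearCombination_single, one_smul]

lemma cone_single {q : ℕ} (a : K) (w : Fin q → K) :
    cone a (Finsupp.single w 1) = Finsupp.single (Fin.cons a w : Fin (q + 1) → K) 1 := by
  rw [cone, Finsupp.lmapDomain_apply, Finsupp.mapDomain_single]

lemma pushTuple_single {q : ℕ} (κ : K → K') (w : Fin q → K) :
    pushTuple κ (Finsupp.single w 1) = Finsupp.single (κ ∘ w) 1 := by
  rw [pushTuple, Finsupp.lmapDomain_apply, Finsupp.mapDomain_single]

lemma tupleChain_hom_ext {q : ℕ} {M : Type*} [AddCommGroup M] [Module ℚ M]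
    {f g : TupleChain q K →ₗ[ℚ] M} (h : ∀ w, f (Finsupp.single w 1) = g (Finsupp.single w 1)) :
    f = g := by
  refine Finsupp.lhom_ext' fun w => LinearMap.ext_ring ?_
  exact h w

/-- Omitting the apex returns the tuple; omitting a later point gives the cone over a face with the
sign reversed. The empty tuple is allowed as an augmentation, and in that degree the last term
disappears. -/
lemma tupleBoundary_cone {q : ℕ} (a : K) (ξ : TupleChain (q + 1) K) :
    tupleBoundary (q + 1) (cone a ξ) = ξ - cone a (tupleBoundary q ξ) := by
  have h : tupleBoundary (q + 1) ∘ₗ cone a =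
      LinearMap.id - cone a ∘ₗ tupleBoundary (K := K) q := by
    refine tupleChain_hom_ext fun w => ?_
    simp only [LinearMap.comp_apply, LinearMap.sub_apply, LinearMap.id_apply, cone_single,
      tupleBoundary_single, map_sum, map_smul]
    rw [Fin.sum_univ_succ, sub_eq_add_neg, ← Finset.sum_neg_distrib]
    congr 1
    · rw [Fin.val_zero, pow_zero, one_smul]
      rfl
    · refine Finset.sum_congr rfl fun i _ => ?_
      rw [Fin.val_succ, pow_succ, mul_neg_one, neg_smul]
      congr 3
      funext j
      refine Fin.cases ?_ (fun j => ?_) j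
      · simp
      · simp
  exact LinearMap.congr_fun h ξ

lemma tupleBoundary_cone_zero (a : K) (ξ : TupleChain 0 K) :
    tupleBoundary 0 (cone a ξ) = ξ := by
  have h : tupleBoundary 0 ∘ₗ cone a = LinearMap.id (R := ℚ) (M := TupleChain 0 K) := by
    refine tupleChain_hom_ext fun w => ?_
    simp only [LinearMap.comp_apply, LinearMap.id_apply, cone_single, tupleBoundary_single]
    rw [Fin.sum_univ_one, Fin.val_zero, pow_zero, one_smul]
    congr 1
  exact LinearMap.congr_fun h ξ

/-- Every nonempty tuple is the cone over its tail, so the cone formula reduces the claim to the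
degree below. -/
lemma tupleBoundary_tupleBoundary (q : ℕ) (ξ : TupleChain (q + 2) K) :
    tupleBoundary q (tupleBoundary (q + 1) ξ) = 0 := by
  induction q with
  | zero =>
    have h : tupleBoundary 0 ∘ₗ tupleBoundary (K := K) 1 = 0 := by
      refine tupleChain_hom_ext fun w => ?_
      rw [LinearMap.comp_apply, ← Fin.cons_self_tail w, ← cone_single, tupleBoundary_cone, map_sub,
        tupleBoundary_cone_zero, sub_self, LinearMap.zero_apply]
    exact LinearMap.congr_fun h ξ
  | succ q ih =>
    have h : tupleBoundary (q + 1) ∘ₗ tupleBoundary (K := K) (q + 2) = 0 := by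
      refine tupleChain_hom_ext fun w => ?_
      rw [LinearMap.comp_apply, ← Fin.cons_self_tail w, ← cone_single, tupleBoundary_cone, map_sub,
        tupleBoundary_cone, ih, map_zero, sub_zero, sub_self, LinearMap.zero_apply]
    exact LinearMap.congr_fun h ξ

lemma pushTuple_tupleBoundary {q : ℕ} (κ : K → K') (ξ : TupleChain (q + 1) K) :
    pushTuple κ (tupleBoundary q ξ) = tupleBoundary q (pushTuple κ ξ) := by
  have h : pushTuple κ ∘ₗ tupleBoundary q = tupleBoundary q ∘ₗ pushTuple κ := by
    refine tupleChain_hom_ext fun w => ?_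
    simp only [LinearMap.comp_apply, pushTuple_single, tupleBoundary_single, map_sum, map_smul,
      Function.comp_assoc]
  exact LinearMap.congr_fun h ξ

lemma pushTuple_cone {q : ℕ} (κ : K → K') (a : K) (ξ : TupleChain q K) :
    pushTuple κ (cone a ξ) = cone (κ a) (pushTuple κ ξ) := by
  have h : pushTuple κ ∘ₗ cone (q := q) a = cone (κ a) ∘ₗ pushTuple κ := by
    refine tupleChain_hom_ext fun w => ?_
    simp only [LinearMap.comp_apply, pushTuple_single, cone_single]
    congr 1
    funext j
    refine Fin.cases ?_ (fun j => ?_) j <;> simp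
  exact LinearMap.congr_fun h ξ

/-- The chain homotopy between two maps of chains of tuples, obtained by taking cones with given
apexes. -/
def coneHomotopy (f g : ∀ q, TupleChain q K →ₗ[ℚ] TupleChain q K')
    (a : ∀ q, (Fin (q + 1) → K) → K') : ∀ q, TupleChain q K →ₗ[ℚ] TupleChain (q + 1) K'
  | 0 => 0
  | q + 1 => Finsupp.linearCombination ℚ fun w =>
      cone (a q w) (f (q + 1) (Finsupp.single w 1) - g (q + 1) (Finsupp.single w 1) -
        coneHomotopy f g a q (tupleBoundary q (Finsupp.single w 1)))

lemma coneHomotopy_single (f g : ∀ q, TupleChain q K →ₗ[ℚ] TupleChain q K')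
    (a : ∀ q, (Fin (q + 1) → K) → K') (q : ℕ) (w : Fin (q + 1) → K) :
    coneHomotopy f g a (q + 1) (Finsupp.single w 1) =
      cone (a q w) (f (q + 1) (Finsupp.single w 1) - g (q + 1) (Finsupp.single w 1) -
        coneHomotopy f g a q (tupleBoundary q (Finsupp.single w 1))) := by
  rw [coneHomotopy, Finsupp.linearCombination_single, one_smul]

/-- The chain whose cone is taken is a cycle by induction, so the boundary of its cone is the chain
itself. Agreement in the augmentation degree starts the induction. -/
lemma tupleBoundary_coneHomotopy {f g : ∀ q, TupleChain q K →ₗ[ℚ] TupleChain q K'}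
    (a : ∀ q, (Fin (q + 1) → K) → K')
    (hf : ∀ q ξ, tupleBoundary q (f (q + 1) ξ) = f q (tupleBoundary q ξ))
    (hg : ∀ q ξ, tupleBoundary q (g (q + 1) ξ) = g q (tupleBoundary q ξ))
    (h0 : f 0 = g 0) (q : ℕ) (ξ : TupleChain (q + 1) K) :
    tupleBoundary (q + 1) (coneHomotopy f g a (q + 1) ξ) =
      f (q + 1) ξ - g (q + 1) ξ - coneHomotopy f g a q (tupleBoundary q ξ) := by
  induction q with
  | zero =>
    have h : tupleBoundary 1 ∘ₗ coneHomotopy f g a 1 =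
        f 1 - g 1 - coneHomotopy f g a 0 ∘ₗ tupleBoundary 0 := by
      refine tupleChain_hom_ext fun w => ?_
      simp only [LinearMap.comp_apply, LinearMap.sub_apply]
      rw [coneHomotopy_single, tupleBoundary_cone]
      simp [map_sub, hf, hg, h0, coneHomotopy]
    exact LinearMap.congr_fun h ξ
  | succ q ih =>
    have h : tupleBoundary (q + 2) ∘ₗ coneHomotopy f g a (q + 2) =
        f (q + 2) - g (q + 2) - coneHomotopy f g a (q + 1) ∘ₗ tupleBoundary (q + 1) := by
      refine tupleChain_hom_ext fun w => ?_
      simp only [LinearMap.comp_apply, LinearMap.sub_apply]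
      rw [coneHomotopy_single, tupleBoundary_cone]
      simp only [map_sub, ih, hf, hg, tupleBoundary_tupleBoundary, map_zero]
      abel
    exact LinearMap.congr_fun h ξ

lemma pushTuple_coneHomotopy {L L' : Type*} {f g : ∀ q, TupleChain q K →ₗ[ℚ] TupleChain q K'}
    {f' g' : ∀ q, TupleChain q L →ₗ[ℚ] TupleChain q L'} {a : ∀ q, (Fin (q + 1) → K) → K'}
    {a' : ∀ q, (Fin (q + 1) → L) → L'} {κ : K → L} {κ' : K' → L'}
    (hf : ∀ q ξ, pushTuple κ' (f q ξ) = f' q (pushTuple κ ξ))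
    (hg : ∀ q ξ, pushTuple κ' (g q ξ) = g' q (pushTuple κ ξ))
    (ha : ∀ q w, κ' (a q w) = a' q (κ ∘ w)) (q : ℕ) (ξ : TupleChain q K) :
    pushTuple κ' (coneHomotopy f g a q ξ) = coneHomotopy f' g' a' q (pushTuple κ ξ) := by
  induction q with
  | zero => simp [coneHomotopy]
  | succ q ih =>
    have h : pushTuple κ' ∘ₗ coneHomotopy f g a (q + 1) =
        coneHomotopy f' g' a' (q + 1) ∘ₗ pushTuple κ := by
      refine tupleChain_hom_ext fun w => ?_
      simp only [LinearMap.comp_apply]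
      rw [coneHomotopy_single, pushTuple_cone, pushTuple_single, coneHomotopy_single, ha]
      simp only [map_sub, ih, hf, hg, pushTuple_tupleBoundary, pushTuple_single]
    exact LinearMap.congr_fun h ξ

end TupleChains

/-! ## Subdivision and prisms -/

section Subdivision

variable {E E' : Type*} [NormedAddCommGroup E] [NormedSpace ℝ E] [NormedAddCommGroup E']
  [NormedSpace ℝ E'] {s : Set E} {s' : Set E'} [Fact (Convex ℝ s)] [Fact (Convex ℝ s')]

/-- The barycenter of a tuple of points of a convex set. -/
def tupleBarycenter {q : ℕ} (w : Fin (q + 1) → s) : s := affineSimplex w stdSimplex.barycenter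

/-- Barycentric subdivision of chains of tuples. -/
def subdivision : ∀ q, TupleChain q s →ₗ[ℚ] TupleChain q s
  | 0 => LinearMap.id
  | q + 1 => Finsupp.linearCombination ℚ fun w =>
      cone (tupleBarycenter w) (subdivision q (tupleBoundary q (Finsupp.single w 1)))

lemma subdivision_single {q : ℕ} (w : Fin (q + 1) → s) :
    subdivision (q + 1) (Finsupp.single w 1) =
      cone (tupleBarycenter w) (subdivision q (tupleBoundary q (Finsupp.single w 1))) := by
  rw [subdivision, Finsupp.linearCombination_single, one_smul]

lemma tupleBoundary_subdivision (q : ℕ) (ξ : TupleChain (q + 1) s) :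
    tupleBoundary q (subdivision (q + 1) ξ) = subdivision q (tupleBoundary q ξ) := by
  induction q with
  | zero =>
    have h : tupleBoundary 0 ∘ₗ subdivision (s := s) 1 = subdivision 0 ∘ₗ tupleBoundary 0 := by
      refine tupleChain_hom_ext fun w => ?_
      rw [LinearMap.comp_apply, LinearMap.comp_apply, subdivision_single, tupleBoundary_cone_zero]
    exact LinearMap.congr_fun h ξ
  | succ q ih =>
    have h : tupleBoundary (q + 1) ∘ₗ subdivision (s := s) (q + 2) =
        subdivision (q + 1) ∘ₗ tupleBoundary (q + 1) := by
      refine tupleChain_hom_ext fun w => ?_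
      rw [LinearMap.comp_apply, LinearMap.comp_apply, subdivision_single, tupleBoundary_cone, ih,
        tupleBoundary_tupleBoundary, map_zero, map_zero, sub_zero]
    exact LinearMap.congr_fun h ξ

lemma IsAffine.map_tupleBarycenter {κ : s → s'} (hκ : IsAffine κ) {q : ℕ} (w : Fin (q + 1) → s) :
    κ (tupleBarycenter w) = tupleBarycenter (κ ∘ w) := hκ q w _

lemma IsAffine.pushTuple_subdivision {κ : s → s'} (hκ : IsAffine κ) (q : ℕ)
    (ξ : TupleChain q s) : pushTuple κ (subdivision q ξ) = subdivision q (pushTuple κ ξ) := by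
  induction q with
  | zero => rfl
  | succ q ih =>
    have h : pushTuple κ ∘ₗ subdivision (q + 1) = subdivision (q + 1) ∘ₗ pushTuple κ := by
      refine tupleChain_hom_ext fun w => ?_
      rw [LinearMap.comp_apply, LinearMap.comp_apply, subdivision_single, pushTuple_cone, ih,
        pushTuple_tupleBoundary, pushTuple_single, subdivision_single, hκ.map_tupleBarycenter]
    exact LinearMap.congr_fun h ξ

/-- The chain homotopy from the identity to the barycentric subdivision. -/
def subdivisionHomotopy (q : ℕ) : TupleChain q s →ₗ[ℚ] TupleChain (q + 1) s :=
  coneHomotopy (fun _ => LinearMap.id) subdivision (fun _ w => w 0) q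

lemma tupleBoundary_subdivisionHomotopy (q : ℕ) (ξ : TupleChain (q + 1) s) :
    tupleBoundary (q + 1) (subdivisionHomotopy (q + 1) ξ) =
      ξ - subdivision (q + 1) ξ - subdivisionHomotopy q (tupleBoundary q ξ) :=
  tupleBoundary_coneHomotopy (f := fun _ => LinearMap.id) (g := subdivision) (fun _ w => w 0)
    (fun _ _ => rfl) tupleBoundary_subdivision rfl q ξ

lemma IsAffine.pushTuple_subdivisionHomotopy {κ : s → s'} (hκ : IsAffine κ) (q : ℕ)
    (ξ : TupleChain q s) :
    pushTuple κ (subdivisionHomotopy q ξ) = subdivisionHomotopy q (pushTuple κ ξ) :=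
  pushTuple_coneHomotopy (f := fun _ => LinearMap.id) (g := subdivision)
    (f' := fun _ => LinearMap.id) (g' := subdivision) (a := fun _ w => w 0) (a' := fun _ w => w 0)
    (fun _ _ => rfl) hκ.pushTuple_subdivision (fun _ _ => rfl) q ξ

/-- The chain homotopy between the maps of chains of tuples induced by two maps. -/
def prism {K K' : Type*} (i₀ i₁ : K → K') (q : ℕ) : TupleChain q K →ₗ[ℚ] TupleChain (q + 1) K' :=
  coneHomotopy (fun _ => pushTuple i₁) (fun _ => pushTuple i₀) (fun _ w => i₀ (w 0)) q

lemma tupleBoundary_prism {K K' : Type*} (i₀ i₁ : K → K') (q : ℕ) (ξ : TupleChain (q + 1) K) :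
    tupleBoundary (q + 1) (prism i₀ i₁ (q + 1) ξ) =
      pushTuple i₁ ξ - pushTuple i₀ ξ - prism i₀ i₁ q (tupleBoundary q ξ) := by
  refine tupleBoundary_coneHomotopy (f := fun _ => pushTuple i₁) (g := fun _ => pushTuple i₀)
    (fun _ w => i₀ (w 0)) (fun _ _ => (pushTuple_tupleBoundary _ _).symm)
    (fun _ _ => (pushTuple_tupleBoundary _ _).symm) ?_ q ξ
  refine tupleChain_hom_ext fun w => ?_
  simp only [pushTuple_single]
  congr 1
  exact Subsingleton.elim _ _

lemma pushTuple_comp {K K' K'' : Type*} {q : ℕ} (κ : K → K') (κ' : K' → K'')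
    (ξ : TupleChain q K) : pushTuple κ' (pushTuple κ ξ) = pushTuple (κ' ∘ κ) ξ := by
  have h : pushTuple κ' ∘ₗ pushTuple κ = pushTuple (q := q) (κ' ∘ κ) :=
    tupleChain_hom_ext fun w => by simp only [LinearMap.comp_apply, pushTuple_single]; rfl
  exact LinearMap.congr_fun h ξ

lemma pushTuple_prism {K K' L L' : Type*} {i₀ i₁ : K → K'} {j₀ j₁ : L → L'} {κ : K → L}
    {κ' : K' → L'} (h₀ : κ' ∘ i₀ = j₀ ∘ κ) (h₁ : κ' ∘ i₁ = j₁ ∘ κ) (q : ℕ)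
    (ξ : TupleChain q K) : pushTuple κ' (prism i₀ i₁ q ξ) = prism j₀ j₁ q (pushTuple κ ξ) :=
  pushTuple_coneHomotopy (f := fun _ => pushTuple i₁) (g := fun _ => pushTuple i₀)
    (f' := fun _ => pushTuple j₁) (g' := fun _ => pushTuple j₀) (a := fun _ w => i₀ (w 0))
    (a' := fun _ w => j₀ (w 0)) (fun _ _ => by rw [pushTuple_comp, pushTuple_comp, h₁])
    (fun _ _ => by rw [pushTuple_comp, pushTuple_comp, h₀])
    (fun _ w => congrFun h₀ (w 0)) q ξ

end Subdivision

/-! ## Evaluation of cochains on affine chains -/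

section Evaluation

variable {X : Type u} [TopologicalSpace X] {K K' : Type*} [TopologicalSpace K]
  [TopologicalSpace K']

/-- A framing of a map `F : K → X`: compatible classes of paths from the points `F k` to a given
point. -/
structure Framing (F : C(K, X)) (y : FundamentalGroupoid X) where
  hom : ∀ k : K, FundamentalGroupoid.mk (F k) ⟶ y
  comm : ∀ (k l : K) (p : FundamentalGroupoid.mk k ⟶ FundamentalGroupoid.mk l),
    (FundamentalGroupoid.map F).map p ≫ hom l = hom k

/-- The pullback of a framing. -/
def Framing.comp {F : C(K, X)} {y : FundamentalGroupoid X} (Γ : Framing F y) (κ : C(K', K)) :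
    Framing (F.comp κ) y where
  hom k := Γ.hom (κ k)
  comm k l p := by
    refine Eq.trans ?_ (Γ.comm (κ k) (κ l) ((FundamentalGroupoid.map κ).map p))
    induction p using Quotient.inductionOn
    rfl

/-- Transport of a framing to another point. -/
def Framing.postcomp {F : C(K, X)} {y z : FundamentalGroupoid X} (Γ : Framing F y) (f : y ⟶ z) :
    Framing F z where
  hom k := Γ.hom k ≫ f
  comm k l p := (Category.assoc _ _ _).symm.trans (congrArg (· ≫ f) (Γ.comm k l p))

/-- In a convex set there is exactly one class of paths between two given points. -/
lemma unique_hom_of_convex {E : Type*} [NormedAddCommGroup E] [NormedSpace ℝ E] {s : Set E}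
    [hs : Fact (Convex ℝ s)] (k l : s) :
    Nonempty (FundamentalGroupoid.mk k ⟶ FundamentalGroupoid.mk l) ∧
      Subsingleton (FundamentalGroupoid.mk k ⟶ FundamentalGroupoid.mk l) := by
  have : ContractibleSpace s := hs.out.contractibleSpace ⟨k, k.2⟩
  refine ⟨⟨Path.Homotopic.Quotient.mk (PathConnectedSpace.joined k l).somePath⟩, ?_⟩
  exact inferInstanceAs (Subsingleton (Path.Homotopic.Quotient k l))

/-- The framing of a map from a convex set by the images of paths to a base point. -/
def Framing.ofBase {E : Type*} [NormedAddCommGroup E] [NormedSpace ℝ E] {s : Set E}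
    [Fact (Convex ℝ s)] (F : C(s, X)) (b : s) : Framing F (FundamentalGroupoid.mk (F b)) where
  hom k := (FundamentalGroupoid.map F).map (unique_hom_of_convex k b).1.some
  comm k l p := by
    have := (unique_hom_of_convex k b).2
    refine ((FundamentalGroupoid.map F).map_comp _ _).symm.trans ?_
    congr 1
    exact Subsingleton.elim _ _

lemma Framing.ext_hom {F : C(K, X)} {y : FundamentalGroupoid X} {Γ Γ' : Framing F y}
    (h : ∀ k, Γ.hom k = Γ'.hom k) : Γ = Γ' := by
  cases Γ; cases Γ'
  congr
  exact funext h

/-- A framing of a map from a convex set is determined by its value at a point. -/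
lemma Framing.eq_of_convex {E : Type*} [NormedAddCommGroup E] [NormedSpace ℝ E] {s : Set E}
    [Fact (Convex ℝ s)] {F : C(s, X)} {y : FundamentalGroupoid X} {Γ Γ' : Framing F y} (b : s)
    (h : Γ.hom b = Γ'.hom b) : Γ = Γ' := by
  refine Framing.ext_hom fun k => ?_
  rw [← Γ.comm k b (unique_hom_of_convex k b).1.some,
    ← Γ'.comm k b (unique_hom_of_convex k b).1.some, h]

lemma Framing.ofBase_hom {E : Type*} [NormedAddCommGroup E] [NormedSpace ℝ E] {s : Set E}
    [Fact (Convex ℝ s)] (F : C(s, X)) (b : s) : (Framing.ofBase F b).hom b = 𝟙 _ := by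
  have := (unique_hom_of_convex b b).2
  refine Eq.trans ?_ ((FundamentalGroupoid.map F).map_id _)
  change (FundamentalGroupoid.map F).map _ = _
  congr 1
  exact Subsingleton.elim _ _

variable {L : FundamentalGroupoid X ⥤ ModuleCat.{w} ℚ}

/-- The value of a cochain on a simplex of a framed map. -/
def Framing.value {F : C(K, X)} {y : FundamentalGroupoid X} (Γ : Framing F y) {q : ℕ}
    (c : Cochain L q) (a : C(Simplex q, K)) : L.obj y :=
  (L.map (Γ.hom (a (vertexZero q)))).hom (c (F.comp a))

/-- A framing transports all values of a cochain into one fibre. Its compatibility with paths in `K`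
absorbs the transport along the edge in the definition of `coboundary`, leaving the untwisted
formula. -/
lemma Framing.value_coboundary {F : C(K, X)} {y : FundamentalGroupoid X} (Γ : Framing F y)
    {q : ℕ} (c : Cochain L q) (a : C(Simplex (q + 1), K)) :
    Γ.value (coboundary L q c) a =
      ∑ i : Fin (q + 2), ((-1 : ℚ) ^ (i : ℕ)) • Γ.value c (a.comp (face q i)) := by
  rw [Framing.value, coboundary, LinearMap.pi_apply, LinearMap.sum_apply, map_sum]
  refine Finset.sum_congr rfl fun i _ => ?_
  rw [LinearMap.smul_apply, map_smul, LinearMap.comp_apply, LinearMap.proj_apply]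
  congr 1
  rw [← ModuleCat.comp_apply, ← L.map_comp]
  rw [Framing.value]
  congr 3
  exact Γ.comm _ _ ((FundamentalGroupoid.map a).map
    (X := .mk (face q i (vertexZero q))) (Y := .mk (vertexZero (q + 1)))
    (Path.Homotopic.Quotient.mk (segmentPath (face q i (vertexZero q)) (vertexZero (q + 1)))))

variable {E E' : Type*} [NormedAddCommGroup E] [NormedSpace ℝ E] [NormedAddCommGroup E']
  [NormedSpace ℝ E'] {s : Set E} {s' : Set E'} [Fact (Convex ℝ s)] [Fact (Convex ℝ s')]

/-- Evaluation of a cochain on the affine chains of a framed map. -/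
def Framing.eval {F : C(s, X)} {y : FundamentalGroupoid X} (Γ : Framing F y) {q : ℕ}
    (c : Cochain L q) : TupleChain (q + 1) s →ₗ[ℚ] L.obj y :=
  Finsupp.linearCombination ℚ fun w => Γ.value c (affineSimplex w)

lemma Framing.eval_single {F : C(s, X)} {y : FundamentalGroupoid X} (Γ : Framing F y) {q : ℕ}
    (c : Cochain L q) (w : Fin (q + 1) → s) :
    Γ.eval c (Finsupp.single w 1) = Γ.value c (affineSimplex w) := by
  rw [Framing.eval, Finsupp.linearCombination_single, one_smul]

lemma Framing.eval_coboundary {F : C(s, X)} {y : FundamentalGroupoid X} (Γ : Framing F y) {q : ℕ}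
    (c : Cochain L q) (ξ : TupleChain (q + 2) s) :
    Γ.eval (coboundary L q c) ξ = Γ.eval c (tupleBoundary (q + 1) ξ) := by
  have h : Γ.eval (coboundary L q c) = Γ.eval c ∘ₗ tupleBoundary (q + 1) := by
    refine tupleChain_hom_ext fun w => ?_
    rw [LinearMap.comp_apply, eval_single, value_coboundary, tupleBoundary_single, map_sum]
    refine Finset.sum_congr rfl fun i _ => ?_
    rw [map_smul, eval_single, affineSimplex_comp_face]
  exact LinearMap.congr_fun h ξ

lemma Framing.eval_comp {F : C(s, X)} {y : FundamentalGroupoid X} (Γ : Framing F y) {q : ℕ}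
    (c : Cochain L q) (κ : C(s', s)) (hκ : IsAffine κ) (ξ : TupleChain (q + 1) s') :
    (Γ.comp κ).eval c ξ = Γ.eval c (pushTuple κ ξ) := by
  have h : (Γ.comp κ).eval c = Γ.eval c ∘ₗ pushTuple κ := by
    refine tupleChain_hom_ext fun w => ?_
    rw [LinearMap.comp_apply, eval_single, pushTuple_single, eval_single]
    have : affineSimplex (κ ∘ w) = κ.comp (affineSimplex w) := by
      ext1 t
      exact (hκ q w t).symm
    rw [this]
    rfl
  exact LinearMap.congr_fun h ξ

lemma Framing.eval_postcomp {F : C(s, X)} {y z : FundamentalGroupoid X} (Γ : Framing F y)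
    (f : y ⟶ z) {q : ℕ} (c : Cochain L q) (ξ : TupleChain (q + 1) s) :
    (Γ.postcomp f).eval c ξ = (L.map f).hom (Γ.eval c ξ) := by
  have h : (Γ.postcomp f).eval c = (L.map f).hom ∘ₗ Γ.eval c := by
    refine tupleChain_hom_ext fun w => ?_
    rw [LinearMap.comp_apply, eval_single, eval_single, value, value, ← ModuleCat.comp_apply,
      ← L.map_comp]
    rfl
  exact LinearMap.congr_fun h ξ

lemma Framing.eval_add {F : C(s, X)} {y : FundamentalGroupoid X} (Γ : Framing F y) {q : ℕ}
    (c d : Cochain L q) (ξ : TupleChain (q + 1) s) :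
    Γ.eval (c + d) ξ = Γ.eval c ξ + Γ.eval d ξ := by
  have h : Γ.eval (c + d) = Γ.eval c + Γ.eval d := by
    refine tupleChain_hom_ext fun w => ?_
    rw [LinearMap.add_apply, eval_single, eval_single, eval_single, value, Pi.add_apply, map_add]
    rfl
  exact LinearMap.congr_fun h ξ

lemma Framing.eval_smul {F : C(s, X)} {y : FundamentalGroupoid X} (Γ : Framing F y) {q : ℕ}
    (r : ℚ) (c : Cochain L q) (ξ : TupleChain (q + 1) s) :
    Γ.eval (r • c) ξ = r • Γ.eval c ξ := by
  have h : Γ.eval (r • c) = r • Γ.eval c := by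
    refine tupleChain_hom_ext fun w => ?_
    rw [LinearMap.smul_apply, eval_single, eval_single, value, Pi.smul_apply, map_smul]
    rfl
  exact LinearMap.congr_fun h ξ

/-- The tuple of the vertices of the standard simplex. -/
def vertices (p : ℕ) : Fin (p + 1) → Simplex p := fun i => stdSimplex.vertex i

lemma eval_vertices {p : ℕ} (c : Cochain L p) (σ : C(Simplex p, X)) :
    (Framing.ofBase σ (vertexZero p)).eval c (Finsupp.single (vertices p) 1) = c σ := by
  rw [Framing.eval_single, show affineSimplex (vertices p) = _ from affineSimplex_vertices p]
  change (L.map ((Framing.ofBase σ (vertexZero p)).hom (vertexZero p))).hom (c σ) = _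
  rw [Framing.ofBase_hom, L.map_id]
  rfl

/-- Evaluated on the tautological simplex of the standard simplex, the coboundary is dual to the
boundary of tuples, whose square is zero. -/
lemma coboundary_coboundary (p : ℕ) (c : Cochain L p) :
    coboundary L (p + 1) (coboundary L p c) = 0 := by
  funext σ
  rw [← eval_vertices (coboundary L (p + 1) (coboundary L p c)), Framing.eval_coboundary,
    Framing.eval_coboundary, tupleBoundary_tupleBoundary, map_zero]
  rfl

/-- The operator on cochains given by an affine chain in the standard simplex. -/
def chainOperator {p q : ℕ} (A : TupleChain (q + 1) (Simplex p)) :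
    Cochain L q →ₗ[ℚ] Cochain L p where
  toFun c σ := (Framing.ofBase σ (vertexZero p)).eval c A
  map_add' c d := funext fun _ => Framing.eval_add _ c d A
  map_smul' r c := funext fun _ => Framing.eval_smul _ r c A

/-- A chain in the standard simplex acts naturally on affine simplices, so identities between chains
become identities between operators on cochains. The framings to be compared agree at the initial
vertex, hence everywhere by convexity. -/
lemma eval_chainOperator {p q : ℕ} (A : TupleChain (q + 1) (Simplex p)) (c : Cochain L q)
    {F : C(s, X)} {y : FundamentalGroupoid X} (Γ : Framing F y) (w : Fin (p + 1) → s) :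
    Γ.eval (chainOperator A c) (Finsupp.single w 1) =
      Γ.eval c (pushTuple (affineSimplex w) A) := by
  rw [← Framing.eval_comp _ _ _ (isAffine_affineSimplex w), Framing.eval_single]
  change (L.map (Γ.hom (affineSimplex w (vertexZero p)))).hom
    ((Framing.ofBase (F.comp (affineSimplex w)) (vertexZero p)).eval c A) = _
  rw [← Framing.eval_postcomp]
  congr 2
  refine Framing.eq_of_convex (vertexZero p) ?_
  change (Framing.ofBase (F.comp (affineSimplex w)) (vertexZero p)).hom (vertexZero p) ≫ _ = _
  rw [Framing.ofBase_hom, Category.id_comp]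
  rfl

end Evaluation


/-! ## Relative cohomology of families of singular simplices -/

/-- The dimension of a subquotient in the middle of an exact sequence. -/
lemma rank_map_mkQ_le {M₁ M₂ M₃ : Type u} [AddCommGroup M₁] [Module ℚ M₁] [AddCommGroup M₂]
    [Module ℚ M₂] [AddCommGroup M₃] [Module ℚ M₃] (f : M₁ →ₗ[ℚ] M₂) (g : M₂ →ₗ[ℚ] M₃)
    {Z₁ B₁ : Submodule ℚ M₁} {Z₂ B₂ : Submodule ℚ M₂} {Z₃ B₃ : Submodule ℚ M₃}
    (hf : B₁ ≤ B₂.comap f) (hg : B₂ ≤ B₃.comap g) (hZ : Z₂ ≤ Z₃.comap g)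
    (hex : ∀ x ∈ Z₂, g x ∈ B₃ → ∃ y ∈ Z₁, x - f y ∈ B₂) :
    Module.rank ℚ (Z₂.map B₂.mkQ) ≤
      Module.rank ℚ (Z₁.map B₁.mkQ) + Module.rank ℚ (Z₃.map B₃.mkQ) := by
  let f' := Submodule.mapQ B₁ B₂ f hf
  let g' := Submodule.mapQ B₂ B₃ g hg
  let k := g'.domRestrict (Z₂.map B₂.mkQ)
  rw [← LinearMap.rank_range_add_rank_ker k, add_comm]
  refine add_le_add ?_ ?_
  · have h1 : (LinearMap.ker k).map (Z₂.map B₂.mkQ).subtype ≤ (Z₁.map B₁.mkQ).map f' := by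
      rintro _ ⟨⟨_, ⟨x, hx, rfl⟩⟩, hk, rfl⟩
      have hgx : g x ∈ B₃ := (Submodule.Quotient.mk_eq_zero B₃).1 hk
      obtain ⟨y, hy, hxy⟩ := hex x hx hgx
      exact ⟨B₁.mkQ y, ⟨y, hy, rfl⟩, ((Submodule.Quotient.eq B₂).2 hxy).symm⟩
    refine le_trans (LinearEquiv.rank_eq (Submodule.equivMapOfInjective _
      (Submodule.subtype_injective _) (LinearMap.ker k))).le ?_
    exact (Submodule.rank_mono h1).trans (rank_map_le _ _)
  · refine Submodule.rank_mono ?_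
    rintro _ ⟨⟨_, ⟨x, hx, rfl⟩⟩, rfl⟩
    exact ⟨g x, hZ hx, rfl⟩

section Relative

variable {X : Type u} [TopologicalSpace X]

/-- A family of singular simplices of all dimensions. -/
abbrev SimplexFamily (X : Type u) [TopologicalSpace X] : Type u := ∀ p : ℕ, Set C(Simplex p, X)

/-- A family of singular simplices is a sieve if it is closed under precomposition. -/
def IsSieve (S : SimplexFamily X) : Prop :=
  ∀ ⦃p q : ℕ⦄ (κ : C(Simplex q, Simplex p)) (σ : C(Simplex p, X)), σ ∈ S p → σ.comp κ ∈ S q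

lemma IsSieve.sup {S T : SimplexFamily X} (hS : IsSieve S) (hT : IsSieve T) : IsSieve (S ⊔ T) :=
  fun _ _ κ σ hσ => hσ.imp (hS κ σ) (hT κ σ)

/-- The singular simplices with image in a subset. -/
def simplicesIn (A : Set X) : SimplexFamily X := fun _ => {σ | ∀ t, σ t ∈ A}

lemma isSieve_simplicesIn (A : Set X) : IsSieve (simplicesIn A) :=
  fun _ _ κ _ hσ t => hσ (κ t)

lemma simplicesIn_mono {A B : Set X} (h : A ⊆ B) : simplicesIn A ≤ simplicesIn B :=
  fun _ _ hσ t => h (hσ t)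

lemma simplicesIn_inter (A B : Set X) :
    simplicesIn (A ∩ B) = simplicesIn A ⊓ simplicesIn B :=
  funext fun _ => Set.ext fun _ => forall_and

variable (L : FundamentalGroupoid X ⥤ ModuleCat.{w} ℚ)

/-- The cochains that vanish on a family of simplices. -/
def vanishing (S : SimplexFamily X) (p : ℕ) : Submodule ℚ (Cochain L p) where
  carrier := {c | ∀ σ ∈ S p, c σ = 0}
  add_mem' ha hb σ hσ := by rw [Pi.add_apply, ha σ hσ, hb σ hσ, add_zero]
  zero_mem' _ _ := rfl
  smul_mem' r c hc σ hσ := by rw [Pi.smul_apply, hc σ hσ, smul_zero]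

lemma vanishing_anti {S T : SimplexFamily X} (h : S ≤ T) (p : ℕ) :
    vanishing L T p ≤ vanishing L S p := fun _ hc σ hσ => hc σ (h p hσ)

variable {L} in
lemma coboundary_congr {S : SimplexFamily X} (hS : IsSieve S) {p : ℕ} {b c : Cochain L p}
    (h : ∀ σ ∈ S p, b σ = c σ) :
    ∀ σ ∈ S (p + 1), coboundary L p b σ = coboundary L p c σ := by
  intro σ hσ
  simp only [coboundary, LinearMap.pi_apply, LinearMap.sum_apply, LinearMap.smul_apply,
    LinearMap.comp_apply, LinearMap.proj_apply]
  refine Finset.sum_congr rfl fun i _ => ?_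
  rw [h _ (hS _ _ hσ)]

variable {L} in
lemma coboundary_mem_vanishing {S : SimplexFamily X} (hS : IsSieve S) {p : ℕ} {c : Cochain L p}
    (hc : c ∈ vanishing L S p) : coboundary L p c ∈ vanishing L S (p + 1) := by
  intro σ hσ
  rw [coboundary_congr hS (c := 0) hc σ hσ, map_zero]
  rfl

/-- The relative cocycles. -/
def relCocycles (S T : SimplexFamily X) (p : ℕ) : Submodule ℚ (Cochain L p) :=
  vanishing L T p ⊓ (vanishing L S (p + 1)).comap (coboundary L p)

/-- The relative coboundaries. -/
def relCoboundaries (S T : SimplexFamily X) : ∀ p : ℕ, Submodule ℚ (Cochain L p)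
  | 0 => vanishing L S 0
  | p + 1 => (vanishing L T p).map (coboundary L p) ⊔ vanishing L S (p + 1)

/-- The dimension of the relative cohomology of a pair of families of simplices. -/
def relRank (S T : SimplexFamily X) (p : ℕ) : Cardinal.{max u w} :=
  Module.rank ℚ ((relCocycles L S T p).map (relCoboundaries L S T p).mkQ)

/-- A cochain on `S` is represented by an arbitrary extension to all singular simplices, so cochains
vanishing on `S` must count as zero. Since `relRank` takes the image of the cocycles in a quotient,
it makes sense without `T ≤ S`. -/
lemma vanishing_le_relCoboundaries (S T : SimplexFamily X) (p : ℕ) :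
    vanishing L S p ≤ relCoboundaries L S T p := by
  cases p with
  | zero => exact le_rfl
  | succ p => exact le_sup_right

lemma relRank_eq_zero_iff {S T : SimplexFamily X} {p : ℕ} :
    relRank L S T p = 0 ↔ relCocycles L S T p ≤ relCoboundaries L S T p := by
  rw [relRank, rank_zero_iff, Submodule.subsingleton_iff_eq_bot, Submodule.eq_bot_iff]
  constructor
  · exact fun h x hx => (Submodule.Quotient.mk_eq_zero _).1 (h _ ⟨x, hx, rfl⟩)
  · rintro h _ ⟨x, hx, rfl⟩
    exact (Submodule.Quotient.mk_eq_zero _).2 (h hx)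

lemma relCoboundaries_le_relCoboundaries {S T R : SimplexFamily X} (h : R ≤ T) (p : ℕ) :
    relCoboundaries L S T p ≤ relCoboundaries L S R p := by
  cases p with
  | zero => exact le_rfl
  | succ p => exact sup_le_sup_right (Submodule.map_mono (vanishing_anti L h p)) _

lemma relCoboundaries_le_relCoboundaries' {S T R : SimplexFamily X} (h : T ≤ S) (p : ℕ) :
    relCoboundaries L S R p ≤ relCoboundaries L T R p := by
  cases p with
  | zero => exact vanishing_anti L h 0
  | succ p => exact sup_le_sup_left (vanishing_anti L h _) _

lemma relCoboundaries_le_comap_coboundary (S T R : SimplexFamily X) (p : ℕ) :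
    relCoboundaries L T R p ≤ (relCoboundaries L S T (p + 1)).comap (coboundary L p) := by
  cases p with
  | zero => exact fun c hc => Submodule.mem_sup_left ⟨c, hc, rfl⟩
  | succ p =>
    intro c hc
    obtain ⟨_, ⟨b, hb, rfl⟩, z, hz, rfl⟩ := Submodule.mem_sup.1 hc
    rw [Submodule.mem_comap, map_add, coboundary_coboundary, zero_add]
    exact Submodule.mem_sup_left ⟨z, hz, rfl⟩

/-- Exactness of the sequence of a triple at the cohomology of the big pair. -/
lemma relRank_le_add_of_triple {S T R : SimplexFamily X} (hRT : R ≤ T) (hTS : T ≤ S) (p : ℕ) :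
    relRank L S R p ≤ relRank L S T p + relRank L T R p := by
  refine rank_map_mkQ_le LinearMap.id LinearMap.id (relCoboundaries_le_relCoboundaries L hRT p)
    (relCoboundaries_le_relCoboundaries' L hTS p)
    (inf_le_inf_left _ (Submodule.comap_mono (vanishing_anti L hTS _))) ?_
  intro x hx hxB
  cases p with
  | zero => exact ⟨x, ⟨hxB, hx.2⟩, by simp⟩
  | succ p =>
    obtain ⟨_, ⟨b, hb, rfl⟩, z, hz, rfl⟩ := Submodule.mem_sup.1 hxB
    refine ⟨z, ⟨hz, ?_⟩, ?_⟩
    · have h := hx.2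
      rw [SetLike.mem_coe, Submodule.mem_comap] at h ⊢
      rw [map_add, coboundary_coboundary, zero_add] at h
      exact h
    · rw [LinearMap.id_apply, add_sub_cancel_right]
      exact Submodule.mem_sup_left ⟨b, hb, rfl⟩

/-- Exactness of the sequence of a triple after the connecting map. -/
lemma relRank_succ_le_add_of_triple {S T R : SimplexFamily X} (hRT : R ≤ T) (hTS : T ≤ S) (p : ℕ) :
    relRank L S T (p + 1) ≤ relRank L T R p + relRank L S R (p + 1) := by
  refine rank_map_mkQ_le (coboundary L p) LinearMap.id
    (relCoboundaries_le_comap_coboundary L S T R p)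
    (relCoboundaries_le_relCoboundaries L hRT _) (inf_le_inf_right _ (vanishing_anti L hRT _)) ?_
  intro x hx hxB
  obtain ⟨_, ⟨b, hb, rfl⟩, z, hz, h⟩ := Submodule.mem_sup.1 hxB
  rw [LinearMap.id_apply] at h
  subst h
  refine ⟨b, ⟨hb, ?_⟩, ?_⟩
  · have h := Submodule.sub_mem _ hx.1 (vanishing_anti L hTS _ hz)
    rwa [add_sub_cancel_right] at h
  · rw [add_sub_cancel_left]
    exact Submodule.mem_sup_right hz

/-- Exactness of the sequence of a triple before the connecting map. -/
lemma relRank_le_add_succ_of_triple {S T R : SimplexFamily X} (hRT : R ≤ T) (hTS : T ≤ S)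
    (p : ℕ) : relRank L T R p ≤ relRank L S R p + relRank L S T (p + 1) := by
  refine rank_map_mkQ_le LinearMap.id (coboundary L p)
    (relCoboundaries_le_relCoboundaries' L hTS p) (relCoboundaries_le_comap_coboundary L S T R p)
    (fun c hc => ⟨hc.2, ?_⟩) ?_
  · rw [SetLike.mem_coe, Submodule.mem_comap, coboundary_coboundary]
    exact Submodule.zero_mem _
  · intro x hx hxB
    obtain ⟨_, ⟨y, hy, rfl⟩, z, hz, h⟩ := Submodule.mem_sup.1 hxB
    refine ⟨x - y, ⟨Submodule.sub_mem _ hx.1 (vanishing_anti L hRT p hy), ?_⟩, ?_⟩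
    · rw [SetLike.mem_coe, Submodule.mem_comap, map_sub, ← h, add_sub_cancel_left]
      exact hz
    · rw [LinearMap.id_apply, sub_sub_cancel]
      exact vanishing_le_relCoboundaries L T R p hy

/-- In degree zero the relative coboundaries do not involve the smaller family. -/
lemma relRank_zero_le {S T R : SimplexFamily X} (hRT : R ≤ T) :
    relRank L S T 0 ≤ relRank L S R 0 := by
  refine Submodule.rank_mono (Submodule.map_mono ?_)
  exact inf_le_inf_right _ (vanishing_anti L hRT _)

/-- Excision for unions of families of simplices. -/
lemma relRank_sup_le {S T : SimplexFamily X} (hS : IsSieve S) (hT : IsSieve T) (p : ℕ) :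
    relRank L (S ⊔ T) T p ≤ relRank L S (S ⊓ T) p := by
  classical
  -- Exactness with a zero term on the left expresses injectivity of restriction to `S`.
  have h := rank_map_mkQ_le (0 : Cochain L p →ₗ[ℚ] Cochain L p) (LinearMap.id)
    (Z₁ := ⊥) (B₁ := ⊥) (Z₂ := relCocycles L (S ⊔ T) T p) (B₂ := relCoboundaries L (S ⊔ T) T p)
    (Z₃ := relCocycles L S (S ⊓ T) p) (B₃ := relCoboundaries L S (S ⊓ T) p) bot_le
    ((relCoboundaries_le_relCoboundaries L inf_le_right p).trans
      (relCoboundaries_le_relCoboundaries' L le_sup_left p))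
    (inf_le_inf (vanishing_anti L inf_le_right _)
      (Submodule.comap_mono (vanishing_anti L le_sup_left _))) ?_
  · rw [Submodule.map_bot, rank_bot, zero_add] at h
    exact h
  · intro x hx hxB
    refine ⟨0, Submodule.zero_mem _, ?_⟩
    rw [LinearMap.zero_apply, sub_zero]
    rw [LinearMap.id_apply] at hxB
    cases p with
    | zero => exact fun σ hσ => hσ.elim (hxB σ) (hx.1 σ)
    | succ p =>
      obtain ⟨_, ⟨b, hb, rfl⟩, z, hz, rfl⟩ := Submodule.mem_sup.1 hxB
      -- As `b` vanishes on `S ⊓ T`, its restriction to `S` extended by zero vanishes on all of `T`.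
      let b' : Cochain L p := fun σ => if σ ∈ S p then b σ else 0
      have hbS : ∀ σ ∈ S p, b' σ = b σ := fun σ hσ => if_pos hσ
      have hbT : b' ∈ vanishing L T p := by
        intro σ hσ
        by_cases h : σ ∈ S p
        · rw [hbS σ h]
          exact hb σ ⟨h, hσ⟩
        · exact if_neg h
      refine Submodule.mem_sup.2 ⟨_, ⟨b', hbT, rfl⟩, coboundary L p b + z - coboundary L p b', ?_,
        add_sub_cancel _ _⟩
      rintro σ (hσ | hσ)
      · rw [Pi.sub_apply, Pi.add_apply, coboundary_congr hS hbS σ hσ, hz σ hσ, add_zero, sub_self]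
      · rw [Pi.sub_apply, coboundary_mem_vanishing hT hbT σ hσ, sub_zero]
        exact hx.1 σ hσ

/-- The cohomology of the union of an increasing sequence of families. -/
lemma relRank_top_eq_zero {S : ℕ → SimplexFamily X} (hS : ∀ k, IsSieve (S k)) (hmono : Monotone S)
    (hunion : ∀ p (σ : C(Simplex p, X)), ∃ k, σ ∈ S k p) (m p : ℕ)
    (h : ∀ k, m ≤ k → relRank L (S (k + 1)) (S k) p = 0) : relRank L ⊤ (S m) p = 0 := by
  classical
  simp only [relRank_eq_zero_iff] at h ⊢
  rintro c ⟨hc, hδ⟩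
  have hδ0 : coboundary L p c = 0 := funext fun σ => hδ σ trivial
  cases p with
  | zero =>
    have hk : ∀ k, c ∈ vanishing L (S (m + k)) 0 := by
      intro k
      induction k with
      | zero => exact hc
      | succ k ih =>
        exact h (m + k) (Nat.le_add_right _ _)
          ⟨ih, by rw [SetLike.mem_coe, Submodule.mem_comap, hδ0]; exact Submodule.zero_mem _⟩
    intro σ _
    obtain ⟨k, hσ⟩ := hunion 0 σ
    exact hk k σ (hmono (Nat.le_add_left k m) 0 hσ)
  | succ p =>
    -- A primitive valid on one family is corrected to one valid on the next, without change of its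
    -- values on the first. The primitives therefore stabilize on each simplex. The hypothesis on
    -- `b` is kept inside the existential so that `next` can be chosen for all cochains.
    have step : ∀ (k : ℕ) (b : Cochain L p), ∃ b' : Cochain L p,
        c - coboundary L p b ∈ vanishing L (S (m + k)) (p + 1) →
          b' - b ∈ vanishing L (S (m + k)) p ∧
            c - coboundary L p b' ∈ vanishing L (S (m + (k + 1))) (p + 1) := by
      intro k b
      by_cases hb : c - coboundary L p b ∈ vanishing L (S (m + k)) (p + 1)
      · have h1 := h (m + k) (Nat.le_add_right _ _) (x := c - coboundary L p b)
          ⟨hb, by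
            rw [SetLike.mem_coe, Submodule.mem_comap, map_sub, hδ0, coboundary_coboundary, sub_zero]
            exact Submodule.zero_mem _⟩
        obtain ⟨_, ⟨b', hb', rfl⟩, z, hz, hsum⟩ := Submodule.mem_sup.1 h1
        refine ⟨b + b', fun _ => ⟨by rwa [add_sub_cancel_left], ?_⟩⟩
        rw [map_add, ← sub_sub, ← hsum, add_sub_cancel_left]
        exact hz
      · exact ⟨b, fun h => absurd h hb⟩
    choose next hnext using step
    let b : ℕ → Cochain L p := fun k => Nat.rec 0 next k
    have hb : ∀ k, c - coboundary L p (b k) ∈ vanishing L (S (m + k)) (p + 1) := by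
      intro k
      induction k with
      | zero =>
        change c - coboundary L p 0 ∈ _
        rwa [map_zero, sub_zero]
      | succ k ih => exact (hnext k (b k) ih).2
    have hb2 : ∀ k, b (k + 1) - b k ∈ vanishing L (S (m + k)) p :=
      fun k => (hnext k (b k) (hb k)).1
    have hb3 : ∀ k j, b (k + j) - b k ∈ vanishing L (S (m + k)) p := by
      intro k j
      induction j with
      | zero => rw [add_zero, sub_self]; exact Submodule.zero_mem _
      | succ j ih =>
        have h2 := vanishing_anti L (hmono (show m + k ≤ m + (k + j) by omega)) p (hb2 (k + j))
        have := Submodule.add_mem _ h2 ih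
        rwa [sub_add_sub_cancel] at this
    choose K hK using hunion
    -- The limit of the primitives: on each simplex, the value at a stage whose family contains it.
    let β : Cochain L p := fun σ => b (K p σ) σ
    have hβ : ∀ k, ∀ σ ∈ S (m + k) p, β σ = b k σ := by
      intro k σ hσ
      change b (K p σ) σ = b k σ
      rcases le_total k (K p σ) with hle | hle
      · obtain ⟨j, hj⟩ := Nat.exists_eq_add_of_le hle
        rw [hj]
        exact sub_eq_zero.1 (hb3 k j σ hσ)
      · obtain ⟨j, hj⟩ := Nat.exists_eq_add_of_le hle
        have := hb3 (K p σ) j σ (hmono (Nat.le_add_left _ m) p (hK p σ))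
        rw [← hj] at this
        exact (sub_eq_zero.1 this).symm
    refine Submodule.mem_sup_left ⟨β, fun σ hσ => hβ 0 σ hσ, ?_⟩
    funext σ
    have hσ : σ ∈ S (m + K _ σ) (p + 1) := hmono (Nat.le_add_left _ m) _ (hK _ σ)
    rw [coboundary_congr (hS _) (hβ (K _ σ)) σ hσ]
    exact (sub_eq_zero.1 (hb _ σ hσ)).symm

lemma finiteDimensional_cohomology_of_relRank_lt {p : ℕ}
    (h : relRank L ⊤ ⊥ p < Cardinal.aleph0) : FiniteDimensional ℚ (Cohomology L p) := by
  have hv : ∀ q, vanishing L ⊤ q = ⊥ := fun q =>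
    (Submodule.eq_bot_iff _).2 fun c hc => funext fun σ => hc σ trivial
  have hv' : ∀ q, vanishing L ⊥ q = ⊤ := fun q =>
    (Submodule.eq_top_iff').2 fun c σ hσ => hσ.elim
  have hZ : relCocycles L ⊤ ⊥ p = cocycles L p := by
    rw [relCocycles, hv, hv', top_inf_eq]
    rfl
  have hB : relCoboundaries L ⊤ ⊥ p = coboundaries L p := by
    cases p with
    | zero => exact hv 0
    | succ p =>
      rw [relCoboundaries, hv, hv', sup_bot_eq, Submodule.map_top]
      rfl
  rw [relRank, hZ, hB] at h
  have : Module.Finite ℚ ((cocycles L p).map (coboundaries L p).mkQ) :=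
    Module.rank_lt_aleph0_iff.1 h
  let f : Cohomology L p →ₗ[ℚ] (cocycles L p).map (coboundaries L p).mkQ :=
    ((Submodule.mapQ _ _ (cocycles L p).subtype le_rfl).codRestrict _ (by
      intro x
      obtain ⟨x, rfl⟩ := Submodule.Quotient.mk_surjective _ x
      exact ⟨x, x.2, rfl⟩))
  refine Module.Finite.of_injective f ?_
  rw [← LinearMap.ker_eq_bot, LinearMap.ker_eq_bot']
  intro x hx
  obtain ⟨x, rfl⟩ := Submodule.Quotient.mk_surjective _ x
  have := congrArg Subtype.val hx
  rw [Submodule.Quotient.mk_eq_zero]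
  exact (Submodule.Quotient.mk_eq_zero (coboundaries L p)).1 this

end Relative


/-! ## Homotopies -/

section Prism

/-- The prism over the standard simplex. -/
abbrev prismSet (q : ℕ) : Set ((Fin (q + 1) → ℝ) × ℝ) :=
  stdSimplex ℝ (Fin (q + 1)) ×ˢ Set.Icc 0 1

instance fact_convex_prismSet (q : ℕ) : Fact (Convex ℝ (prismSet q)) :=
  ⟨(convex_stdSimplex ℝ _).prod (convex_Icc 0 1)⟩

/-- The bottom of the prism. -/
def prismBot (q : ℕ) : C(Simplex q, prismSet q) where
  toFun k := ⟨(k.1, 0), k.2, by simp⟩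
  continuous_toFun := by fun_prop

/-- The top of the prism. -/
def prismTop (q : ℕ) : C(Simplex q, prismSet q) where
  toFun k := ⟨(k.1, 1), k.2, by simp⟩
  continuous_toFun := by fun_prop

/-- The projection of the prism. -/
def prismFst (q : ℕ) : C(prismSet q, Simplex q) where
  toFun k := ⟨k.1.1, k.2.1⟩
  continuous_toFun := by fun_prop

/-- The map of prisms induced by a map of simplices. -/
def prismMap {p q : ℕ} (κ : C(Simplex p, Simplex q)) : C(prismSet p, prismSet q) where
  toFun k := ⟨((κ (prismFst p k)).1, k.1.2), (κ (prismFst p k)).2, k.2.2⟩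
  continuous_toFun := by fun_prop

lemma isAffine_prismMap_face (q : ℕ) (i : Fin (q + 2)) : IsAffine (prismMap (face q i)) :=
  isAffine_of_coe_eq _ (LinearMap.prodMap (FunOnFinite.linearMap ℝ ℝ i.succAbove) LinearMap.id)
    fun _ => rfl

lemma affineSimplex_prismBot (q : ℕ) :
    affineSimplex (prismBot q ∘ vertices q) = prismBot q := by
  ext1 t
  apply Subtype.ext
  rw [affineSimplex_coe]
  refine Prod.ext ?_ ?_
  · rw [Prod.fst_sum]
    ext j
    change (∑ i, t.1 i • (Pi.single i 1 : Fin (q + 1) → ℝ)) j = t.1 j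
    simp [Finset.sum_apply, Pi.single_apply]
  · rw [Prod.snd_sum]
    change ∑ i, t.1 i • (0 : ℝ) = 0
    simp

lemma affineSimplex_prismTop (q : ℕ) :
    affineSimplex (prismTop q ∘ vertices q) = prismTop q := by
  ext1 t
  apply Subtype.ext
  rw [affineSimplex_coe]
  refine Prod.ext ?_ ?_
  · rw [Prod.fst_sum]
    ext j
    change (∑ i, t.1 i • (Pi.single i 1 : Fin (q + 1) → ℝ)) j = t.1 j
    simp [Finset.sum_apply, Pi.single_apply]
  · rw [Prod.snd_sum]
    change ∑ i, t.1 i • (1 : ℝ) = 1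
    simpa using t.2.2

lemma face_comp_vertices (q : ℕ) (i : Fin (q + 2)) :
    face q i ∘ vertices q = vertices (q + 1) ∘ i.succAbove := by
  funext j
  exact stdSimplex.map_vertex i.succAbove j

lemma affineSimplex_face (q : ℕ) (i : Fin (q + 2)) :
    affineSimplex (vertices (q + 1) ∘ i.succAbove) = face q i := by
  rw [← affineSimplex_comp_face]
  rw [show affineSimplex (vertices (q + 1)) = _ from affineSimplex_vertices (q + 1)]
  rfl

end Prism

section Homotopy

variable {X : Type u} [TopologicalSpace X] {L : FundamentalGroupoid X ⥤ ModuleCat.{w} ℚ}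

/-- The evaluation of a cochain on the prism of a homotopy of a simplex. -/
def prismValue {q : ℕ} (c : Cochain L (q + 1)) (σ : C(Simplex q, X)) (G : C(prismSet q, X))
    (h : G.comp (prismBot q) = σ) : L.obj (FundamentalGroupoid.mk (σ (vertexZero q))) :=
  (L.map (eqToHom (by rw [← h]; rfl))).hom
    ((Framing.ofBase G (prismBot q (vertexZero q))).eval c
      (prism (prismBot q) (prismTop q) (q + 1) (Finsupp.single (vertices q) 1)))

lemma prismValue_rfl {q : ℕ} (c : Cochain L (q + 1)) (G : C(prismSet q, X)) :
    prismValue c (G.comp (prismBot q)) G rfl =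
      (Framing.ofBase G (prismBot q (vertexZero q))).eval c
        (prism (prismBot q) (prismTop q) (q + 1) (Finsupp.single (vertices q) 1)) := by
  rw [prismValue, eqToHom_refl, L.map_id]
  rfl

/-- Naturality of the prism chain under the affine map of prisms induced by a face, with both sides
transported to the fibre at the initial vertex of the bottom. -/
lemma map_prismValue_face {q : ℕ} (c : Cochain L (q + 1)) (G : C(prismSet (q + 1), X))
    (i : Fin (q + 2)) (G' : C(prismSet q, X)) (hG : G' = G.comp (prismMap (face q i)))
    (h : G'.comp (prismBot q) = (G.comp (prismBot (q + 1))).comp (face q i)) :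
    (L.map ((Framing.ofBase (G.comp (prismBot (q + 1))) (vertexZero (q + 1))).hom
      (face q i (vertexZero q)))).hom (prismValue c _ G' h) =
      (Framing.ofBase G (prismBot (q + 1) (vertexZero (q + 1)))).eval c
        (prism (prismBot (q + 1)) (prismTop (q + 1)) (q + 1)
          (Finsupp.single (vertices (q + 1) ∘ i.succAbove) 1)) := by
  subst hG
  rw [← face_comp_vertices, ← pushTuple_single,
    ← pushTuple_prism (i₀ := prismBot q) (i₁ := prismTop q) (j₀ := prismBot (q + 1))
      (j₁ := prismTop (q + 1)) (κ := face q i) (κ' := prismMap (face q i)) rfl rfl,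
    ← Framing.eval_comp _ _ _ (isAffine_prismMap_face q i)]
  refine (congrArg _ (prismValue_rfl c (G.comp (prismMap (face q i))))).trans ?_
  refine (Framing.eval_postcomp (Framing.ofBase (G.comp (prismMap (face q i)))
    (prismBot q (vertexZero q))) _ c _).symm.trans ?_
  congr 2
  refine Framing.eq_of_convex (prismBot q (vertexZero q)) ?_
  change (Framing.ofBase (G.comp (prismMap (face q i))) (prismBot q (vertexZero q))).hom
    (prismBot q (vertexZero q)) ≫ _ = _
  rw [Framing.ofBase_hom]
  refine (Category.id_comp _).trans ?_
  have hs := (unique_hom_of_convex (prismBot (q + 1) (face q i (vertexZero q)))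
    (prismBot (q + 1) (vertexZero (q + 1)))).2
  have key : ∀ (a b : Simplex (q + 1)) (p : FundamentalGroupoid.mk a ⟶ FundamentalGroupoid.mk b),
      (FundamentalGroupoid.map (G.comp (prismBot (q + 1)))).map p =
        (FundamentalGroupoid.map G).map ((FundamentalGroupoid.map (prismBot (q + 1))).map p) := by
    intro a b p
    induction p using Quotient.inductionOn
    rfl
  refine (key _ _ _).trans ?_
  exact congrArg (FundamentalGroupoid.map G).map (hs.elim _ _)

/-- Homotopy invariance: if the simplices of a family can be deformed, compatibly with faces, within
the family, to a subfamily, and this preserves the subfamily, then the relative cohomology is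
zero. -/
lemma relRank_eq_zero_of_prism {S T : SimplexFamily X}
    (H : ∀ q, C(Simplex q, X) → C(prismSet q, X)) (h0 : ∀ q σ, (H q σ).comp (prismBot q) = σ)
    (hface : ∀ q, ∀ σ ∈ S (q + 1), ∀ i,
      H q (σ.comp (face q i)) = (H (q + 1) σ).comp (prismMap (face q i)))
    (hHS : ∀ q, ∀ σ ∈ S q, ∀ r (κ : C(Simplex r, prismSet q)), (H q σ).comp κ ∈ S r)
    (hHT : ∀ q, ∀ σ ∈ T q, ∀ r (κ : C(Simplex r, prismSet q)), (H q σ).comp κ ∈ T r)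
    (h1 : ∀ q, ∀ σ ∈ S q, (H q σ).comp (prismTop q) ∈ T q) (q : ℕ) :
    relRank L S T q = 0 := by
  rw [relRank_eq_zero_iff]
  rintro c ⟨hc, hδ⟩
  have heval : ∀ {F : SimplexFamily X} {p m : ℕ} {d : Cochain L m}, d ∈ vanishing L F m →
      ∀ σ : C(Simplex p, X), (∀ r (κ : C(Simplex r, prismSet p)), (H p σ).comp κ ∈ F r) →
        ∀ {y : FundamentalGroupoid X} (Γ : Framing (H p σ) y) ξ, Γ.eval d ξ = 0 := by
    intro F p m d hd σ hσ y Γ ξ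
    have : Γ.eval d = 0 := by
      refine tupleChain_hom_ext fun w => ?_
      rw [Framing.eval_single, Framing.value, hd _ (hσ _ _), map_zero, LinearMap.zero_apply]
    rw [this, LinearMap.zero_apply]
  -- The coboundary of `c` vanishes on the prism. Of the resulting boundary terms the top one is
  -- zero because the top lies in `T`, leaving the sides and the bottom.
  have hsum : ∀ σ ∈ S q, (Framing.ofBase (H q σ) (prismBot q (vertexZero q))).eval c
      (prism (prismBot q) (prismTop q) q (tupleBoundary q (Finsupp.single (vertices q) 1))) =
        - (Framing.ofBase (H q σ) (prismBot q (vertexZero q))).eval c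
          (Finsupp.single (prismBot q ∘ vertices q) 1) := by
    intro σ hσ
    have e1 := heval hδ σ (hHS q σ hσ) (Framing.ofBase (H q σ) (prismBot q (vertexZero q)))
      (prism (prismBot q) (prismTop q) (q + 1) (Finsupp.single (vertices q) 1))
    rw [Framing.eval_coboundary, tupleBoundary_prism, map_sub, map_sub, pushTuple_single,
      pushTuple_single, Framing.eval_single _ _ (prismTop q ∘ vertices q), affineSimplex_prismTop,
      Framing.value, hc _ (h1 q σ hσ), map_zero, zero_sub, sub_eq_zero] at e1
    exact e1.symm
  have hbot : ∀ (σ : C(Simplex q, X)) (G : C(prismSet q, X)) (h : G.comp (prismBot q) = σ),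
      (Framing.ofBase G (prismBot q (vertexZero q))).eval c
        (Finsupp.single (prismBot q ∘ vertices q) 1) = 0 → c σ = 0 := by
    rintro _ G rfl h
    rw [Framing.eval_single, affineSimplex_prismBot, Framing.value, Framing.ofBase_hom,
      L.map_id] at h
    exact h
  cases q with
  | zero =>
    intro σ hσ
    refine hbot σ (H 0 σ) (h0 0 σ) ?_
    have := hsum σ hσ
    rw [prism, coneHomotopy, LinearMap.zero_apply, map_zero] at this
    exact neg_eq_zero.1 this.symm
  | succ q =>
    -- Integration of `c` over prisms satisfies `δ b = -c` on `S`, so the primitive is `-b`.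
    let b : Cochain L q := fun τ => prismValue c τ (H q τ) (h0 q τ)
    refine Submodule.mem_sup.2 ⟨coboundary L q (-b), ⟨-b, Submodule.neg_mem _ ?_, rfl⟩,
      c - coboundary L q (-b), ?_, add_sub_cancel _ _⟩
    · intro τ hτ
      change prismValue c τ (H q τ) (h0 q τ) = 0
      rw [prismValue, heval hc τ (hHT q τ hτ), map_zero]
    · intro σ hσ
      rw [map_neg, sub_neg_eq_add, Pi.add_apply, ← eval_vertices (coboundary L q b),
        Framing.eval_coboundary, tupleBoundary_single, map_sum]
      have hface' := hface q σ hσ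
      have hsum' := hsum σ hσ
      have h0' := h0 (q + 1) σ
      generalize H (q + 1) σ = G at hface' hsum' h0'
      subst h0'
      have hterm : ∀ i : Fin (q + 2),
          (Framing.ofBase (G.comp (prismBot (q + 1))) (vertexZero (q + 1))).eval b
            (((-1 : ℚ) ^ (i : ℕ)) • Finsupp.single (vertices (q + 1) ∘ i.succAbove) 1) =
          (Framing.ofBase G (prismBot (q + 1) (vertexZero (q + 1)))).eval c
            (prism (prismBot (q + 1)) (prismTop (q + 1)) (q + 1) (((-1 : ℚ) ^ (i : ℕ)) •
              Finsupp.single (vertices (q + 1) ∘ i.succAbove) 1)) := by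
        intro i
        rw [map_smul, map_smul, map_smul, Framing.eval_single, affineSimplex_face]
        congr 1
        exact map_prismValue_face c G i _ (hface' i) _
      rw [Finset.sum_congr rfl fun i _ => hterm i, ← map_sum, ← map_sum, ← tupleBoundary_single,
        hsum', Framing.eval_single, affineSimplex_prismBot, Framing.value, Framing.ofBase_hom,
        L.map_id]
      exact add_neg_cancel _

/-- Homotopy invariance: a pair of subsets has no relative cohomology if the bigger subset can be
deformed to the smaller one. -/
lemma relRank_eq_zero_of_homotopy {A B : Set X} (h : X → ℝ → X)
    (hcont : ContinuousOn (fun z : X × ℝ => h z.1 z.2) (B ×ˢ Set.Icc 0 1))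
    (h0 : ∀ x ∈ B, h x 0 = x) (hB : ∀ x ∈ B, ∀ t ∈ Set.Icc (0 : ℝ) 1, h x t ∈ B) (hAB : A ⊆ B)
    (hA : ∀ x ∈ A, ∀ t ∈ Set.Icc (0 : ℝ) 1, h x t ∈ A) (h1 : ∀ x ∈ B, h x 1 ∈ A) (q : ℕ) :
    relRank L (simplicesIn B) (simplicesIn A) q = 0 := by
  classical
  let G : ∀ q (σ : C(Simplex q, X)), σ ∈ simplicesIn B q → C(prismSet q, X) := fun q σ hσ =>
    { toFun := fun k => h (σ (prismFst q k)) k.1.2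
      continuous_toFun := by
        refine hcont.comp_continuous
          (f := fun k : prismSet q => (σ (prismFst q k), k.1.2)) (by fun_prop) ?_
        exact fun k => ⟨hσ _, k.2.2⟩ }
  refine relRank_eq_zero_of_prism
    -- Outside `B` the constant homotopy is a harmless default.
    (fun q σ => if hσ : σ ∈ simplicesIn B q then G q σ hσ else σ.comp (prismFst q))
    ?_ ?_ ?_ ?_ ?_ q
  · intro q σ
    by_cases hσ : σ ∈ simplicesIn B q
    · simp only [dif_pos hσ]
      ext1 t
      exact h0 _ (hσ t)
    · simp only [dif_neg hσ]
      rfl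
  · intro q σ hσ i
    simp only [dif_pos hσ, dif_pos (isSieve_simplicesIn B (face q i) σ hσ)]
    rfl
  · intro q σ hσ r κ
    simp only [dif_pos hσ]
    exact fun t => hB _ (hσ _) _ (κ t).2.2
  · intro q σ hσ r κ
    simp only [dif_pos (simplicesIn_mono hAB q hσ)]
    exact fun t => hA _ (hσ _) _ (κ t).2.2
  · intro q σ hσ
    simp only [dif_pos hσ]
    exact fun t => h1 _ (hσ _)

/-! ## A point -/

lemma ofBase_const_hom {q : ℕ} (z : X) (b k : Simplex q) :
    (Framing.ofBase (ContinuousMap.const (Simplex q) z) b).hom k = 𝟙 _ := by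
  change (FundamentalGroupoid.map (ContinuousMap.const (Simplex q) z)).map _ = _
  generalize (unique_hom_of_convex k b).1.some = p
  induction p using Quotient.inductionOn
  rfl

lemma value_const {q p : ℕ} (z : X) (c : Cochain L q) (b : Simplex p)
    (a : C(Simplex q, Simplex p)) :
    (Framing.ofBase (ContinuousMap.const (Simplex p) z) b).value c a =
      c (ContinuousMap.const _ z) := by
  have h : ∀ f : FundamentalGroupoid.mk z ⟶ FundamentalGroupoid.mk z, f = 𝟙 _ →
      (L.map f).hom (c (ContinuousMap.const (Simplex q) z)) = c (ContinuousMap.const _ z) := by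
    rintro _ rfl
    rw [L.map_id]
    rfl
  exact h _ (ofBase_const_hom z b (a (vertexZero q)))

/-- All faces of a constant simplex are constant and its edges act trivially, so only the signs are
left. -/
lemma coboundary_const {q : ℕ} (z : X) (c : Cochain L q) :
    coboundary L q c (ContinuousMap.const _ z) =
      (∑ i : Fin (q + 2), (-1 : ℚ) ^ (i : ℕ)) • c (ContinuousMap.const _ z) := by
  rw [← eval_vertices (coboundary L q c), Framing.eval_coboundary, tupleBoundary_single, map_sum,
    Finset.sum_smul]
  refine Finset.sum_congr rfl fun i _ => ?_
  rw [map_smul, Framing.eval_single, value_const]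
  rfl

lemma simplicesIn_singleton_iff {z : X} {q : ℕ} {σ : C(Simplex q, X)} :
    σ ∈ simplicesIn {z} q ↔ σ = ContinuousMap.const _ z :=
  ⟨fun h => ContinuousMap.ext h, fun h => h ▸ fun _ => rfl⟩

/-- The cohomology of a point. -/
lemma relRank_point (z : X) {r : ℕ} (hr : Module.rank ℚ (L.obj (FundamentalGroupoid.mk z)) ≤ r)
    (q : ℕ) : relRank L (simplicesIn {z}) ⊥ q ≤ ((if q = 0 then r else 0 : ℕ) : Cardinal) := by
  cases q with
  | zero =>
    rw [if_pos rfl]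
    let e : Cochain L 0 →ₗ[ℚ] L.obj (FundamentalGroupoid.mk z) :=
      LinearMap.proj (ContinuousMap.const (Simplex 0) z)
    have hker : LinearMap.ker e = relCoboundaries L (simplicesIn {z}) ⊥ 0 := by
      ext c
      rw [LinearMap.mem_ker]
      constructor
      · intro h σ hσ
        rw [simplicesIn_singleton_iff] at hσ
        rw [hσ]
        exact h
      · exact fun h => h _ (simplicesIn_singleton_iff.2 rfl)
    refine (Submodule.rank_le _).trans ?_
    rw [← hker]
    have h2 := LinearMap.lift_rank_le_of_injective _ (LinearMap.ker_eq_bot.1 (Submodule.ker_liftQ_eq_bot' _ e rfl))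
    have h3 := h2.trans (Cardinal.lift_le.2 hr)
    rwa [Cardinal.lift_natCast, Cardinal.lift_le_nat_iff] at h3
  | succ q =>
    rw [if_neg (Nat.succ_ne_zero q), Nat.cast_zero, nonpos_iff_eq_zero, relRank_eq_zero_iff]
    rintro c ⟨-, hδ⟩
    have h1 := hδ _ (simplicesIn_singleton_iff.2 rfl)
    rw [coboundary_const, Fin.sum_neg_one_pow] at h1
    -- The alternating sum over the `q + 3` faces is `1` for even `q`, so the cocycle vanishes on
    -- the constant simplex. For odd `q` the sum over `q + 2` faces, one degree lower, is `1`, so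
    -- the cocycle is a coboundary.
    rcases Nat.even_or_odd q with hq | hq
    · rw [if_neg (by simpa [parity_simps] using hq), one_smul] at h1
      refine Submodule.mem_sup_right fun σ hσ => ?_
      rw [simplicesIn_singleton_iff] at hσ
      rw [hσ]
      exact h1
    -- The chain operator of a degenerate simplex takes values in the fibres required of a cochain
    -- of degree `q`; on the constant simplex it returns the value of `c`.
    · let b : Cochain L q :=
        chainOperator (Finsupp.single (fun _ => vertexZero q : Fin (q + 2) → Simplex q) 1) c
      refine Submodule.mem_sup.2 ⟨coboundary L q b, ⟨b, fun σ hσ => hσ.elim, rfl⟩,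
        c - coboundary L q b, fun σ hσ => ?_, add_sub_cancel _ _⟩
      rw [simplicesIn_singleton_iff] at hσ
      subst hσ
      rw [Pi.sub_apply, coboundary_const, Fin.sum_neg_one_pow,
        if_neg (by simpa [parity_simps] using hq), one_smul]
      refine sub_eq_zero.2 (Eq.symm ?_)
      exact (Framing.eval_single _ c _).trans (value_const z c _ _)

end Homotopy


/-! ## The mesh of a subdivision -/

section Mesh

variable {E : Type*} [NormedAddCommGroup E] [NormedSpace ℝ E] {s : Set E} [Fact (Convex ℝ s)]

/-- The points of the tuple are at most `d` apart. -/
def IsSmall {K : Type*} [PseudoMetricSpace K] (d : ℝ) {q : ℕ} (u : Fin q → K) : Prop :=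
  ∀ i j, dist (u i) (u j) ≤ d

/-- Every closed ball that contains the points of `w` contains the points of `u`. -/
def IsWithin {K : Type*} [PseudoMetricSpace K] {q r : ℕ} (w : Fin q → K) (u : Fin r → K) : Prop :=
  ∀ (x : K) (ρ : ℝ), (∀ j, dist (w j) x ≤ ρ) → ∀ i, dist (u i) x ≤ ρ

lemma map_mem_of_mem_supported {K M : Type*} [AddCommGroup M] [Module ℚ M] {q : ℕ}
    {A : Set (Fin q → K)} {N : Submodule ℚ M} (f : TupleChain q K →ₗ[ℚ] M)
    (h : ∀ u ∈ A, f (Finsupp.single u 1) ∈ N) {ξ : TupleChain q K}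
    (hξ : ξ ∈ Finsupp.supported ℚ ℚ A) : f ξ ∈ N := by
  rw [Finsupp.supported_eq_span_single] at hξ
  refine (Submodule.span_le (p := N.comap f)).2 ?_ hξ
  rintro _ ⟨u, hu, rfl⟩
  exact h u hu

lemma dist_affineSimplex_le {q : ℕ} (w : Fin (q + 1) → s) (t : Simplex q) (x : s) {ρ : ℝ}
    (h : ∀ j, dist (w j) x ≤ ρ) : dist (affineSimplex w t) x ≤ ρ :=
  (convex_closedBall (x : E) ρ).sum_mem (fun i _ => t.2.1 i) t.2.2
    (fun i _ => Metric.mem_closedBall.2 (h i))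

/-- The difference is the average of `q + 1` differences of points, one of which is zero. -/
lemma dist_tupleBarycenter_le {q : ℕ} (w : Fin (q + 1) → s) {d : ℝ} (h : IsSmall d w)
    (j : Fin (q + 1)) : dist (w j) (tupleBarycenter w) ≤ (q / (q + 1) : ℝ) * d := by
  have hq : (0 : ℝ) < q + 1 := by positivity
  have e : (w j : E) - (tupleBarycenter w : E) =
      ∑ i, ((q + 1 : ℝ)⁻¹) • ((w j : E) - w i) := by
    rw [← Finset.smul_sum, Finset.sum_sub_distrib, smul_sub, Finset.sum_const, Finset.card_univ,
      Fintype.card_fin, tupleBarycenter, affineSimplex_coe]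
    congr 1
    · rw [← Nat.cast_smul_eq_nsmul ℝ, smul_smul, Nat.cast_succ, inv_mul_cancel₀ hq.ne', one_smul]
    · rw [Finset.smul_sum]
      refine Finset.sum_congr rfl fun i _ => ?_
      rw [stdSimplex.barycenter_apply, Fintype.card_fin, Nat.cast_succ]
  rw [Subtype.dist_eq, dist_eq_norm, e]
  refine (norm_sum_le _ _).trans ?_
  rw [← Finset.add_sum_erase _ _ (Finset.mem_univ j), sub_self, smul_zero, norm_zero, zero_add]
  refine (Finset.sum_le_card_nsmul _ _ ((q + 1 : ℝ)⁻¹ * d) fun i _ => ?_).trans ?_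
  · rw [norm_smul, Real.norm_of_nonneg (by positivity), ← dist_eq_norm]
    exact mul_le_mul_of_nonneg_left (h j i) (by positivity)
  · rw [Finset.card_erase_of_mem (Finset.mem_univ j), Finset.card_univ, Fintype.card_fin,
      Nat.add_sub_cancel, nsmul_eq_mul, ← mul_assoc, div_eq_mul_inv]

/-- With `q` points the dimension is `q - 1`, so `1 - 1/q` is the usual contraction factor. The
condition `IsWithin` is carried through the induction to bound the distances from the subdivided
boundary to the new apex. -/
lemma subdivision_single_mem_supported (q : ℕ) {d : ℝ} (w : Fin q → s) (hw : IsSmall d w) :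
    subdivision q (Finsupp.single w 1) ∈
      Finsupp.supported ℚ ℚ {u | IsSmall ((1 - (q : ℝ)⁻¹) * d) u ∧ IsWithin w u} := by
  induction q with
  | zero =>
    exact Finsupp.single_mem_supported ℚ _ ⟨fun i => i.elim0, fun _ _ _ i => i.elim0⟩
  | succ q ih =>
    have hd : 0 ≤ d := dist_nonneg.trans (hw 0 0)
    have hq1 : (1 - ((q + 1 : ℕ) : ℝ)⁻¹) = (q / (q + 1) : ℝ) := by
      rw [Nat.cast_succ]
      field_simp
      ring
    have h1 : subdivision q (tupleBoundary q (Finsupp.single w 1)) ∈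
        Finsupp.supported ℚ ℚ {u | IsSmall ((1 - (q : ℝ)⁻¹) * d) u ∧ IsWithin w u} := by
      rw [tupleBoundary_single, map_sum]
      refine Submodule.sum_mem _ fun i _ => ?_
      rw [map_smul]
      refine Submodule.smul_mem _ _ ?_
      refine Finsupp.supported_mono ?_ (ih (w ∘ i.succAbove) fun _ _ => hw _ _)
      rintro u ⟨hu, hu'⟩
      exact ⟨hu, fun x ρ hx => hu' x ρ fun j => hx _⟩
    rw [subdivision_single]
    refine map_mem_of_mem_supported _ (fun u hu => ?_) h1
    rw [cone_single]
    refine Finsupp.single_mem_supported ℚ _ ?_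
    have hb : ∀ i, dist (u i) (tupleBarycenter w) ≤ (q / (q + 1) : ℝ) * d :=
      hu.2 _ _ fun j => dist_tupleBarycenter_le w hw j
    constructor
    · rw [hq1]
      intro i j
      refine Fin.cases (Fin.cases ?_ (fun j => ?_) j) (fun i => Fin.cases ?_ (fun j => ?_) j) i
      · rw [dist_self]
        positivity
      · rw [Fin.cons_zero, Fin.cons_succ, dist_comm]
        exact hb j
      · rw [Fin.cons_zero, Fin.cons_succ]
        exact hb i
      · rw [Fin.cons_succ, Fin.cons_succ, ← hq1]
        refine (hu.1 i j).trans (mul_le_mul_of_nonneg_right ?_ hd)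
        have : (0 : ℝ) < q := by exact_mod_cast i.pos
        refine sub_le_sub_left (inv_anti₀ this ?_) 1
        exact_mod_cast q.le_succ
    · intro x ρ hx i
      refine Fin.cases ?_ (fun i => ?_) i
      · exact dist_affineSimplex_le w _ x hx
      · exact hu.2 x ρ hx i

lemma iterate_subdivision_mem_supported (q : ℕ) {d : ℝ} {ξ : TupleChain q s}
    (hξ : ξ ∈ Finsupp.supported ℚ ℚ {u | IsSmall d u}) (n : ℕ) :
    (subdivision q)^[n] ξ ∈
      Finsupp.supported ℚ ℚ {u | IsSmall ((1 - (q : ℝ)⁻¹) ^ n * d) u} := by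
  induction n with
  | zero => simpa using hξ
  | succ n ih =>
    rw [Function.iterate_succ_apply', pow_succ', mul_assoc]
    refine map_mem_of_mem_supported _ (fun u hu => ?_) ih
    exact Finsupp.supported_mono (fun v hv => hv.1) (subdivision_single_mem_supported q u hu)

end Mesh

/-! ## Small simplices -/

section SmallSimplices

instance compactSpace_simplex (q : ℕ) : CompactSpace (Simplex q) :=
  isCompact_iff_compactSpace.1 (isCompact_stdSimplex ℝ _)

/-- Iterated subdivisions of a chain are eventually supported on small tuples. -/
lemma exists_iterate_subdivision_mem_supported {p q : ℕ} (ξ : TupleChain (q + 1) (Simplex p))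
    {ε : ℝ} (hε : 0 < ε) : ∃ N, ∀ n, N ≤ n →
      (subdivision (q + 1))^[n] ξ ∈ Finsupp.supported ℚ ℚ {u | IsSmall ε u} := by
  obtain ⟨D, hD⟩ := Metric.isBounded_iff.1 (isCompact_univ (X := Simplex p)).isBounded
  have hξ : ξ ∈ Finsupp.supported ℚ ℚ {u | IsSmall D u} :=
    fun u _ i j => hD (Set.mem_univ _) (Set.mem_univ _)
  have hr0 : (0 : ℝ) ≤ 1 - ((q + 1 : ℕ) : ℝ)⁻¹ := by
    rw [sub_nonneg]
    exact inv_le_one_of_one_le₀ (by exact_mod_cast Nat.succ_le_succ q.zero_le)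
  have hr1 : 1 - ((q + 1 : ℕ) : ℝ)⁻¹ < 1 := sub_lt_self _ (by positivity)
  have hlim : Filter.Tendsto (fun n : ℕ => (1 - ((q + 1 : ℕ) : ℝ)⁻¹) ^ n * D) Filter.atTop
      (nhds (0 * D)) := (tendsto_pow_atTop_nhds_zero_of_lt_one hr0 hr1).mul_const D
  rw [zero_mul] at hlim
  obtain ⟨N, hN⟩ := Filter.eventually_atTop.1 (hlim.eventually (gt_mem_nhds hε))
  refine ⟨N, fun n hn => ?_⟩
  exact Finsupp.supported_mono (fun u hu i j => (hu i j).trans (hN n hn).le)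
    (iterate_subdivision_mem_supported _ hξ n)

variable {X : Type u} [TopologicalSpace X] {L : FundamentalGroupoid X ⥤ ModuleCat.{w} ℚ}

lemma eval_eq_zero_of_mem_supported {p q : ℕ} {T : SimplexFamily X} {c : Cochain L q}
    (hc : c ∈ vanishing L T q) {σ : C(Simplex p, X)} {y : FundamentalGroupoid X} (Γ : Framing σ y)
    {A : Set (Fin (q + 1) → Simplex p)} (hA : ∀ u ∈ A, σ.comp (affineSimplex u) ∈ T q)
    {ξ : TupleChain (q + 1) (Simplex p)} (hξ : ξ ∈ Finsupp.supported ℚ ℚ A) :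
    Γ.eval c ξ = 0 := by
  refine (Submodule.mem_bot ℚ).1 (map_mem_of_mem_supported (Γ.eval c) (fun u hu => ?_) hξ)
  rw [Framing.eval_single, Framing.value, hc _ (hA u hu), map_zero]
  exact Submodule.zero_mem _

variable {A B : Set X}

/-- Cochains that vanish on small simplices vanish on sufficiently fine subdivisions. -/
lemma exists_eval_iterate_subdivision_eq_zero {U V : Set X} (hU : IsOpen U) (hV : IsOpen V)
    (hUA : U ∩ (A ∪ B) ⊆ A) (hVB : V ∩ (A ∪ B) ⊆ B) (hUV : A ∪ B ⊆ U ∪ V) {p q : ℕ}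
    {c : Cochain L q} (hc : c ∈ vanishing L (simplicesIn A ⊔ simplicesIn B) q)
    {σ : C(Simplex p, X)} (hσ : σ ∈ simplicesIn (A ∪ B) p) {y : FundamentalGroupoid X}
    (Γ : Framing σ y) (ξ : TupleChain (q + 1) (Simplex p)) :
    ∃ N, ∀ n, N ≤ n → Γ.eval c ((subdivision (q + 1))^[n] ξ) = 0 := by
  -- Tuples of diameter at most half a Lebesgue number span simplices inside a ball of radius `δ`,
  -- hence inside one of the two sets.
  obtain ⟨δ, hδ, hball⟩ := lebesgue_number_lemma_of_metric (isCompact_univ (X := Simplex p))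
    (c := fun b : Bool => σ ⁻¹' (if b then U else V))
    (fun b => IsOpen.preimage σ.continuous (by cases b <;> simpa)) (by
      intro t _
      rw [Set.mem_iUnion]
      rcases hUV (hσ t) with h | h
      · exact ⟨true, by simpa using h⟩
      · exact ⟨false, by simpa using h⟩)
  obtain ⟨N, hN⟩ := exists_iterate_subdivision_mem_supported ξ (half_pos hδ)
  refine ⟨N, fun n hn => eval_eq_zero_of_mem_supported hc Γ (fun u hu => ?_) (hN n hn)⟩
  have hsub : ∀ t, affineSimplex u t ∈ Metric.ball (u 0) δ := fun t =>
    lt_of_le_of_lt (dist_affineSimplex_le u t (u 0) fun j => hu j 0) (half_lt_self hδ)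
  obtain ⟨b, hb⟩ := hball (u 0) (Set.mem_univ _)
  cases b with
  | true => exact Or.inl fun t => hUA ⟨by simpa using hb (hsub t), hσ _⟩
  | false => exact Or.inr fun t => hVB ⟨by simpa using hb (hsub t), hσ _⟩

lemma affineSimplex_comp_vertices {E : Type*} [NormedAddCommGroup E] [NormedSpace ℝ E] {s : Set E}
    [Fact (Convex ℝ s)] {q : ℕ} (w : Fin (q + 1) → s) : affineSimplex w ∘ vertices q = w :=
  funext fun i => affineSimplex_vertex w i

/-- The partial sums of the cochain homotopy between the identity and fine subdivisions. -/
def subdivisionSum (q N : ℕ) (c : Cochain L (q + 1)) : Cochain L q :=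
  ∑ n ∈ Finset.range N, chainOperator ((subdivision (q + 2))^[n]
    (subdivisionHomotopy (q + 1) (Finsupp.single (vertices q) 1))) c

lemma IsAffine.pushTuple_iterate_subdivision {E E' : Type*} [NormedAddCommGroup E]
    [NormedSpace ℝ E] [NormedAddCommGroup E'] [NormedSpace ℝ E'] {s : Set E} {s' : Set E'}
    [Fact (Convex ℝ s)] [Fact (Convex ℝ s')] {κ : s → s'} (hκ : IsAffine κ) (q n : ℕ)
    (ξ : TupleChain q s) :
    pushTuple κ ((subdivision q)^[n] ξ) = (subdivision q)^[n] (pushTuple κ ξ) :=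
  (Function.Semiconj.iterate_right (fun ξ => hκ.pushTuple_subdivision q ξ) n) ξ

lemma iterate_subdivision_eq_pow {E : Type*} [NormedAddCommGroup E] [NormedSpace ℝ E] {s : Set E}
    [Fact (Convex ℝ s)] (q n : ℕ) (ξ : TupleChain q s) :
    (subdivision q)^[n] ξ = ((subdivision q : Module.End ℚ (TupleChain q s)) ^ n) ξ :=
  (Module.End.pow_apply _ n ξ).symm

lemma eval_subdivisionSum {p q : ℕ} (N : ℕ) (c : Cochain L (q + 1)) {σ : C(Simplex p, X)}
    {y : FundamentalGroupoid X} (Γ : Framing σ y) (ξ : TupleChain (q + 1) (Simplex p)) :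
    Γ.eval (subdivisionSum q N c) ξ = ∑ n ∈ Finset.range N,
      Γ.eval c ((subdivision (q + 2))^[n] (subdivisionHomotopy (q + 1) ξ)) := by
  have hadd : Γ.eval (subdivisionSum q N c) = ∑ n ∈ Finset.range N,
      Γ.eval (chainOperator ((subdivision (q + 2))^[n]
        (subdivisionHomotopy (q + 1) (Finsupp.single (vertices q) 1))) c) :=
    map_sum (⟨⟨fun c => Γ.eval c, LinearMap.ext fun ξ => by
        have := Framing.eval_smul Γ 0 (0 : Cochain L q) ξ
        rwa [zero_smul, zero_smul] at this⟩,
      fun c d => LinearMap.ext fun ξ => Framing.eval_add Γ c d ξ⟩ :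
        Cochain L q →+ (TupleChain (q + 1) (Simplex p) →ₗ[ℚ] L.obj y)) _ _
  rw [hadd, LinearMap.sum_apply]
  refine Finset.sum_congr rfl fun n _ => ?_
  have h : Γ.eval (chainOperator ((subdivision (q + 2))^[n]
      (subdivisionHomotopy (q + 1) (Finsupp.single (vertices q) 1))) c) =
      Γ.eval c ∘ₗ ((subdivision (q + 2) : Module.End ℚ _) ^ n) ∘ₗ subdivisionHomotopy (q + 1) := by
    refine tupleChain_hom_ext fun w => ?_
    rw [eval_chainOperator, (isAffine_affineSimplex w).pushTuple_iterate_subdivision,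
      (isAffine_affineSimplex w).pushTuple_subdivisionHomotopy, pushTuple_single,
      affineSimplex_comp_vertices, LinearMap.comp_apply, LinearMap.comp_apply,
      iterate_subdivision_eq_pow]
  rw [h, LinearMap.comp_apply, LinearMap.comp_apply, iterate_subdivision_eq_pow]

/-- For `D` the homotopy from the identity to subdivision, the contributions of `D ∂` in successive
subdivisions telescope. Terms that evaluate `c` on a boundary vanish because `c` is a cocycle on
`S`. -/
lemma coboundary_subdivisionSum {q : ℕ} (N : ℕ) {S : SimplexFamily X} (hS : IsSieve S)
    {c : Cochain L (q + 1)} (hc : coboundary L (q + 1) c ∈ vanishing L S (q + 2))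
    {σ : C(Simplex (q + 1), X)} (hσ : σ ∈ S (q + 1)) :
    coboundary L q (subdivisionSum q N c) σ =
      c σ - (Framing.ofBase σ (vertexZero (q + 1))).eval c
        ((subdivision (q + 2))^[N] (Finsupp.single (vertices (q + 1)) 1)) := by
  rw [← eval_vertices (coboundary L q (subdivisionSum q N c)), ← eval_vertices c,
    Framing.eval_coboundary, eval_subdivisionSum]
  set Γ := Framing.ofBase σ (vertexZero (q + 1))
  set ι : TupleChain (q + 2) (Simplex (q + 1)) := Finsupp.single (vertices (q + 1)) 1
  have hbd : ∀ (n : ℕ) (ξ : TupleChain (q + 3) (Simplex (q + 1))),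
      Γ.eval c ((subdivision (q + 2))^[n] (tupleBoundary (q + 2) ξ)) = 0 := by
    intro n ξ
    have := (Function.Semiconj.iterate_right (f := tupleBoundary (q + 2))
      (fun ξ => tupleBoundary_subdivision (s := stdSimplex ℝ (Fin (q + 2))) (q + 2) ξ) n) ξ
    rw [← this, ← Framing.eval_coboundary]
    refine eval_eq_zero_of_mem_supported hc Γ (A := Set.univ) (fun u _ => hS _ _ hσ) ?_
    rw [Finsupp.supported_univ]
    exact Submodule.mem_top
  have hterm : ∀ n : ℕ, Γ.eval c ((subdivision (q + 2))^[n]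
      (subdivisionHomotopy (q + 1) (tupleBoundary (q + 1) ι))) =
        Γ.eval c ((subdivision (q + 2))^[n] ι) - Γ.eval c ((subdivision (q + 2))^[n + 1] ι) := by
    intro n
    have h1 : subdivisionHomotopy (q + 1) (tupleBoundary (q + 1) ι) =
        ι - subdivision (q + 2) ι - tupleBoundary (q + 2) (subdivisionHomotopy (q + 2) ι) := by
      rw [tupleBoundary_subdivisionHomotopy, sub_sub_cancel]
    have h2 := hbd n (subdivisionHomotopy (q + 2) ι)
    rw [h1, Function.iterate_succ_apply]
    rw [iterate_subdivision_eq_pow] at h2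
    simp only [iterate_subdivision_eq_pow, map_sub]
    rw [h2, sub_zero]
  rw [Finset.sum_congr rfl fun n _ => hterm n, Finset.sum_range_sub']
  rfl

/-- The theorem of small simplices: for subsets that are relatively open in their union, the
simplices of the union have no cohomology relative to the simplices of the two subsets. -/
lemma relRank_union_eq_zero {U V : Set X} (hU : IsOpen U) (hV : IsOpen V)
    (hUA : U ∩ (A ∪ B) ⊆ A) (hVB : V ∩ (A ∪ B) ⊆ B) (hUV : A ∪ B ⊆ U ∪ V) (q : ℕ) :
    relRank L (simplicesIn (A ∪ B)) (simplicesIn A ⊔ simplicesIn B) q = 0 := by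
  classical
  rw [relRank_eq_zero_iff]
  rintro c ⟨hc, hδ⟩
  cases q with
  | zero =>
    have hsub : Subsingleton (Simplex 0) := ⟨fun a b => Subtype.ext (funext fun i => by
      have ha := a.2.2
      have hb := b.2.2
      rw [Fin.sum_univ_one] at ha hb
      rw [Fin.fin_one_eq_zero i, ha, hb])⟩
    intro σ hσ
    refine hc σ ((hσ (vertexZero 0)).imp (fun h t => ?_) (fun h t => ?_)) <;>
    · rw [Subsingleton.elim t (vertexZero 0)]
      exact h
  | succ q =>
    have hS := isSieve_simplicesIn (A ∪ B)
    -- The number of subdivisions needed depends on the simplex, so the cochain `b` below uses as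
    -- many terms as its argument requires; by `hb`, further terms are zero.
    have hex : ∀ (p : ℕ) (σ : C(Simplex p, X)) (ξ : TupleChain (q + 2) (Simplex p)), ∃ N : ℕ,
        σ ∈ simplicesIn (A ∪ B) p → ∀ n, N ≤ n →
          (Framing.ofBase σ (vertexZero p)).eval c ((subdivision (q + 2))^[n] ξ) = 0 := by
      intro p σ ξ
      by_cases hσ : σ ∈ simplicesIn (A ∪ B) p
      · obtain ⟨N, hN⟩ := exists_eval_iterate_subdivision_eq_zero hU hV hUA hVB hUV hc hσ
          (Framing.ofBase σ (vertexZero p)) ξ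
        exact ⟨N, fun _ => hN⟩
      · exact ⟨0, fun h => absurd h hσ⟩
    choose N hN using hex
    let M : C(Simplex q, X) → ℕ := fun τ =>
      N q τ (subdivisionHomotopy (q + 1) (Finsupp.single (vertices q) 1))
    let b : Cochain L q := fun τ => subdivisionSum q (M τ) c τ
    have hval : ∀ (n : ℕ) (τ : C(Simplex q, X)), subdivisionSum q n c τ =
        ∑ k ∈ Finset.range n, (Framing.ofBase τ (vertexZero q)).eval c ((subdivision (q + 2))^[k]
          (subdivisionHomotopy (q + 1) (Finsupp.single (vertices q) 1))) := by
      intro n τ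
      rw [← eval_vertices (subdivisionSum q n c), eval_subdivisionSum]
    have hb : ∀ τ ∈ simplicesIn (A ∪ B) q, ∀ n, M τ ≤ n → subdivisionSum q n c τ = b τ := by
      intro τ hτ n hn
      change _ = subdivisionSum q (M τ) c τ
      rw [hval, hval]
      refine (Finset.sum_subset (Finset.range_mono hn) fun k _ hk => ?_).symm
      exact hN q τ _ hτ k (not_lt.1 fun h => hk (Finset.mem_range.2 h))
    refine Submodule.mem_sup.2 ⟨coboundary L q b, ⟨b, fun τ hτ => ?_, rfl⟩,
      c - coboundary L q b, fun σ hσ => ?_, add_sub_cancel _ _⟩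
    · change subdivisionSum q (M τ) c τ = 0
      rw [hval]
      refine Finset.sum_eq_zero fun k _ => ?_
      refine eval_eq_zero_of_mem_supported hc _ (A := Set.univ) (fun u _ => ?_) ?_
      · exact ((isSieve_simplicesIn A).sup (isSieve_simplicesIn B)) _ _ hτ
      · rw [Finsupp.supported_univ]
        exact Submodule.mem_top
    -- A single number large enough for `σ` and for all its faces.
    · let n := N (q + 1) σ (Finsupp.single (vertices (q + 1)) 1) +
        ∑ i : Fin (q + 2), M (σ.comp (face q i))
      have h1 : coboundary L q b σ = coboundary L q (subdivisionSum q n c) σ := by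
        simp only [coboundary, LinearMap.pi_apply, LinearMap.sum_apply, LinearMap.smul_apply,
          LinearMap.comp_apply, LinearMap.proj_apply]
        refine Finset.sum_congr rfl fun i _ => ?_
        rw [hb _ (hS (face q i) σ hσ) n]
        exact (Finset.single_le_sum (f := fun i => M (σ.comp (face q i)))
          (fun _ _ => Nat.zero_le _) (Finset.mem_univ i)).trans (Nat.le_add_left _ _)
      rw [Pi.sub_apply, h1, coboundary_subdivisionSum n hS hδ hσ, sub_sub_cancel]
      exact hN _ σ _ hσ n (Nat.le_add_right _ _)

/-- Excision. -/
lemma relRank_union_le {U V : Set X} (hU : IsOpen U) (hV : IsOpen V) (hUA : U ∩ (A ∪ B) ⊆ A)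
    (hVB : V ∩ (A ∪ B) ⊆ B) (hUV : A ∪ B ⊆ U ∪ V) (q : ℕ) :
    relRank L (simplicesIn (A ∪ B)) (simplicesIn A) q ≤
      relRank L (simplicesIn B) (simplicesIn (A ∩ B)) q := by
  refine (relRank_le_add_of_triple L (T := simplicesIn A ⊔ simplicesIn B) le_sup_left
    (sup_le (simplicesIn_mono Set.subset_union_left) (simplicesIn_mono Set.subset_union_right))
    q).trans ?_
  rw [relRank_union_eq_zero hU hV hUA hVB hUV, zero_add, sup_comm, simplicesIn_inter, inf_comm]
  exact relRank_sup_le L (isSieve_simplicesIn B) (isSieve_simplicesIn A) q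

end SmallSimplices


/-! ## Cohomology of pairs of subsets of a cell -/

section Cell

variable {X : Type u} [TopologicalSpace X] {L : FundamentalGroupoid X ⥤ ModuleCat.{w} ℚ}

lemma simplicesIn_empty : simplicesIn (∅ : Set X) = ⊥ :=
  funext fun q => Set.eq_empty_iff_forall_notMem.2 fun _ hσ => hσ (vertexZero q)

lemma relRank_self (S : SimplexFamily X) (q : ℕ) : relRank L S S q = 0 := by
  rw [relRank_eq_zero_iff]
  exact fun c hc => vanishing_le_relCoboundaries L S S q hc.1

variable {m : ℕ} {f : (Fin m → ℝ) → X} {g : X → Fin m → ℝ} {D : Set (Fin m → ℝ)}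

lemma continuousOn_lineMap_comp (hf : ContinuousOn f D) (hg : ContinuousOn g (f '' D))
    (hgf : Set.LeftInvOn g f D) {P : Set (Fin m → ℝ)} (hPD : P ⊆ D) {z : Fin m → ℝ}
    (hP : StarConvex ℝ z P) :
    ContinuousOn (fun y : X × ℝ => f ((1 - y.2) • g y.1 + y.2 • z)) ((f '' P) ×ˢ Set.Icc 0 1) := by
  refine hf.comp (((continuousOn_const.sub continuousOn_snd).smul
    ((hg.mono (Set.image_mono hPD)).comp continuousOn_fst fun y hy => hy.1)).add
      (continuousOn_snd.smul continuousOn_const)) ?_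
  rintro ⟨_, t⟩ ⟨⟨x, hx, rfl⟩, ht⟩
  refine hPD ?_
  simp only [hgf (hPD hx)]
  rw [add_comm]
  exact hP hx ht.1 (sub_nonneg.2 ht.2) (add_sub_cancel _ _)

/-- In the chart given by `g`, straight-line contraction to the common centre `z` preserves both
sets and ends in the smaller one. -/
lemma relRank_image_eq_zero_of_starConvex (hf : ContinuousOn f D) (hg : ContinuousOn g (f '' D))
    (hgf : Set.LeftInvOn g f D) {P Q : Set (Fin m → ℝ)} (hQP : Q ⊆ P) (hPD : P ⊆ D)
    {z : Fin m → ℝ} (hz : z ∈ Q) (hP : StarConvex ℝ z P) (hQ : StarConvex ℝ z Q) (q : ℕ) :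
    relRank L (simplicesIn (f '' P)) (simplicesIn (f '' Q)) q = 0 := by
  refine relRank_eq_zero_of_homotopy (fun x t => f ((1 - t) • g x + t • z))
    (continuousOn_lineMap_comp hf hg hgf hPD hP) ?_ ?_ (Set.image_mono hQP) ?_ ?_ q
  · rintro _ ⟨x, hx, rfl⟩
    simp only [hgf (hPD hx), sub_zero, one_smul, zero_smul, add_zero]
  · rintro _ ⟨x, hx, rfl⟩ t ht
    simp only [hgf (hPD hx)]
    rw [add_comm]
    exact ⟨_, hP hx ht.1 (sub_nonneg.2 ht.2) (add_sub_cancel _ _), rfl⟩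
  · rintro _ ⟨x, hx, rfl⟩ t ht
    simp only [hgf (hPD (hQP hx))]
    rw [add_comm]
    exact ⟨_, hQ hx ht.1 (sub_nonneg.2 ht.2) (add_sub_cancel _ _), rfl⟩
  · rintro _ ⟨x, hx, rfl⟩
    refine ⟨z, hz, ?_⟩
    simp only [sub_self, one_smul, zero_smul, zero_add]

lemma relRank_image_of_starConvex (hf : ContinuousOn f D) (hg : ContinuousOn g (f '' D))
    (hgf : Set.LeftInvOn g f D) {z : Fin m → ℝ} (hz : z ∈ D) (hD : StarConvex ℝ z D) {r : ℕ}
    (hr : ∀ x, Module.rank ℚ (L.obj x) ≤ r) (q : ℕ) :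
    relRank L (simplicesIn (f '' D)) ⊥ q ≤ ((if q = 0 then r else 0 : ℕ) : Cardinal) := by
  have h1 := relRank_image_eq_zero_of_starConvex (L := L) hf hg hgf
    (Set.singleton_subset_iff.2 hz) le_rfl (Set.mem_singleton z) hD (starConvex_singleton z) q
  refine (relRank_le_add_of_triple L (T := simplicesIn (f '' {z})) bot_le
    (simplicesIn_mono (Set.image_mono (Set.singleton_subset_iff.2 hz))) q).trans ?_
  rw [h1, zero_add, Set.image_singleton]
  exact relRank_point (f z) (hr _) q

/-- Excision for relatively open subsets of a cell. -/
lemma relRank_image_union_le (hg : ContinuousOn g (f '' D)) (hgf : Set.LeftInvOn g f D)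
    {O O' : Set (Fin m → ℝ)} (hO : IsOpen O) (hO' : IsOpen O') (q : ℕ) :
    relRank L (simplicesIn (f '' (D ∩ O ∪ D ∩ O'))) (simplicesIn (f '' (D ∩ O))) q ≤
      relRank L (simplicesIn (f '' (D ∩ O'))) (simplicesIn (f '' (D ∩ O ∩ (D ∩ O')))) q := by
  -- Continuity of the inverse chart turns open sets of the model into traces of open sets of `X`,
  -- as excision requires.
  obtain ⟨U, hU, hUe⟩ := continuousOn_iff'.1 hg O hO
  obtain ⟨V, hV, hVe⟩ := continuousOn_iff'.1 hg O' hO'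
  have hsub : ∀ (P : Set (Fin m → ℝ)) (W : Set X), g ⁻¹' P ∩ f '' D = W ∩ f '' D →
      f '' (D ∩ P) = W ∩ f '' D := by
    intro P W hW
    rw [← hW]
    ext y
    constructor
    · rintro ⟨x, ⟨hx, hxP⟩, rfl⟩
      exact ⟨by rwa [Set.mem_preimage, hgf hx], x, hx, rfl⟩
    · rintro ⟨hy, x, hx, rfl⟩
      rw [Set.mem_preimage, hgf hx] at hy
      exact ⟨x, ⟨hx, hy⟩, rfl⟩
  have e1 := hsub O U hUe
  have e2 := hsub O' V hVe
  rw [Set.image_union, hgf.injOn.image_inter Set.inter_subset_left Set.inter_subset_left, e1, e2]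
  refine relRank_union_le hU hV ?_ ?_ ?_ q
  · rintro y ⟨hy, hy'⟩
    exact ⟨hy, hy'.elim And.right And.right⟩
  · rintro y ⟨hy, hy'⟩
    exact ⟨hy, hy'.elim And.right And.right⟩
  · exact Set.union_subset_union Set.inter_subset_left Set.inter_subset_left

/-- The subspace where the first `j` coordinates vanish. -/
def coordSubspace (m j : ℕ) : Set (Fin m → ℝ) := {x | ∀ i : Fin m, i.1 < j → x i = 0}

lemma isClosed_coordSubspace (m j : ℕ) : IsClosed (coordSubspace m j) := by
  have : coordSubspace m j = ⋂ i : Fin m, ⋂ _ : i.1 < j, {x | x i = 0} := by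
    ext x
    simp only [coordSubspace, Set.mem_iInter]
    rfl
  rw [this]
  exact isClosed_iInter fun i => isClosed_iInter fun _ =>
    isClosed_eq (continuous_apply i) continuous_const

/-- The points that are not in the closed half space, given by a sign, of a coordinate subspace. -/
def signedOpen (m : ℕ) (j : Fin m) (ε : ℝ) : Set (Fin m → ℝ) :=
  {x | x ∈ coordSubspace m j → 0 < ε * x j}

lemma isOpen_signedOpen (m : ℕ) (j : Fin m) (ε : ℝ) : IsOpen (signedOpen m j ε) := by
  have : signedOpen m j ε = (coordSubspace m j)ᶜ ∪ {x | 0 < ε * x j} := by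
    ext x
    exact imp_iff_not_or
  rw [this]
  exact (isClosed_coordSubspace m j).isOpen_compl.union
    (isOpen_lt continuous_const (continuous_const.mul (continuous_apply j)))

lemma signedOpen_union (m : ℕ) (j : Fin m) :
    signedOpen m j 1 ∪ signedOpen m j (-1) = (coordSubspace m (j + 1))ᶜ := by
  ext x
  have h : x ∈ coordSubspace m (j + 1) ↔ x ∈ coordSubspace m j ∧ x j = 0 := by
    constructor
    · exact fun h => ⟨fun i hi => h i (by omega), h j (Nat.lt_succ_self _)⟩
    · rintro ⟨h, h'⟩ i hi
      rcases Nat.lt_succ_iff_lt_or_eq.1 hi with hi | hi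
      · exact h i hi
      · rwa [Fin.ext hi]
  rw [Set.mem_compl_iff, h, Set.mem_union]
  simp only [signedOpen, one_mul, neg_one_mul, neg_pos, Set.mem_ofPred_eq]
  constructor
  · rintro (h | h) ⟨h1, h2⟩
    · exact (h h1).ne' h2
    · exact (h h1).ne h2
  · intro h
    by_cases hx : x ∈ coordSubspace m j
    · rcases lt_trichotomy (x j) 0 with h' | h' | h'
      · exact Or.inr fun _ => h'
      · exact absurd ⟨hx, h'⟩ h
      · exact Or.inl fun _ => h'
    · exact Or.inl fun h' => absurd h' hx

lemma signedOpen_inter (m : ℕ) (j : Fin m) :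
    signedOpen m j 1 ∩ signedOpen m j (-1) = (coordSubspace m j)ᶜ := by
  ext x
  rw [Set.mem_compl_iff]
  constructor
  · rintro ⟨h1, h2⟩ h
    have h1 := h1 h
    have h2 := h2 h
    linarith
  · exact fun h => ⟨fun h' => absurd h' h, fun h' => absurd h' h⟩

lemma starConvex_signedOpen {m : ℕ} (j : Fin m) {ε : ℝ} (hε : ε * ε = 1) :
    StarConvex ℝ (Pi.single j (ε / 2)) (Metric.ball 0 1 ∩ signedOpen m j ε) ∧
      Pi.single j (ε / 2) ∈ Metric.ball (0 : Fin m → ℝ) 1 ∩ signedOpen m j ε := by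
  have hz : Pi.single j (ε / 2) ∈ Metric.ball (0 : Fin m → ℝ) 1 := by
    rw [mem_ball_zero_iff, Pi.norm_single, Real.norm_eq_abs, abs_div]
    have : |ε| = 1 := by rcases mul_self_eq_one_iff.1 hε with rfl | rfl <;> norm_num
    rw [this]
    norm_num
  refine ⟨fun y hy a b ha hb hab => ⟨?_, fun h => ?_⟩, hz, fun _ => ?_⟩
  · exact (convex_ball (0 : Fin m → ℝ) 1) hz hy.1 ha hb hab
  · have e : ε * ((a • Pi.single j (ε / 2) + b • y : Fin m → ℝ) j) = a / 2 + b * (ε * y j) := by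
      rw [Pi.add_apply, Pi.smul_apply, Pi.smul_apply, Pi.single_eq_same, smul_eq_mul, smul_eq_mul]
      linear_combination (a / 2) * hε
    rw [e]
    rcases hb.eq_or_lt with rfl | hb
    · rw [add_zero] at hab
      rw [hab]
      norm_num
    -- The centre has zero coordinates before `j`. A point of the segment with `b > 0` can then lie
    -- in the coordinate subspace only if `y` does.
    · have hy' : y ∈ coordSubspace m j := by
        intro i hi
        have := h i hi
        rw [Pi.add_apply, Pi.smul_apply, Pi.smul_apply, Pi.single_eq_of_ne (Fin.ne_of_lt hi),
          smul_zero, zero_add, smul_eq_mul] at this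
        exact (mul_eq_zero.1 this).resolve_left hb.ne'
      have := hy.2 hy'
      positivity
  · rw [Pi.single_eq_same, ← mul_div_assoc, hε]
    norm_num

/-- The cohomology of an open cell relative to the complement of a coordinate subspace. -/
lemma relRank_ball_le (hf : ContinuousOn f (Metric.ball 0 1))
    (hg : ContinuousOn g (f '' Metric.ball 0 1)) (hgf : Set.LeftInvOn g f (Metric.ball 0 1)) {r : ℕ}
    (hr : ∀ x, Module.rank ℚ (L.obj x) ≤ r) (j : ℕ) (hj : j ≤ m) (q : ℕ) :
    relRank L (simplicesIn (f '' Metric.ball 0 1))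
      (simplicesIn (f '' (Metric.ball 0 1 ∩ (coordSubspace m j)ᶜ))) q ≤
        ((if q = j then r else 0 : ℕ) : Cardinal) := by
  induction j generalizing q with
  | zero =>
    have h0 : (coordSubspace m 0)ᶜ = ∅ := by
      rw [Set.compl_empty_iff]
      exact Set.eq_univ_of_forall fun x i hi => absurd hi (Nat.not_lt_zero _)
    rw [h0, Set.inter_empty, Set.image_empty, simplicesIn_empty]
    exact relRank_image_of_starConvex hf hg hgf (Metric.mem_ball_self one_pos)
      ((convex_ball 0 1).starConvex (Metric.mem_ball_self one_pos)) hr q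
  | succ j ih =>
    -- The complement of the smaller coordinate subspace is `P ∪ N`, that of the larger one is `P ∩
    -- N`, and `P`, `N` and the ball are star-shaped. Up to inequalities of ranks, `H^{q+1}(D, P ∪
    -- N)` is compared with `H^q(P ∪ N, P)`, then with `H^q(N, P ∩ N)` by excision, then with
    -- `H^q(D, P ∩ N)`. No cohomology of spheres is needed.
    let k : Fin m := ⟨j, hj⟩
    set D : Set (Fin m → ℝ) := Metric.ball 0 1
    set P := D ∩ signedOpen m k 1
    set N := D ∩ signedOpen m k (-1)
    have hPN : D ∩ (coordSubspace m (j + 1))ᶜ = P ∪ N := by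
      rw [← Set.inter_union_distrib_left, signedOpen_union]
    have hPN' : P ∩ N = D ∩ (coordSubspace m j)ᶜ := by
      rw [← Set.inter_inter_distrib_left, signedOpen_inter]
    have hPD : P ⊆ D := Set.inter_subset_left
    have hND : N ⊆ D := Set.inter_subset_left
    obtain ⟨hPs, hPz⟩ := starConvex_signedOpen k (ε := 1) (by norm_num)
    obtain ⟨hNs, hNz⟩ := starConvex_signedOpen k (ε := -1) (by norm_num)
    have hDP : ∀ q, relRank L (simplicesIn (f '' D)) (simplicesIn (f '' P)) q = 0 := fun q =>
      relRank_image_eq_zero_of_starConvex hf hg hgf hPD le_rfl hPz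
        ((convex_ball 0 1).starConvex hPz.1) hPs q
    have hDN : ∀ q, relRank L (simplicesIn (f '' D)) (simplicesIn (f '' N)) q = 0 := fun q =>
      relRank_image_eq_zero_of_starConvex hf hg hgf hND le_rfl hNz
        ((convex_ball 0 1).starConvex hNz.1) hNs q
    have hmono : ∀ {A B : Set (Fin m → ℝ)}, A ⊆ B → simplicesIn (f '' A) ≤ simplicesIn (f '' B) :=
      fun h => simplicesIn_mono (Set.image_mono h)
    rw [hPN]
    cases q with
    | zero =>
      refine (relRank_zero_le L (hmono Set.subset_union_left)).trans ?_
      rw [hDP]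
      exact zero_le
    | succ q =>
      refine (relRank_succ_le_add_of_triple L (R := simplicesIn (f '' P))
        (hmono Set.subset_union_left) (hmono (Set.union_subset hPD hND)) q).trans ?_
      rw [hDP, add_zero]
      refine (relRank_image_union_le hg hgf (isOpen_signedOpen _ _ _) (isOpen_signedOpen _ _ _)
        q).trans ?_
      refine (relRank_le_add_succ_of_triple L (S := simplicesIn (f '' D))
        (hmono Set.inter_subset_right) (hmono hND) q).trans ?_
      rw [hDN, add_zero, hPN']
      simpa only [Nat.add_right_cancel_iff] using ih (Nat.le_of_succ_le hj) q

end Cell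

/-! ## Attaching a cell -/

section Attach

variable {X : Type u} [TopologicalSpace X] [T2Space X]
  {L : FundamentalGroupoid X ⥤ ModuleCat.{w} ℚ} {m : ℕ} {f : (Fin m → ℝ) → X}
  {g : X → Fin m → ℝ} {Y : Set X}

/-- The homotopy that pushes the points of a ball radially to the boundary. -/
def radialPush (x : Fin m → ℝ) (t : ℝ) : Fin m → ℝ := ((1 - t) + t / ‖x‖) • x

lemma norm_radialPush {x : Fin m → ℝ} (hx : x ≠ 0) {t : ℝ} (ht : t ∈ Set.Icc (0 : ℝ) 1) :
    ‖radialPush x t‖ = (1 - t) * ‖x‖ + t := by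
  have h1 : 0 ≤ 1 - t := sub_nonneg.2 ht.2
  have h2 : 0 ≤ t := ht.1
  have h3 : 0 < ‖x‖ := norm_pos_iff.2 hx
  rw [radialPush, norm_smul, Real.norm_of_nonneg (by positivity)]
  field_simp

lemma radialPush_mem {x : Fin m → ℝ} (hx : x ≠ 0) (hx1 : ‖x‖ ≤ 1) {t : ℝ}
    (ht : t ∈ Set.Icc (0 : ℝ) 1) : radialPush x t ∈ Metric.closedBall 0 1 ∧ radialPush x t ≠ 0 := by
  have h1 : 0 ≤ 1 - t := sub_nonneg.2 ht.2
  have h2 : 0 ≤ t := ht.1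
  have h3 : 0 < ‖x‖ := norm_pos_iff.2 hx
  rw [mem_closedBall_zero_iff, ← norm_pos_iff, norm_radialPush hx ht]
  constructor
  · nlinarith
  · rcases h2.eq_or_lt with rfl | h2
    · simpa using h3
    · positivity

lemma continuousOn_radialPush : ContinuousOn (fun y : (Fin m → ℝ) × ℝ => radialPush y.1 y.2)
    ((Metric.closedBall 0 1 ∩ {0}ᶜ) ×ˢ Set.Icc 0 1) := by
  refine ContinuousOn.smul
    (ContinuousOn.add (continuousOn_const.sub continuousOn_snd) ?_) continuousOn_fst
  exact ContinuousOn.div continuousOn_snd (continuous_norm.comp_continuousOn continuousOn_fst)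
    fun y hy => norm_ne_zero_iff.2 hy.1.2

/-- A space with a cell attached, without the center of the cell, deforms to the space. -/
lemma relRank_attach_compl_center (hY : IsClosed Y) (hf : ContinuousOn f (Metric.closedBall 0 1))
    (hgf : Set.LeftInvOn g f (Metric.ball 0 1)) (hfY : Set.MapsTo f (Metric.sphere 0 1) Y)
    (hdisj : Disjoint (f '' Metric.ball 0 1) Y) (q : ℕ) :
    relRank L (simplicesIn ((Y ∪ f '' Metric.ball 0 1) \ {f 0})) (simplicesIn Y) q = 0 := by
  classical
  have h0Y : f 0 ∉ Y := Set.disjoint_left.1 hdisj ⟨0, Metric.mem_ball_self one_pos, rfl⟩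
  have hnotY : ∀ x, ‖x‖ < 1 → f x ∉ Y := fun x hx =>
    Set.disjoint_left.1 hdisj ⟨x, mem_ball_zero_iff.2 hx, rfl⟩
  have hsY : ∀ x, ‖x‖ = 1 → f x ∈ Y := fun x hx => hfY (mem_sphere_zero_iff_norm.2 hx)
  have hne : ∀ x, ‖x‖ ≤ 1 → x ≠ 0 → f x ≠ f 0 := by
    intro x hx hx0 h
    rcases hx.lt_or_eq with hx | hx
    · exact hx0 (hgf.injOn (mem_ball_zero_iff.2 hx) (Metric.mem_ball_self one_pos) h)
    · exact h0Y (h ▸ hsY x hx)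
  -- The two prescriptions agree on the boundary of the cell, since the radial push fixes the unit
  -- sphere.
  let h : X → ℝ → X := fun x t => if x ∈ Y then x else f (radialPush (g x) t)
  have hhY : ∀ x ∈ Y, ∀ t, h x t = x := fun x hx t => if_pos hx
  have hhf : ∀ x, ‖x‖ ≤ 1 → x ≠ 0 → ∀ t, h (f x) t = f (radialPush x t) := by
    intro x hx hx0 t
    rcases hx.lt_or_eq with hx | hx
    · change (if f x ∈ Y then f x else f (radialPush (g (f x)) t)) = _
      rw [if_neg (hnotY x hx), hgf (mem_ball_zero_iff.2 hx)]
    · rw [hhY _ (hsY x hx)]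
      congr 1
      rw [radialPush, hx, div_one, sub_add_cancel, one_smul]
  have hcases : ∀ y ∈ (Y ∪ f '' Metric.ball 0 1) \ {f 0},
      y ∈ Y ∨ ∃ x, ‖x‖ < 1 ∧ x ≠ 0 ∧ f x = y := by
    rintro y ⟨hy | ⟨x, hx, rfl⟩, hy0⟩
    · exact Or.inl hy
    · exact Or.inr ⟨x, mem_ball_zero_iff.1 hx, fun h => hy0 (by rw [h]; rfl), rfl⟩
  have hYsub : Y ⊆ (Y ∪ f '' Metric.ball 0 1) \ {f 0} := fun y hy =>
    ⟨Or.inl hy, fun h => h0Y (by rwa [← (h : y = f 0)])⟩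
  have hmem : ∀ x, ‖x‖ ≤ 1 → x ≠ 0 → f x ∈ (Y ∪ f '' Metric.ball 0 1) \ {f 0} := by
    intro x hx hx0
    refine ⟨?_, hne x hx hx0⟩
    rcases hx.lt_or_eq with hx | hx
    · exact Or.inr ⟨x, mem_ball_zero_iff.2 hx, rfl⟩
    · exact Or.inl (hsY x hx)
  refine relRank_eq_zero_of_homotopy h ?_ ?_ ?_ hYsub (fun x hx t _ => by rwa [hhY x hx]) ?_ q
  -- The inverse chart need not extend to the closed cell, so continuity is checked on closed sets.
  -- The preimage of `C` is the trace of a closed part over `Y` and of the image under `f` of a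
  -- compact set, closed since `X` is Hausdorff.
  · rw [continuousOn_iff_isClosed]
    intro C hC
    have hγ : ContinuousOn (fun y : (Fin m → ℝ) × ℝ => f (radialPush y.1 y.2))
        ((Metric.closedBall 0 1 ∩ {0}ᶜ) ×ˢ Set.Icc 0 1) :=
      hf.comp continuousOn_radialPush fun y hy =>
        (radialPush_mem hy.1.2 (mem_closedBall_zero_iff.1 hy.1.1) hy.2).1
    obtain ⟨K, hK, hKe⟩ := continuousOn_iff_isClosed.1 hγ C hC
    have hcomp : IsCompact (K ∩ Metric.closedBall (0 : Fin m → ℝ) 1 ×ˢ Set.Icc (0 : ℝ) 1) :=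
      ((isCompact_closedBall _ _).prod isCompact_Icc).inter_left hK
    have hG : IsClosed ((fun y : (Fin m → ℝ) × ℝ => (f y.1, y.2)) ''
        (K ∩ Metric.closedBall 0 1 ×ˢ Set.Icc 0 1)) := by
      refine (hcomp.image_of_continuousOn ?_).isClosed
      refine ContinuousOn.prodMk (hf.comp continuousOn_fst fun y hy => hy.2.1) continuousOn_snd
    refine ⟨(Y ∩ C) ×ˢ Set.univ ∪ _, ((hY.inter hC).prod isClosed_univ).union hG, ?_⟩
    have hKmem : ∀ x, ‖x‖ ≤ 1 → x ≠ 0 → ∀ t ∈ Set.Icc (0 : ℝ) 1,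
        ((x, t) ∈ K ↔ f (radialPush x t) ∈ C) := by
      intro x hx hx0 t ht
      have hs : (x, t) ∈ (Metric.closedBall (0 : Fin m → ℝ) 1 ∩ {0}ᶜ) ×ˢ Set.Icc (0 : ℝ) 1 :=
        ⟨⟨mem_closedBall_zero_iff.2 hx, hx0⟩, ht⟩
      have := Set.ext_iff.1 hKe (x, t)
      exact ⟨fun h => (this.2 ⟨h, hs⟩).1, fun h => (this.1 ⟨h, hs⟩).1⟩
    ext ⟨y, t⟩
    constructor
    · rintro ⟨hyC, hy, ht⟩
      refine ⟨?_, hy, ht⟩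
      rcases hcases y hy with hyY | ⟨x, hx, hx0, rfl⟩
      · rw [Set.mem_preimage, hhY y hyY] at hyC
        exact Or.inl ⟨⟨hyY, hyC⟩, trivial⟩
      · rw [Set.mem_preimage, hhf x hx.le hx0] at hyC
        exact Or.inr ⟨(x, t), ⟨(hKmem x hx.le hx0 t ht).2 hyC, mem_closedBall_zero_iff.2 hx.le, ht⟩,
          rfl⟩
    · rintro ⟨⟨⟨hyY, hyC⟩, -⟩ | ⟨⟨x, t'⟩, ⟨hxK, hx, ht'⟩, hxy⟩, hy, ht⟩
      · refine ⟨?_, hy, ht⟩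
        rw [Set.mem_preimage, hhY y hyY]
        exact hyC
      · obtain ⟨rfl, rfl⟩ := Prod.mk.inj hxy
        refine ⟨?_, hy, ht⟩
        have hx1 := mem_closedBall_zero_iff.1 hx
        have hx0 : x ≠ 0 := fun h => hy.2 (by rw [show x = 0 from h]; rfl)
        rw [Set.mem_preimage, hhf x hx1 hx0]
        exact (hKmem x hx1 hx0 _ ht).1 hxK
  · intro y hy
    rcases hcases y hy with hyY | ⟨x, hx, hx0, rfl⟩
    · exact hhY y hyY 0
    · rw [hhf x hx.le hx0, radialPush, zero_div, sub_zero, add_zero, one_smul]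
  · intro y hy t ht
    rcases hcases y hy with hyY | ⟨x, hx, hx0, rfl⟩
    · rwa [hhY y hyY t]
    · rw [hhf x hx.le hx0]
      obtain ⟨h1, h2⟩ := radialPush_mem hx0 hx.le ht
      exact hmem _ (mem_closedBall_zero_iff.1 h1) h2
  · intro y hy
    rcases hcases y hy with hyY | ⟨x, hx, hx0, rfl⟩
    · rwa [hhY y hyY]
    · rw [hhf x hx.le hx0]
      refine hsY _ ?_
      rw [norm_radialPush hx0 ⟨zero_le_one, le_rfl⟩, sub_self, zero_mul, zero_add]

/-- The cohomology of a space with a cell attached, relative to the space. -/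
lemma relRank_attach_le (hY : IsClosed Y) (hf : ContinuousOn f (Metric.closedBall 0 1))
    (hg : ContinuousOn g (f '' Metric.ball 0 1)) (hgf : Set.LeftInvOn g f (Metric.ball 0 1))
    (hfY : Set.MapsTo f (Metric.sphere 0 1) Y) (hdisj : Disjoint (f '' Metric.ball 0 1) Y) {r : ℕ}
    (hr : ∀ x, Module.rank ℚ (L.obj x) ≤ r) (q : ℕ) :
    relRank L (simplicesIn (Y ∪ f '' Metric.ball 0 1)) (simplicesIn Y) q ≤
      ((if q = m then r else 0 : ℕ) : Cardinal) := by
  have h0 : (0 : Fin m → ℝ) ∈ Metric.ball (0 : Fin m → ℝ) 1 := Metric.mem_ball_self one_pos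
  have h0Y : f 0 ∉ Y := Set.disjoint_left.1 hdisj ⟨0, h0, rfl⟩
  set e := f '' Metric.ball 0 1 with he
  have hYU : Y ⊆ (Y ∪ e) \ {f 0} := fun y hy =>
    ⟨Or.inl hy, fun h => h0Y (by rwa [← (h : y = f 0)])⟩
  have hunion : (Y ∪ e) \ {f 0} ∪ e = Y ∪ e := by
    refine Set.Subset.antisymm (Set.union_subset Set.sdiff_subset Set.subset_union_right) ?_
    exact Set.union_subset_union_left _ hYU
  have hcenter : (coordSubspace m m)ᶜ = {0}ᶜ := by
    congr 1
    ext x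
    exact ⟨fun h => funext fun i => h i i.2, fun h i _ => congrFun h i⟩
  have hinter : (Y ∪ e) \ {f 0} ∩ e = f '' (Metric.ball 0 1 ∩ (coordSubspace m m)ᶜ) := by
    rw [hcenter]
    ext y
    constructor
    · rintro ⟨⟨-, hy0⟩, x, hx, rfl⟩
      exact ⟨x, ⟨hx, fun h => hy0 (by rw [show x = 0 from h]; rfl)⟩, rfl⟩
    · rintro ⟨x, ⟨hx, hx0⟩, rfl⟩
      exact ⟨⟨Or.inr ⟨x, hx, rfl⟩, fun h => hx0 (hgf.injOn hx h0 h)⟩, x, hx, rfl⟩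
  -- Removing the centre of the cell makes `Y` relatively open up to deformation. Excision of `Y`
  -- then leaves the open cell relative to the complement of its centre.
  refine (relRank_le_add_of_triple L (T := simplicesIn ((Y ∪ e) \ {f 0})) (simplicesIn_mono hYU)
    (simplicesIn_mono Set.sdiff_subset) q).trans ?_
  rw [relRank_attach_compl_center hY hf hgf hfY hdisj, add_zero]
  have h1 := relRank_union_le (L := L) (A := (Y ∪ e) \ {f 0}) (B := e) (U := {f 0}ᶜ) (V := Yᶜ)
    isOpen_compl_singleton hY.isOpen_compl (by
      rw [hunion]
      exact fun y hy => ⟨hy.2, hy.1⟩) (by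
      rw [hunion]
      exact fun y hy => hy.2.resolve_left hy.1) (by
      rw [hunion]
      intro y _
      by_cases hy : y ∈ Y
      · exact Or.inl fun h => h0Y (by rwa [← (h : y = f 0)])
      · exact Or.inr hy) q
  rw [hunion, hinter] at h1
  exact h1.trans (relRank_ball_le (hf.mono Metric.ball_subset_closedBall) hg hgf hr m le_rfl q)

end Attach


/-! ## Cohomology of CW complexes of finite type -/

section CW

open Topology RelCWComplex

variable {X : Type u} [TopologicalSpace X] [T2Space X] [Topology.CWComplex (Set.univ : Set X)]
  {L : FundamentalGroupoid X ⥤ ModuleCat.{w} ℚ}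

/-- The union of the cells of dimension less than `m` and some cells of dimension `m`. -/
def partialSkeleton (m : ℕ) (s : Finset (cell (Set.univ : Set X) m)) : Set X :=
  (skeletonLT (Set.univ : Set X) m : Set X) ∪ ⋃ i ∈ s, closedCell m i

lemma isClosed_partialSkeleton (m : ℕ) (s : Finset (cell (Set.univ : Set X) m)) :
    IsClosed (partialSkeleton m s) :=
  (skeletonLT (Set.univ : Set X) m).closed'.union
    (isClosed_biUnion_finset fun _ _ => isClosed_closedCell)

lemma partialSkeleton_insert [DecidableEq (cell (Set.univ : Set X) m)]
    (s : Finset (cell (Set.univ : Set X) m)) (i : cell (Set.univ : Set X) m) :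
    partialSkeleton m (insert i s) = partialSkeleton m s ∪ openCell m i := by
  have h : closedCell m i ∪ (skeletonLT (Set.univ : Set X) m : Set X) =
      openCell m i ∪ (skeletonLT (Set.univ : Set X) m : Set X) := by
    rw [← cellFrontier_union_openCell_eq_closedCell, Set.union_comm (cellFrontier m i),
      Set.union_assoc, Set.union_eq_self_of_subset_left (cellFrontier_subset_skeletonLT m i)]
  rw [partialSkeleton, partialSkeleton, Finset.set_biUnion_insert, ← Set.union_assoc,
    Set.union_comm _ (closedCell m i), h, Set.union_comm (openCell m i), Set.union_right_comm]

lemma disjoint_openCell_partialSkeleton {m : ℕ} {s : Finset (cell (Set.univ : Set X) m)}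
    {i : cell (Set.univ : Set X) m} (hi : i ∉ s) :
    Disjoint (openCell m i) (partialSkeleton m s) := by
  have h1 : Disjoint (openCell m i) (skeletonLT (Set.univ : Set X) m : Set X) :=
    (disjoint_skeletonLT_openCell le_rfl).symm
  refine h1.union_right ?_
  simp only [Set.disjoint_iUnion_right]
  intro j hj
  rw [← cellFrontier_union_openCell_eq_closedCell]
  refine (h1.mono_right (cellFrontier_subset_skeletonLT m j)).union_right ?_
  refine disjoint_openCell_of_ne fun h => ?_
  exact hi (by rw [eq_of_heq (Sigma.mk.inj h).2]; exact hj)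

/-- The cells are attached one at a time, and each adds at most `r`, in degree `m` only. -/
lemma relRank_partialSkeleton_le {r : ℕ} (hr : ∀ x, Module.rank ℚ (L.obj x) ≤ r) (m : ℕ)
    (s : Finset (cell (Set.univ : Set X) m)) (q : ℕ) :
    relRank L (simplicesIn (partialSkeleton m s))
      (simplicesIn (skeletonLT (Set.univ : Set X) m : Set X)) q ≤
        ((if q = m then s.card * r else 0 : ℕ) : Cardinal) := by
  classical
  induction s using Finset.induction_on with
  | empty =>
    have : partialSkeleton m (∅ : Finset (cell (Set.univ : Set X) m)) =
        (skeletonLT (Set.univ : Set X) m : Set X) := by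
      simp [partialSkeleton]
    rw [this, relRank_self]
    exact zero_le
  | insert i s hi ih =>
    have hsub : (skeletonLT (Set.univ : Set X) m : Set X) ⊆ partialSkeleton m s :=
      Set.subset_union_left
    refine (relRank_le_add_of_triple L (T := simplicesIn (partialSkeleton m s))
      (simplicesIn_mono hsub) (simplicesIn_mono ?_) q).trans ?_
    · rw [partialSkeleton_insert]
      exact Set.subset_union_left
    · have h1 := relRank_attach_le (L := L) (isClosed_partialSkeleton m s)
        (RelCWComplex.continuousOn m i) (g := (RelCWComplex.map m i).symm) (by
          have := RelCWComplex.continuousOn_symm m i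
          rwa [← PartialEquiv.image_source_eq_target, RelCWComplex.source_eq] at this)
        (by
          have := (RelCWComplex.map m i).leftInvOn
          rwa [RelCWComplex.source_eq] at this)
        (fun x hx => hsub (cellFrontier_subset_skeletonLT m i ⟨x, hx, rfl⟩))
        (disjoint_openCell_partialSkeleton hi) hr q
      rw [partialSkeleton_insert]
      refine (add_le_add h1 ih).trans ?_
      rw [← Nat.cast_add, Nat.cast_le, Finset.card_insert_of_notMem hi]
      split_ifs
      · rw [Nat.succ_mul, add_comm]
      · exact le_rfl

lemma monotone_simplicesIn_skeletonLT :
    Monotone fun m : ℕ => simplicesIn (skeletonLT (Set.univ : Set X) m : Set X) :=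
  fun _ _ h => simplicesIn_mono (skeletonLT_mono (by exact_mod_cast h))

/-- A compact subset of a CW complex is contained in a skeleton. -/
lemma exists_subset_skeletonLT {K : Set X} (hK : IsCompact K) :
    ∃ m : ℕ, K ⊆ skeletonLT (Set.univ : Set X) m := by
  by_contra! hcon
  have hcon : ∀ m : ℕ, ∃ x ∈ K, x ∉ (skeletonLT (Set.univ : Set X) m : Set X) :=
    fun m => Set.not_subset.1 (hcon m)
  choose x hxK hx using hcon
  have hx' : ∀ m k : ℕ, m ≤ k → x k ∉ (skeletonLT (Set.univ : Set X) m : Set X) :=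
    fun m k h hmem => hx k (skeletonLT_mono (by exact_mod_cast h) hmem)
  -- A closed cell contains only finitely many of the chosen points, which makes each tail closed.
  -- By compactness some point lies in all tails, yet it belongs to a skeleton that late tails
  -- avoid.
  have hclosed : ∀ k, IsClosed (x '' Set.Ici k) := by
    intro k
    rw [CWComplex.closed Set.univ _ (Set.subset_univ _)]
    intro n j
    refine ((Set.finite_Iic n).image x).subset ?_ |>.isClosed
    rintro _ ⟨⟨i, -, rfl⟩, hi⟩
    refine ⟨i, Set.mem_Iic.2 (not_lt.1 fun h => ?_), rfl⟩
    exact hx' (n + 1) i h (closedCell_subset_skeletonLT n j hi)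
  obtain ⟨y, hy⟩ := IsCompact.nonempty_iInter_of_sequence_nonempty_isCompact_isClosed
    (fun k => x '' Set.Ici k) (fun k => Set.image_mono (Set.Ici_subset_Ici.2 k.le_succ))
    (fun k => ⟨x k, k, Set.mem_Ici.2 le_rfl, rfl⟩)
    (hK.of_isClosed_subset (hclosed 0) (Set.image_subset_iff.2 fun k _ => hxK k)) hclosed
  have hy' : y ∈ ⋃ n : ℕ, (skeletonLT (Set.univ : Set X) n : Set X) := by
    rw [iUnion_skeletonLT_eq_complex]
    trivial
  obtain ⟨m, hm⟩ := Set.mem_iUnion.1 hy'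
  obtain ⟨k, hk, rfl⟩ := Set.mem_iInter.1 hy m
  exact hx' m k hk hm

variable [Topology.RelCWComplex.FiniteType (Set.univ : Set X)]

lemma exists_relRank_skeleton_le {r : ℕ} (hr : ∀ x, Module.rank ℚ (L.obj x) ≤ r) (m q : ℕ) :
    ∃ d : ℕ, relRank L (simplicesIn (skeletonLT (Set.univ : Set X) (m + 1 : ℕ) : Set X))
      (simplicesIn (skeletonLT (Set.univ : Set X) m : Set X)) q ≤
        ((if q = m then d else 0 : ℕ) : Cardinal) := by
  have : Finite (cell (Set.univ : Set X) m) := FiniteType.finite_cell m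
  have : Fintype (cell (Set.univ : Set X) m) := Fintype.ofFinite _
  refine ⟨(Finset.univ : Finset (cell (Set.univ : Set X) m)).card * r, ?_⟩
  have h := relRank_partialSkeleton_le hr m (Finset.univ : Finset (cell (Set.univ : Set X) m)) q
  have e : partialSkeleton m (Finset.univ : Finset (cell (Set.univ : Set X) m)) =
      (skeletonLT (Set.univ : Set X) (m + 1 : ℕ) : Set X) := by
    rw [partialSkeleton]
    simp only [Finset.mem_univ, Set.iUnion_true]
    exact skeletonLT_union_iUnion_closedCell_eq_skeletonLT_succ m
  rwa [e] at h

lemma relRank_skeleton_lt_aleph0 {r : ℕ} (hr : ∀ x, Module.rank ℚ (L.obj x) ≤ r) (m q : ℕ) :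
    relRank L (simplicesIn (skeletonLT (Set.univ : Set X) m : Set X)) ⊥ q < Cardinal.aleph0 := by
  induction m with
  | zero =>
    have : (skeletonLT (Set.univ : Set X) ((0 : ℕ) : ℕ∞) : Set X) = ∅ :=
      CWComplex.skeletonLT_zero_eq_empty
    rw [this, simplicesIn_empty, relRank_self]
    exact Cardinal.aleph0_pos
  | succ m ih =>
    obtain ⟨d, hd⟩ := exists_relRank_skeleton_le hr m q
    refine (relRank_le_add_of_triple L bot_le (monotone_simplicesIn_skeletonLT m.le_succ)
      q).trans_lt ?_
    exact Cardinal.add_lt_aleph0 (hd.trans_lt (Cardinal.natCast_lt_aleph0)) ih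

/-- The cohomology of a CW complex of finite type with coefficients in a local system with finite
dimensional fibres is finite dimensional. -/
theorem finiteDimensional_cohomology {r : ℕ} (hr : ∀ x, Module.rank ℚ (L.obj x) ≤ r) (p : ℕ) :
    FiniteDimensional ℚ (Cohomology L p) := by
  refine finiteDimensional_cohomology_of_relRank_lt L ?_
  -- `skeletonLT (p + 1)` is the skeleton of dimension `p`. The cells attached afterwards have
  -- dimension greater than `p` and do not contribute in degree `p`.
  have htop : relRank L ⊤
      (simplicesIn (skeletonLT (Set.univ : Set X) (p + 1 : ℕ) : Set X)) p = 0 := by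
    refine relRank_top_eq_zero L
      (S := fun m : ℕ => simplicesIn (skeletonLT (Set.univ : Set X) m : Set X))
      (fun k => isSieve_simplicesIn _) monotone_simplicesIn_skeletonLT ?_ (p + 1) p ?_
    · intro q σ
      obtain ⟨m, hm⟩ := exists_subset_skeletonLT (isCompact_range σ.continuous)
      exact ⟨m, fun t => hm ⟨t, rfl⟩⟩
    · intro k hk
      obtain ⟨d, hd⟩ := exists_relRank_skeleton_le hr k p
      rw [if_neg (by omega), Nat.cast_zero] at hd
      exact le_antisymm hd zero_le
  refine (relRank_le_add_of_triple L
    (T := simplicesIn (skeletonLT (Set.univ : Set X) (p + 1 : ℕ) : Set X)) bot_le le_top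
    p).trans_lt ?_
  rw [htop, zero_add]
  exact relRank_skeleton_lt_aleph0 hr (p + 1) p

end CW

/-! ### Fibres of the local system of a representation. -/

section LocalSystem

variable {X : Type u} [TopologicalSpace X] {x₀ : X} {V : Type v} [AddCommGroup V] [Module ℚ V]

/-- The dimension of a fibre of a local system is at most the dimension of the representation. -/
lemma rank_localSystem_obj_le [FiniteDimensional ℚ V]
    (α : Representation ℚ (FundamentalGroup X x₀) V) (x : FundamentalGroupoid X) :
    Module.rank ℚ ((localSystem α).obj x) ≤ Module.finrank ℚ V := by
  change Module.rank ℚ (fibre α x) ≤ _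
  rcases isEmpty_or_nonempty (x ⟶ FundamentalGroupoid.mk x₀) with h | ⟨⟨γ⟩⟩
  · have : Subsingleton (fibre α x) := ⟨fun f g => Subtype.ext (funext fun γ => h.elim γ)⟩
    rw [rank_subsingleton']
    exact zero_le
  -- Any two paths from `x` to `x₀` differ by a loop at `x₀`, so equivariance determines an element
  -- of the fibre by its value on one path.
  · let e : fibre α x →ₗ[ℚ] V := LinearMap.proj γ ∘ₗ (fibre α x).subtype
    have he : Function.Injective e := by
      intro f g hfg
      refine Subtype.ext (funext fun δ => ?_)
      have hγ : γ ≫ (Groupoid.inv γ ≫ δ) = δ := by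
        rw [← Category.assoc, Groupoid.comp_inv, Category.id_comp]
      have hf := f.2 γ (FundamentalGroup.fromArrow (Groupoid.inv γ ≫ δ))
      have hg := g.2 γ (FundamentalGroup.fromArrow (Groupoid.inv γ ≫ δ))
      change f.1 (γ ≫ (Groupoid.inv γ ≫ δ)) = _ at hf
      change g.1 (γ ≫ (Groupoid.inv γ ≫ δ)) = _ at hg
      rw [hγ] at hf hg
      rw [hf, hg]
      exact congrArg _ hfg
    have := LinearMap.lift_rank_le_of_injective e he
    rwa [← Module.finrank_eq_rank ℚ V, Cardinal.lift_natCast, Cardinal.lift_le_nat_iff] at this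

end LocalSystem

end

end RepStability

theorem mainTheorem11 {X : Type u} [TopologicalSpace X] [T2Space X] [ConnectedSpace X]
    [Topology.CWComplex (Set.univ : Set X)]
    [Topology.RelCWComplex.FiniteType (Set.univ : Set X)] (x₀ : X)
    {V : ℕ → Type v} [∀ n, AddCommGroup (V n)] [∀ n, Module ℚ (V n)]
    (ρ : ∀ n, Representation ℚ (Equiv.Perm (Fin n)) (V n))
    (α : ∀ n, Representation ℚ (FundamentalGroup X x₀) (V n))
    (φ : ∀ n, V n →ₗ[ℚ] V (n + 1))
    (hcons : RepStability.IsConsistent ρ φ) (hcomp : RepStability.IsCompatible α ρ φ)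
    (N : ℕ) (hmono : RepStability.IsMonotone ρ φ N)
    (hstab : RepStability.IsUniformlyRepStable ρ φ N) (p : ℕ) :
    RepStability.IsMonotone (V := fun n => RepStability.LocalCohomology (α n) p)
        (fun n => RepStability.localCohomologyRep (α n) (ρ n) (hcomp.commute n) p)
        (fun n => RepStability.localCohomologyMap (φ n) (hcomp.equivariant n) p) N ∧
      RepStability.IsUniformlyRepStable (V := fun n => RepStability.LocalCohomology (α n) p)
        (fun n => RepStability.localCohomologyRep (α n) (ρ n) (hcomp.commute n) p)
        (fun n => RepStability.localCohomologyMap (φ n) (hcomp.equivariant n) p) N :=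
  RepStability.stability_of_finiteDimensional hcons hcomp hmono hstab p fun n =>
    have := hstab.finiteDimensional n
    RepStability.finiteDimensional_cohomology (RepStability.rank_localSystem_obj_le (α n)) p
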